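/- Let $\gamma\in\mathbb R\setminus\{0\}$, $p>1$ and $s\in(1/2,1)$. On $L^2(\mathbb R)$ let $-\Delta_\gamma$ be the operator with domain $$\mathcal D(-\Delta_\gamma)=\{f\in H^1(\mathbb R)\cap H^2(\mathbb R\setminus\{0\}) : f'(0+)-f'(0-)=-\gamma f(0)\},\qquad -\Delta_\gamma f=-\partial_x^2 f \text{ on } \mathbb R\setminus\{0\}.$$ Then $i\Delta_\gamma$ generates a strongly continuous one-parameter unitary group $(e^{it\Delta_\gamma})_{t\in\mathbb R}$ on $L^2(\mathbb R)$, and the equation $$ i\partial_t u+\partial_x^2u+\gamma\delta u+|u|^{p-1}u=0,\qquad u(0)=u_0, \tag{$\delta$NLS}$$ is locally well-posed in $H^s(\mathbb R)$. Here, for an interval $I\ni 0$, a solution on $I$ with datum $u_0\in H^s(\mathbb R)$ is a function $u\in C(I;H^s(\mathbb R))$ with $$u(t)=e^{it\Delta_\gamma}u_0+i\int_0^t e^{i(t-\tau)\Delta_\gamma}\bigl(|u|^{p-1}u\bigr)(\tau)\,d\tau\quad\text{in } L^2(\mathbb R)\text{ for all } t\in I$$ (with $|u(t)|^{p-1}u(t)\in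 L^2(\mathbb R)$ for $t\in I$ and the integrand integrable), and local well-posedness means: 1. (Existence) For every $R>0$ there is $T=T(R,\gamma,p,s)>0$ such that for every $u_0\in H^s(\mathbb R)$ with $\|u_0\|_{H^s}\le R$ there is a solution on $[-T,T]$ with datum $u_0$. 2. (Uniqueness) For every interval $I\ni0$ and every $u_0\in H^s(\mathbb R)$, any two solutions on $I$ with datum $u_0$ coincide on $I$. 3. (Continuous dependence) If $a\le 0\le b$ and $u$ is a solution on $[a,b]$ with datum $u_0$, then for every $\varepsilon>0$ there is $\eta>0$ such that for every $v_0\in H^s(\mathbb R)$ with $\|v_0-u_0\|_{H^s}<\eta$ there is a solution $v$ on $[a,b]$ with datum $v_0$, and $\sup_{t\in[a,b]}\|v(t)-u(t)\|_{H^s}\le\varepsilon$. -/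

import Mathlib

open MeasureTheory Filter Set Topology
open scoped SchwartzMap ContDiff

noncomputable section

/-- The Hilbert space `L²(ℝ; ℂ)`. -/
abbrev L2 : Type := Lp ℂ 2 (volume : Measure ℝ)

/-! ### The Sobolev spaces `H^s(ℝ)`, `s ≥ 0` -/

/-- The elements of `L²(ℝ)` that belong to the Sobolev space of order `s`. For `s ≥ 0` these are all
the elements of `H^s(ℝ)`. -/
def sobolevSubmodule (s : ℝ) : Submodule ℂ L2 where
  carrier := {f | TemperedDistribution.MemSobolev s 2 (f : 𝓢'(ℝ, ℂ))}
  add_mem' {f g} hf hg := by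
    have h : ((f + g : L2) : 𝓢'(ℝ, ℂ)) = (f : 𝓢'(ℝ, ℂ)) + (g : 𝓢'(ℝ, ℂ)) :=
      map_add (Lp.toTemperedDistributionCLM ℂ (volume : Measure ℝ) 2) f g
    simp only [Set.mem_ofPred_eq] at *
    rw [h]
    exact hf.add hg
  zero_mem' := by
    have h : ((0 : L2) : 𝓢'(ℝ, ℂ)) = 0 :=
      map_zero (Lp.toTemperedDistributionCLM ℂ (volume : Measure ℝ) 2)
    simp only [Set.mem_ofPred_eq]
    rw [h]
    exact TemperedDistribution.memSobolev_fun_zero ℝ ℂ s 2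
  smul_mem' c f hf := by
    have h : ((c • f : L2) : 𝓢'(ℝ, ℂ)) = c • (f : 𝓢'(ℝ, ℂ)) :=
      map_smul (Lp.toTemperedDistributionCLM ℂ (volume : Measure ℝ) 2) c f
    simp only [Set.mem_ofPred_eq] at *
    rw [h]
    exact hf.smul c

/-- The Sobolev space `H^s(ℝ)` (for `s ≥ 0`), with the norm `‖f‖_{H^s} = ‖J^s f‖_{L²}` defined below. -/
def Hs (s : ℝ) : Type := ↥(sobolevSubmodule s)

instance (s : ℝ) : AddCommGroup (Hs s) := inferInstanceAs (AddCommGroup ↥(sobolevSubmodule s))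

instance (s : ℝ) : Module ℂ (Hs s) := inferInstanceAs (Module ℂ ↥(sobolevSubmodule s))

/-- The inclusion of `H^s(ℝ)` into `L²(ℝ)`. -/
def Hs.toL2 {s : ℝ} : Hs s →ₗ[ℂ] L2 := (sobolevSubmodule s).subtype

theorem Hs.toL2_injective {s : ℝ} : Function.Injective (Hs.toL2 : Hs s →ₗ[ℂ] L2) :=
  (sobolevSubmodule s).injective_subtype

theorem toTemperedDistribution_injective {f g : L2} (h : (f : 𝓢'(ℝ, ℂ)) = (g : 𝓢'(ℝ, ℂ))) :
    f = g :=
  LinearMap.ker_eq_bot.mp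
    (Lp.ker_toTemperedDistributionCLM_eq_bot (F := ℂ) (μ := (volume : Measure ℝ)) (p := 2)) h

theorem Hs.exists_bessel {s : ℝ} (f : Hs s) :
    ∃ g : L2, TemperedDistribution.besselPotential ℝ ℂ s (f.toL2 : 𝓢'(ℝ, ℂ)) = (g : 𝓢'(ℝ, ℂ)) :=
  f.2

/-- The Bessel potential `J^s : H^s(ℝ) → L²(ℝ)`, the Fourier multiplier with symbol
`(1 + ξ²)^{s/2}`, where `ξ` is the frequency for the normalization `∫ f(x) e^{-2πixξ} dx`
of the Fourier transform. -/
def Hs.bessel {s : ℝ} : Hs s →ₗ[ℂ] L2 where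
  toFun f := f.exists_bessel.choose
  map_add' f g := by
    apply toTemperedDistribution_injective
    have h1 : ((f + g).toL2 : 𝓢'(ℝ, ℂ)) = (f.toL2 : 𝓢'(ℝ, ℂ)) + (g.toL2 : 𝓢'(ℝ, ℂ)) := by
      rw [map_add]
      exact map_add (Lp.toTemperedDistributionCLM ℂ (volume : Measure ℝ) 2) f.toL2 g.toL2
    have h2 := map_add (Lp.toTemperedDistributionCLM ℂ (volume : Measure ℝ) 2)
      f.exists_bessel.choose g.exists_bessel.choose
    simp only [Lp.toTemperedDistributionCLM_apply] at h2
    rw [← (f + g).exists_bessel.choose_spec, h1, h2, map_add,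
      ← f.exists_bessel.choose_spec, ← g.exists_bessel.choose_spec]
  map_smul' c f := by
    apply toTemperedDistribution_injective
    have h1 : ((c • f).toL2 : 𝓢'(ℝ, ℂ)) = c • (f.toL2 : 𝓢'(ℝ, ℂ)) := by
      rw [map_smul]
      exact map_smul (Lp.toTemperedDistributionCLM ℂ (volume : Measure ℝ) 2) c f.toL2
    have h2 := map_smul (Lp.toTemperedDistributionCLM ℂ (volume : Measure ℝ) 2) c
      f.exists_bessel.choose
    simp only [Lp.toTemperedDistributionCLM_apply] at h2
    rw [RingHom.id_apply, ← (c • f).exists_bessel.choose_spec, h1, h2, map_smul,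
      ← f.exists_bessel.choose_spec]

theorem Hs.bessel_spec {s : ℝ} (f : Hs s) :
    TemperedDistribution.besselPotential ℝ ℂ s (f.toL2 : 𝓢'(ℝ, ℂ)) = (f.bessel : 𝓢'(ℝ, ℂ)) :=
  f.exists_bessel.choose_spec

theorem Hs.bessel_injective {s : ℝ} : Function.Injective (Hs.bessel : Hs s →ₗ[ℂ] L2) := by
  intro f g h
  apply Hs.toL2_injective
  apply toTemperedDistribution_injective
  have h2 : TemperedDistribution.besselPotential ℝ ℂ s (f.toL2 : 𝓢'(ℝ, ℂ)) =
      TemperedDistribution.besselPotential ℝ ℂ s (g.toL2 : 𝓢'(ℝ, ℂ)) := by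
    rw [f.bessel_spec, g.bessel_spec, h]
  have h3 := congrArg (TemperedDistribution.besselPotential ℝ ℂ (-s)) h2
  simpa using h3

/-- `‖f‖_{H^s} = ‖J^s f‖_{L²}`. -/
instance (s : ℝ) : NormedAddCommGroup (Hs s) :=
  NormedAddCommGroup.induced (Hs s) L2 (Hs.bessel : Hs s →ₗ[ℂ] L2) Hs.bessel_injective

instance (s : ℝ) : NormedSpace ℂ (Hs s) :=
  NormedSpace.induced ℂ (Hs s) L2 (Hs.bessel : Hs s →ₗ[ℂ] L2)

/-! ### The Schrödinger operator with a delta potential and its propagator -/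

/-- `g` is the weak derivative of `f` on the open set `Ω ⊆ ℝ` (for locally integrable `f`, `g`). -/
def HasWeakDerivOn (Ω : Set ℝ) (f g : ℝ → ℂ) : Prop :=
  ∀ φ : ℝ → ℂ, ContDiff ℝ ∞ φ → HasCompactSupport φ → tsupport φ ⊆ Ω →
    ∫ x, f x * deriv φ x = -∫ x, g x * φ x

/-- The graph of `-Δ_γ = -∂ₓ² - γ δ` in `L²(ℝ)`: `f` lies in the domain
`{f ∈ H¹(ℝ) ∩ H²(ℝ ∖ {0}) : f'(0+) - f'(0-) = -γ f(0)}` and `-∂ₓ² f = g` on `ℝ ∖ {0}`.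
Here `F` is the continuous representative of `f`, and `F'` is the representative of its weak
derivative that is continuous away from `0`. -/
def NegDeltaLaplacian (γ : ℝ) (f g : L2) : Prop :=
  ∃ (F F' : ℝ → ℂ) (a b : ℂ),
    F =ᵐ[volume] f ∧ Continuous F ∧
    MemLp F' 2 volume ∧ HasWeakDerivOn univ F F' ∧
    ContinuousOn F' {0}ᶜ ∧ HasWeakDerivOn {0}ᶜ F' (fun x => -g x) ∧
    Tendsto F' (𝓝[>] 0) (𝓝 a) ∧ Tendsto F' (𝓝[<] 0) (𝓝 b) ∧
    a - b = -(γ : ℂ) * F 0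

/-- `U` is the strongly continuous one-parameter group of unitary operators on `L²(ℝ)` whose
generator is `i Δ_γ` (with exactly the domain of `-Δ_γ`), that is, `U t = e^{i t Δ_γ}`. -/
structure IsDeltaPropagator (γ : ℝ) (U : ℝ → (L2 ≃ₗᵢ[ℂ] L2)) : Prop where
  zero : ∀ f, U 0 f = f
  add : ∀ t r f, U (t + r) f = U t (U r f)
  continuous : ∀ f, Continuous fun t => U t f
  generator : ∀ f g, NegDeltaLaplacian γ f g ↔ HasDerivAt (fun t => U t f) (-Complex.I • g) 0

/-- The Schrödinger propagator `e^{i t Δ_γ}`: the family characterized by `IsDeltaPropagator γ`. -/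
def deltaPropagator (γ : ℝ) : ℝ → (L2 ≃ₗᵢ[ℂ] L2) :=
  haveI : Nonempty (ℝ → (L2 ≃ₗᵢ[ℂ] L2)) := ⟨fun _ => LinearIsometryEquiv.refl ℂ L2⟩
  Classical.epsilon (IsDeltaPropagator γ)

/-! ### Solutions of the nonlinear equation -/

/-- The function `|f|^{p-1} f`. -/
def powerFun (p : ℝ) (f : L2) : ℝ → ℂ := fun x => ((‖f x‖ ^ (p - 1) : ℝ) : ℂ) * f x

open Classical in
/-- `|f|^{p-1} f` as an element of `L²(ℝ)` (used only when this function is in `L²`). -/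
def powerNL (p : ℝ) (f : L2) : L2 :=
  if h : MemLp (powerFun p f) 2 volume then h.toLp (powerFun p f) else 0

/-- `u ∈ C(I; H^s(ℝ))` solves `i ∂ₜu + ∂ₓ²u + γ δ u + |u|^{p-1} u = 0` on the time interval `I ∋ 0`
with `u(0) = u₀`, in the sense of Duhamel's formula
`u(t) = e^{i t Δ_γ} u₀ + i ∫₀ᵗ e^{i (t - τ) Δ_γ} (|u|^{p-1} u)(τ) dτ` for `t ∈ I`. -/
structure IsSolution (γ p s : ℝ) (I : Set ℝ) (u₀ : Hs s) (u : ℝ → Hs s) : Prop where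
  continuousOn : ContinuousOn u I
  memLp : ∀ t ∈ I, MemLp (powerFun p (u t).toL2) 2 volume
  integrable : ∀ t ∈ I, IntervalIntegrable
    (fun τ => deltaPropagator γ (t - τ) (powerNL p (u τ).toL2)) volume 0 t
  duhamel : ∀ t ∈ I, (u t).toL2 = deltaPropagator γ t u₀.toL2 +
    Complex.I • ∫ τ in (0 : ℝ)..t, deltaPropagator γ (t - τ) (powerNL p (u τ).toL2)

end

/-! Write κ = γ/2. The propagator is constructed explicitly from a factorization. With A = ∂ₓ + κ
sgn(x), mapping even functions to odd ones, the formal adjoint is A* = -∂ₓ + κ sgn(x). Then A*A =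
-Δ_γ + κ² on even functions. On odd functions AA* = κ² - ∂ₓ², because the delta term carries the
value at the origin, which is zero. Hence the partial isometry C = (κ² - ∂ₓ²)^{-1/2} A (`deltaC`,
with adjoint `deltaB`) satisfies CC* = 1 on odd functions. It carries the even part of -Δ_γ to the
free operator, except on ker A, where f' = -κ sgn(x) f: this is the bound state, of energy -κ². So
e^{itΔ_γ} is the free group on odd functions, C* e^{it∂²} C plus the phase e^{itκ²} on ker A on even
ones (`deltaProp`). That the generator has exactly the prescribed domain is checked in both
directions (`NegDeltaLaplacian.of_hasDerivAt`, `hasDerivAt_deltaProp`). A unitary group is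
determined by its generator (`IsDeltaPropagator.eq`), so the abstractly chosen `deltaPropagator` is
this one.

The formula also gives uniform bounds on H^s for 0 ≤ s ≤ 1 (`exists_propagator_Hs`). C and C* are
bounded Fourier multipliers plus terms containing sgn(x) which map L² into H¹.

For the nonlinearity, s > 1/2 gives H^s ⊂ L^∞, so |z|^{p-1}z may be truncated outside a disc to a
globally Lipschitz C¹ function G. Composition with G is bounded on H^s and Lipschitz in L², by the
Gagliardo description of H^s. For p close to 1 the derivative of G is only uniformly continuous, so
composition is only almost Lipschitz on H^s: ‖G(f) - G(g)‖ ≤ L‖f - g‖ + ε when f, g are bounded in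
H^s and close in L² (`exists_truncated_powerNL`).

This is enough for the two-norm scheme in `SemilinearSetting`. The Picard iterates are bounded in
H^s and contract in L²; the almost Lipschitz bound then makes them Cauchy in H^s. The same mechanism
gives uniqueness through L² and continuity of the flow in H^s. A solution of the truncated equation
that stays below the truncation level solves the original one, and conversely, which yields the
three assertions. -/

noncomputable section

open FourierTransform

/-! ### Bounded multiplication operators and Fourier multipliers on `L²(ℝ)` -/

/-- A bounded measurable function, used as a multiplier. -/
def IsBddSymbol (m : ℝ → ℂ) : Prop := Measurable m ∧ ∃ C : ℝ, ∀ x, ‖m x‖ ≤ C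

theorem IsBddSymbol.memLp {m : ℝ → ℂ} (hm : IsBddSymbol m) (f : L2) :
    MemLp (fun x => m x * f x) 2 volume := by
  obtain ⟨h, C, hC⟩ := hm
  refine (Lp.memLp f).of_le_mul (c := C) (h.aestronglyMeasurable.mul (Lp.aestronglyMeasurable f)) ?_
  refine Eventually.of_forall fun x => ?_
  rw [norm_mul]
  gcongr
  exact hC x

theorem IsBddSymbol.mul {m n : ℝ → ℂ} (hm : IsBddSymbol m) (hn : IsBddSymbol n) :
    IsBddSymbol (fun x => m x * n x) := by
  obtain ⟨h, C, hC⟩ := hm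
  obtain ⟨h', C', hC'⟩ := hn
  refine ⟨h.mul h', C * C', fun x => ?_⟩
  rw [norm_mul]
  exact mul_le_mul (hC x) (hC' x) (norm_nonneg _) ((norm_nonneg _).trans (hC x))

theorem IsBddSymbol.conj {m : ℝ → ℂ} (hm : IsBddSymbol m) :
    IsBddSymbol (fun x => (starRingEnd ℂ) (m x)) :=
  ⟨Complex.continuous_conj.measurable.comp hm.1, by simpa using hm.2⟩

theorem isBddSymbol_const (c : ℂ) : IsBddSymbol (fun _ => c) :=
  ⟨measurable_const, ‖c‖, fun _ => le_rfl⟩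

theorem IsBddSymbol.comp_neg {m : ℝ → ℂ} (hm : IsBddSymbol m) :
    IsBddSymbol (fun x => m (-x)) :=
  ⟨hm.1.comp measurable_neg, hm.2.imp fun _ h x => h (-x)⟩

open Classical in
/-- Multiplication by a bounded measurable function. -/
def mulL2 (m : ℝ → ℂ) : L2 →L[ℂ] L2 :=
  if hm : IsBddSymbol m then
    LinearMap.mkContinuousOfExistsBound
      { toFun := fun f => (hm.memLp f).toLp _
        map_add' := fun f g => by
          rw [← MemLp.toLp_add]
          refine MemLp.toLp_congr _ _ ?_
          filter_upwards [Lp.coeFn_add f g] with x hx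
          rw [hx, Pi.add_apply, mul_add, Pi.add_apply]
        map_smul' := fun c f => by
          rw [RingHom.id_apply, ← MemLp.toLp_const_smul]
          refine MemLp.toLp_congr _ _ ?_
          filter_upwards [Lp.coeFn_smul c f] with x hx
          rw [hx, Pi.smul_apply, Pi.smul_apply, smul_eq_mul, smul_eq_mul, mul_left_comm] }
      (by
        obtain ⟨C, hC⟩ := hm.2
        refine ⟨C, fun f => Lp.norm_le_mul_norm_of_ae_le_mul ?_⟩
        filter_upwards [(hm.memLp f).coeFn_toLp] with x hx
        simp only [LinearMap.coe_mk, AddHom.coe_mk]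
        rw [hx, norm_mul]
        gcongr
        exact hC x)
  else 0

theorem mulL2_ae {m : ℝ → ℂ} (hm : IsBddSymbol m) (f : L2) :
    mulL2 m f =ᵐ[volume] fun x => m x * f x := by
  rw [mulL2, dif_pos hm]
  exact (hm.memLp f).coeFn_toLp

theorem eq_mulL2 {m : ℝ → ℂ} (hm : IsBddSymbol m) {f g : L2}
    (h : g =ᵐ[volume] fun x => m x * f x) : g = mulL2 m f :=
  Lp.ext (h.trans (mulL2_ae hm f).symm)

theorem norm_mulL2_le {m : ℝ → ℂ} (hm : IsBddSymbol m) {C : ℝ} (hC : ∀ x, ‖m x‖ ≤ C) (f : L2) :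
    ‖mulL2 m f‖ ≤ C * ‖f‖ := by
  refine Lp.norm_le_mul_norm_of_ae_le_mul ?_
  filter_upwards [mulL2_ae hm f] with x hx
  rw [hx, norm_mul]
  gcongr
  exact hC x

theorem mulL2_mulL2 {m n : ℝ → ℂ} (hm : IsBddSymbol m) (hn : IsBddSymbol n) (f : L2) :
    mulL2 m (mulL2 n f) = mulL2 (fun x => m x * n x) f := by
  refine eq_mulL2 (hm.mul hn) ?_
  filter_upwards [mulL2_ae hm (mulL2 n f), mulL2_ae hn f] with x h1 h2
  rw [h1, h2, mul_assoc]

theorem mulL2_one (f : L2) : mulL2 (fun _ => 1) f = f :=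
  (eq_mulL2 (isBddSymbol_const 1) (by simp)).symm

theorem inner_mulL2_left {m : ℝ → ℂ} (hm : IsBddSymbol m) (f g : L2) :
    inner ℂ (mulL2 m f) g = inner ℂ f (mulL2 (fun x => (starRingEnd ℂ) (m x)) g) := by
  rw [L2.inner_def, L2.inner_def]
  refine integral_congr_ae ?_
  filter_upwards [mulL2_ae hm f, mulL2_ae hm.conj g] with x h1 h2
  simp only [h1, h2, RCLike.inner_apply, map_mul]
  ring

/-- The Fourier multiplier with a bounded symbol. -/
def fourierMul (m : ℝ → ℂ) : L2 →L[ℂ] L2 :=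
  ((Lp.fourierTransformₗᵢ ℝ ℂ).symm.toContinuousLinearEquiv : L2 →L[ℂ] L2) ∘L mulL2 m ∘L
    ((Lp.fourierTransformₗᵢ ℝ ℂ).toContinuousLinearEquiv : L2 →L[ℂ] L2)

theorem fourierMul_apply (m : ℝ → ℂ) (f : L2) : fourierMul m f = 𝓕⁻ (mulL2 m (𝓕 f)) := rfl

@[simp]
theorem fourier_fourierMul (m : ℝ → ℂ) (f : L2) : 𝓕 (fourierMul m f) = mulL2 m (𝓕 f) := by
  rw [fourierMul_apply, fourier_fourierInv_eq]

theorem fourier_L2_injective {f g : L2} (h : 𝓕 f = 𝓕 g) : f = g :=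
  (Lp.fourierTransformₗᵢ ℝ ℂ).injective h

theorem fourierMul_fourierMul {m n : ℝ → ℂ} (hm : IsBddSymbol m) (hn : IsBddSymbol n) (f : L2) :
    fourierMul m (fourierMul n f) = fourierMul (fun x => m x * n x) f := by
  apply fourier_L2_injective
  simp [mulL2_mulL2 hm hn]

theorem fourierMul_one (f : L2) : fourierMul (fun _ => 1) f = f := by
  apply fourier_L2_injective
  simp [mulL2_one]

theorem norm_fourierMul_le {m : ℝ → ℂ} (hm : IsBddSymbol m) {C : ℝ} (hC : ∀ x, ‖m x‖ ≤ C)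
    (f : L2) : ‖fourierMul m f‖ ≤ C * ‖f‖ := by
  rw [← Lp.norm_fourier_eq, fourier_fourierMul, ← Lp.norm_fourier_eq f]
  exact norm_mulL2_le hm hC _

theorem inner_fourierMul_left {m : ℝ → ℂ} (hm : IsBddSymbol m) (f g : L2) :
    inner ℂ (fourierMul m f) g = inner ℂ f (fourierMul (fun x => (starRingEnd ℂ) (m x)) g) := by
  rw [← Lp.inner_fourier_eq, ← Lp.inner_fourier_eq f, fourier_fourierMul, fourier_fourierMul,
    inner_mulL2_left hm]

/-! ### Reflection and translations -/

/-- The reflection `f ↦ f(-·)`. -/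
def reflL2 : L2 →L[ℂ] L2 :=
  (Lp.compMeasurePreservingₗᵢ ℂ (fun x : ℝ => -x)
    (Measure.measurePreserving_neg volume)).toContinuousLinearMap

theorem reflL2_ae (f : L2) : reflL2 f =ᵐ[volume] fun x => f (-x) :=
  Lp.coeFn_compMeasurePreserving f (Measure.measurePreserving_neg (volume : Measure ℝ))

theorem ae_comp_neg {p : ℝ → Prop} (h : ∀ᵐ x, p x) : ∀ᵐ x, p (-x) :=
  (Measure.measurePreserving_neg (volume : Measure ℝ)).quasiMeasurePreserving.ae h

theorem ae_comp_add {p : ℝ → Prop} (h : ∀ᵐ x, p x) (t : ℝ) : ∀ᵐ x, p (x + t) :=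
  (measurePreserving_add_right (volume : Measure ℝ) t).quasiMeasurePreserving.ae h

theorem reflL2_reflL2 (f : L2) : reflL2 (reflL2 f) = f := by
  apply Lp.ext
  filter_upwards [reflL2_ae (reflL2 f), ae_comp_neg (reflL2_ae f)] with x h1 h2
  rw [h1, h2, neg_neg]

theorem reflL2_mulL2 {m : ℝ → ℂ} (hm : IsBddSymbol m) (f : L2) :
    reflL2 (mulL2 m f) = mulL2 (fun x => m (-x)) (reflL2 f) := by
  refine eq_mulL2 hm.comp_neg ?_
  filter_upwards [reflL2_ae (mulL2 m f), ae_comp_neg (mulL2_ae hm f), reflL2_ae f] with x h1 h2 h3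
  rw [h1, h2, h3]

theorem inner_reflL2_left (f g : L2) : inner ℂ (reflL2 f) g = inner ℂ f (reflL2 g) := by
  have h := (Lp.compMeasurePreservingₗᵢ ℂ (fun x : ℝ => -x)
    (Measure.measurePreserving_neg (volume : Measure ℝ))
      (E := ℂ) (p := 2)).inner_map_map f (reflL2 g)
  have h2 := reflL2_reflL2 g
  rw [← h]
  exact congrArg _ h2.symm

/-- The translation `f ↦ f(· + t)`. -/
def transL2 (t : ℝ) : L2 →L[ℂ] L2 :=
  (Lp.compMeasurePreservingₗᵢ ℂ (fun x : ℝ => x + t)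
    (measurePreserving_add_right volume t)).toContinuousLinearMap

theorem transL2_ae (t : ℝ) (f : L2) : transL2 t f =ᵐ[volume] fun x => f (x + t) :=
  Lp.coeFn_compMeasurePreserving f (measurePreserving_add_right (volume : Measure ℝ) t)

theorem norm_transL2 (t : ℝ) (f : L2) : ‖transL2 t f‖ = ‖f‖ :=
  (Lp.compMeasurePreservingₗᵢ ℂ (fun x : ℝ => x + t)
    (measurePreserving_add_right volume t) (E := ℂ) (p := 2)).norm_map f

/-- Density of Schwartz functions. It reduces identities for the L² Fourier transform to functions
for which the transform is an integral. -/
theorem L2_induction_schwartz {A B : L2 →L[ℂ] L2}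
    (h : ∀ φ : 𝓢(ℝ, ℂ), A (φ.toLp 2) = B (φ.toLp 2)) (f : L2) : A f = B f := by
  refine DenseRange.induction_on (p := fun f => A f = B f)
    (SchwartzMap.denseRange_toLpCLM (E := ℝ) (F := ℂ) (p := 2) (μ := volume)
      ENNReal.ofNat_ne_top) f ?_ ?_
  · exact isClosed_eq A.continuous B.continuous
  · exact fun φ => h φ

/-- The character `ξ ↦ e^{2πitξ}`. -/
def expSymbol (t : ℝ) (ξ : ℝ) : ℂ := Complex.exp (2 * Real.pi * t * ξ * Complex.I)

theorem norm_expSymbol (t ξ : ℝ) : ‖expSymbol t ξ‖ = 1 := by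
  have : (2 * Real.pi * t * ξ * Complex.I : ℂ) = ((2 * Real.pi * t * ξ : ℝ) : ℂ) * Complex.I := by
    push_cast; ring
  rw [expSymbol, this, Complex.norm_exp_ofReal_mul_I]

theorem isBddSymbol_expSymbol (t : ℝ) : IsBddSymbol (expSymbol t) :=
  ⟨by unfold expSymbol; fun_prop, 1, fun ξ => (norm_expSymbol t ξ).le⟩

theorem fourier_transL2 (t : ℝ) (f : L2) : 𝓕 (transL2 t f) = mulL2 (expSymbol t) (𝓕 f) := by
  refine L2_induction_schwartz
    (A := ((Lp.fourierTransformₗᵢ ℝ ℂ).toContinuousLinearEquiv : L2 →L[ℂ] L2) ∘L transL2 t)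
    (B := mulL2 (expSymbol t) ∘L
      ((Lp.fourierTransformₗᵢ ℝ ℂ).toContinuousLinearEquiv : L2 →L[ℂ] L2)) (fun φ => ?_) f
  let ψ : 𝓢(ℝ, ℂ) := SchwartzMap.compSubConstCLM ℂ (-t) φ
  have h1 : transL2 t (φ.toLp 2) = ψ.toLp 2 := by
    apply Lp.ext
    filter_upwards [transL2_ae t (φ.toLp 2), ae_comp_add (φ.coeFn_toLp 2 volume) t,
      ψ.coeFn_toLp 2 volume] with x h1 h2 h3
    rw [h1, h2, h3]
    simp [ψ]
  change 𝓕 (transL2 t (φ.toLp 2)) = mulL2 (expSymbol t) (𝓕 (φ.toLp 2))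
  rw [h1, SchwartzMap.toLp_fourier_eq, SchwartzMap.toLp_fourier_eq]
  refine eq_mulL2 (isBddSymbol_expSymbol t) ?_
  filter_upwards [(𝓕 ψ).coeFn_toLp 2 volume, (𝓕 φ).coeFn_toLp 2 volume] with ξ h2 h3
  rw [h2, h3, SchwartzMap.fourier_coe, SchwartzMap.fourier_coe]
  have : (ψ : ℝ → ℂ) = (φ : ℝ → ℂ) ∘ fun x => x + t := by
    ext x; simp [ψ]
  rw [this]
  have h4 := VectorFourier.fourierIntegral_comp_add_right Real.fourierChar volume (innerₗ ℝ) φ t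
  have h5 := congrFun h4 ξ
  simp only [innerₗ_apply_apply, Circle.smul_def, Real.fourierChar_apply] at h5
  refine h5.trans ?_
  rw [smul_eq_mul]
  congr 1
  rw [expSymbol]
  congr 1
  simp [RCLike.inner_apply]
  ring

theorem fourier_reflL2 (f : L2) : 𝓕 (reflL2 f) = reflL2 (𝓕 f) := by
  refine L2_induction_schwartz
    (A := ((Lp.fourierTransformₗᵢ ℝ ℂ).toContinuousLinearEquiv : L2 →L[ℂ] L2) ∘L reflL2)
    (B := reflL2 ∘L
      ((Lp.fourierTransformₗᵢ ℝ ℂ).toContinuousLinearEquiv : L2 →L[ℂ] L2)) (fun φ => ?_) f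
  let ψ : 𝓢(ℝ, ℂ) := SchwartzMap.compCLMOfContinuousLinearEquiv ℂ
    (LinearIsometryEquiv.neg ℝ (E := ℝ)).toContinuousLinearEquiv φ
  have h1 : reflL2 (φ.toLp 2) = ψ.toLp 2 := by
    apply Lp.ext
    filter_upwards [reflL2_ae (φ.toLp 2), ae_comp_neg (φ.coeFn_toLp 2 volume),
      ψ.coeFn_toLp 2 volume] with x h1 h2 h3
    rw [h1, h2, h3]
    simp [ψ]
  change 𝓕 (reflL2 (φ.toLp 2)) = reflL2 (𝓕 (φ.toLp 2))
  rw [h1, SchwartzMap.toLp_fourier_eq, SchwartzMap.toLp_fourier_eq]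
  apply Lp.ext
  filter_upwards [(𝓕 ψ).coeFn_toLp 2 volume, reflL2_ae ((𝓕 φ).toLp 2),
    ae_comp_neg ((𝓕 φ).coeFn_toLp 2 volume)] with ξ h2 h3 h4
  rw [h2, h3, h4, SchwartzMap.fourier_coe, SchwartzMap.fourier_coe]
  have : (ψ : ℝ → ℂ) = (φ : ℝ → ℂ) ∘ (LinearIsometryEquiv.neg ℝ (E := ℝ)) := by
    ext x; simp [ψ]
  rw [this, Real.fourier_comp_linearIsometry]
  simp

theorem reflL2_fourierMul {m : ℝ → ℂ} (hm : IsBddSymbol m) (f : L2) :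
    reflL2 (fourierMul m f) = fourierMul (fun x => m (-x)) (reflL2 f) := by
  apply fourier_L2_injective
  rw [fourier_reflL2, fourier_fourierMul, fourier_fourierMul, reflL2_mulL2 hm, fourier_reflL2]

theorem continuous_transL2 (f : L2) : Continuous fun t => transL2 t f := by
  refine Continuous.compMeasurePreservingLp (p := 2) (f := fun _ : ℝ => f)
    (g := fun t => (⟨fun x => x + t, by fun_prop⟩ : C(ℝ, ℝ))) continuous_const ?_
    (fun t => measurePreserving_add_right volume t) (by simp)
  exact (ContinuousMap.curry ⟨fun p : ℝ × ℝ => p.2 + p.1, by fun_prop⟩).continuous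

/-! ### Convergence in `L²` and unitary multiplication groups -/

theorem L2_norm_sq_eq (f : L2) : ‖f‖ ^ 2 = ∫ x, ‖f x‖ ^ 2 := by
  have h := L2.inner_def (𝕜 := ℂ) f f
  rw [inner_self_eq_norm_sq_to_K] at h
  have h2 : ∀ x, inner ℂ (f x) (f x) = ((‖f x‖ ^ 2 : ℝ) : ℂ) := fun x => by
    rw [inner_self_eq_norm_sq_to_K]; simp
  simp_rw [h2] at h
  rw [integral_complex_ofReal] at h
  apply Complex.ofReal_injective
  rw [← h]
  simp

theorem L2_integrable_norm_sq (f : L2) : Integrable (fun x => ‖f x‖ ^ 2) :=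
  (memLp_two_iff_integrable_sq_norm (Lp.aestronglyMeasurable f)).1 (Lp.memLp f)

/-- Dominated convergence for |k_i - G|², with majorant 2|b|² + 2|G|². -/
theorem tendsto_L2_of_dominated {ι : Type*} {l : Filter ι} [l.IsCountablyGenerated]
    {F : ι → L2} {G b : L2} {k : ι → ℝ → ℂ} (hF : ∀ᶠ i in l, F i =ᵐ[volume] k i)
    (hb : ∀ᶠ i in l, ∀ᵐ x, ‖k i x‖ ≤ ‖b x‖)
    (hlim : ∀ᵐ x, Tendsto (fun i => k i x) l (𝓝 (G x))) : Tendsto F l (𝓝 G) := by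
  rw [tendsto_iff_norm_sub_tendsto_zero]
  have key : Tendsto (fun i => ∫ x, ‖F i x - G x‖ ^ 2) l (𝓝 0) := by
    have h1 : Tendsto (fun i => ∫ x, ‖k i x - G x‖ ^ 2) l (𝓝 (∫ _ : ℝ, (0 : ℝ))) := by
      refine tendsto_integral_filter_of_dominated_convergence
        (fun x => 2 * ‖b x‖ ^ 2 + 2 * ‖G x‖ ^ 2) ?_ ?_ ?_ ?_
      · filter_upwards [hF] with i hi
        refine AEStronglyMeasurable.pow (AEStronglyMeasurable.norm ?_) 2
        exact ((Lp.aestronglyMeasurable (F i)).congr hi).sub (Lp.aestronglyMeasurable G)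
      · filter_upwards [hb] with i hi
        filter_upwards [hi] with x hx
        rw [Real.norm_of_nonneg (by positivity)]
        have h2 := norm_sub_le (k i x) (G x)
        have h3 : ‖k i x - G x‖ ≤ ‖b x‖ + ‖G x‖ := h2.trans (by gcongr)
        calc ‖k i x - G x‖ ^ 2 ≤ (‖b x‖ + ‖G x‖) ^ 2 := by gcongr
          _ ≤ _ := by nlinarith [sq_nonneg (‖b x‖ - ‖G x‖)]
      · exact ((L2_integrable_norm_sq b).const_mul 2).add ((L2_integrable_norm_sq G).const_mul 2)
      · filter_upwards [hlim] with x hx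
        have := ((hx.sub_const (G x)).norm).pow 2
        simpa using this
    simp only [integral_zero] at h1
    refine h1.congr' ?_
    filter_upwards [hF] with i hi
    refine integral_congr_ae ?_
    filter_upwards [hi] with x hx
    rw [hx]
  have h2 : (fun i => ‖F i - G‖) = fun i => Real.sqrt (∫ x, ‖F i x - G x‖ ^ 2) := by
    ext i
    have : ∫ x, ‖F i x - G x‖ ^ 2 = ‖F i - G‖ ^ 2 := by
      rw [L2_norm_sq_eq]
      refine integral_congr_ae ?_
      filter_upwards [Lp.coeFn_sub (F i) G] with x hx
      rw [hx, Pi.sub_apply]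
    rw [this, Real.sqrt_sq (norm_nonneg _)]
  rw [h2]
  have h3 := (Real.continuous_sqrt.tendsto 0).comp key
  rwa [Real.sqrt_zero] at h3

/-- Convergence in L² implies convergence in measure, hence almost everywhere along a subsequence.
-/
theorem L2_ae_eq_of_tendsto {F : ℕ → L2} {G : L2} {k : ℕ → ℝ → ℂ} {H : ℝ → ℂ}
    (hF : ∀ n, F n =ᵐ[volume] k n) (hG : Tendsto F atTop (𝓝 G))
    (hlim : ∀ᵐ x, Tendsto (fun n => k n x) atTop (𝓝 (H x))) : G =ᵐ[volume] H := by
  have h1 := tendstoInMeasure_of_tendsto_Lp hG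
  obtain ⟨ns, hns, h2⟩ := h1.exists_seq_tendsto_ae
  filter_upwards [h2, hlim, ae_all_iff.2 hF] with x hx hx2 hx3
  refine tendsto_nhds_unique hx ?_
  simp_rw [hx3]
  exact hx2.comp hns.tendsto_atTop

/-- The symbol `e^{ita(ξ)}` of a unitary group. -/
def groupSymbol (a : ℝ → ℝ) (t : ℝ) (ξ : ℝ) : ℂ := Complex.exp ((t * a ξ : ℝ) * Complex.I)

theorem norm_groupSymbol (a : ℝ → ℝ) (t ξ : ℝ) : ‖groupSymbol a t ξ‖ = 1 :=
  Complex.norm_exp_ofReal_mul_I _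

theorem isBddSymbol_groupSymbol {a : ℝ → ℝ} (ha : Measurable a) (t : ℝ) :
    IsBddSymbol (groupSymbol a t) :=
  ⟨by unfold groupSymbol; fun_prop, 1, fun ξ => (norm_groupSymbol a t ξ).le⟩

theorem groupSymbol_add (a : ℝ → ℝ) (t r ξ : ℝ) :
    groupSymbol a t ξ * groupSymbol a r ξ = groupSymbol a (t + r) ξ := by
  rw [groupSymbol, groupSymbol, groupSymbol, ← Complex.exp_add]
  push_cast
  ring_nf

theorem groupSymbol_zero (a : ℝ → ℝ) (ξ : ℝ) : groupSymbol a 0 ξ = 1 := by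
  simp [groupSymbol]

theorem groupSymbol_conj (a : ℝ → ℝ) (t ξ : ℝ) :
    (starRingEnd ℂ) (groupSymbol a t ξ) = groupSymbol a (-t) ξ := by
  rw [groupSymbol, groupSymbol, ← Complex.exp_conj]
  simp

theorem continuous_groupSymbol (a : ℝ → ℝ) (ξ : ℝ) : Continuous fun t => groupSymbol a t ξ := by
  unfold groupSymbol
  fun_prop

theorem continuous_mulL2_groupSymbol {a : ℝ → ℝ} (ha : Measurable a) (f : L2) :
    Continuous fun t => mulL2 (groupSymbol a t) f := by
  rw [continuous_iff_continuousAt]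
  intro t
  refine tendsto_L2_of_dominated (b := f) (k := fun r x => groupSymbol a r x * f x)
    (Eventually.of_forall fun r => mulL2_ae (isBddSymbol_groupSymbol ha r) f) ?_ ?_
  · refine Eventually.of_forall fun r => Eventually.of_forall fun x => ?_
    rw [norm_mul, norm_groupSymbol, one_mul]
  · filter_upwards [mulL2_ae (isBddSymbol_groupSymbol ha t) f] with x hx
    rw [hx]
    exact ((continuous_groupSymbol a x).tendsto t).mul_const _

theorem hasDerivAt_groupSymbol (a : ℝ → ℝ) (ξ : ℝ) :
    HasDerivAt (fun t => groupSymbol a t ξ) (Complex.I * a ξ) 0 := by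
  have h : HasDerivAt (fun t : ℝ => ((t * a ξ : ℝ) : ℂ) * Complex.I) (a ξ * Complex.I) 0 := by
    have := ((hasDerivAt_id (0 : ℝ)).mul_const (a ξ)).ofReal_comp.mul_const Complex.I
    simpa using this
  have := h.cexp
  simpa [groupSymbol, mul_comm] using this

theorem norm_groupSymbol_sub_one_le (a : ℝ → ℝ) (t ξ : ℝ) :
    ‖groupSymbol a t ξ - 1‖ ≤ |t| * |a ξ| := by
  have := Real.norm_exp_I_mul_ofReal_sub_one_le (x := t * a ξ)
  rw [mul_comm, Real.norm_eq_abs, abs_mul] at this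
  exact this

/-- The difference quotients of e^{ita} at 0 converge pointwise to ia and are bounded by |a|. If the
orbit is differentiable in L², the limit is therefore i a f. Conversely, if i a f is in L², it is
its own majorant for dominated convergence. This determines the domain of the generator exactly. -/
theorem hasDerivAt_mulL2_groupSymbol_iff {a : ℝ → ℝ} (ha : Measurable a) (f g : L2) :
    HasDerivAt (fun t => mulL2 (groupSymbol a t) f) g 0 ↔
      g =ᵐ[volume] fun ξ => Complex.I * a ξ * f ξ := by
  rw [hasDerivAt_iff_tendsto_slope]
  have hs : ∀ t : ℝ, slope (fun t => mulL2 (groupSymbol a t) f) 0 t =ᵐ[volume]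
      fun ξ => slope (fun t => groupSymbol a t ξ) 0 t * f ξ := by
    intro t
    rw [slope_def_module]
    filter_upwards [Lp.coeFn_smul (t - 0)⁻¹ (mulL2 (groupSymbol a t) f - mulL2 (groupSymbol a 0) f),
      Lp.coeFn_sub (mulL2 (groupSymbol a t) f) (mulL2 (groupSymbol a 0) f),
      mulL2_ae (isBddSymbol_groupSymbol ha t) f, mulL2_ae (isBddSymbol_groupSymbol ha 0) f]
      with ξ h1 h2 h3 h4
    rw [h1, Pi.smul_apply, h2, Pi.sub_apply, h3, h4, slope_def_module]
    rw [smul_mul_assoc, sub_mul]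
  have hlim : ∀ ξ, Tendsto (fun t => slope (fun t => groupSymbol a t ξ) 0 t * f ξ) (𝓝[≠] 0)
      (𝓝 (Complex.I * a ξ * f ξ)) := fun ξ =>
    (hasDerivAt_iff_tendsto_slope.1 (hasDerivAt_groupSymbol a ξ)).mul_const _
  constructor
  · intro h
    have hu : Tendsto (fun n : ℕ => 1 / ((n : ℝ) + 1)) atTop (𝓝[≠] 0) := by
      refine tendsto_nhdsWithin_iff.2 ⟨tendsto_one_div_add_atTop_nhds_zero_nat, ?_⟩
      refine Eventually.of_forall fun n => ?_
      simp only [mem_compl_iff, mem_singleton_iff]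
      positivity
    exact L2_ae_eq_of_tendsto (fun n => hs (1 / ((n : ℝ) + 1))) (h.comp hu)
      (Eventually.of_forall fun ξ => (hlim ξ).comp hu)
  · intro h
    refine tendsto_L2_of_dominated (b := g) (Eventually.of_forall hs) ?_ ?_
    · filter_upwards [self_mem_nhdsWithin] with t ht
      filter_upwards [h] with ξ hξ
      rw [hξ, slope_def_module, norm_mul, norm_mul, norm_smul, groupSymbol_zero, norm_mul]
      simp only [Complex.norm_I, one_mul, Complex.norm_real, sub_zero, Real.norm_eq_abs, abs_inv]
      gcongr
      have ht' : 0 < |t| := abs_pos.2 ht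
      rw [inv_mul_le_iff₀ ht']
      exact norm_groupSymbol_sub_one_le a t ξ
    · filter_upwards [h] with ξ hξ
      rw [hξ]
      exact hlim ξ

/-- The Fourier multiplier group with symbol `e^{ita(ξ)}`. -/
def fourierGroup (a : ℝ → ℝ) (t : ℝ) : L2 →L[ℂ] L2 := fourierMul (groupSymbol a t)

theorem hasDerivAt_iff_fourier {u : ℝ → L2} {g : L2} {t : ℝ} :
    HasDerivAt u g t ↔ HasDerivAt (fun t => 𝓕 (u t)) (𝓕 g) t := by
  constructor
  · intro h
    exact (((Lp.fourierTransformₗᵢ ℝ ℂ).toContinuousLinearEquiv : L2 →L[ℂ] L2).restrictScalars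
      ℝ).hasFDerivAt.comp_hasDerivAt t h
  · intro h
    have h2 := (((Lp.fourierTransformₗᵢ ℝ ℂ).symm.toContinuousLinearEquiv :
      L2 →L[ℂ] L2).restrictScalars ℝ).hasFDerivAt.comp_hasDerivAt t h
    have h3 : (fun t => (Lp.fourierTransformₗᵢ ℝ ℂ).symm (𝓕 (u t))) = u := by
      ext1 t; exact (Lp.fourierTransformₗᵢ ℝ ℂ).symm_apply_apply (u t)
    have h4 : (Lp.fourierTransformₗᵢ ℝ ℂ).symm (𝓕 g) = g :=
      (Lp.fourierTransformₗᵢ ℝ ℂ).symm_apply_apply g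
    change HasDerivAt (fun t => (Lp.fourierTransformₗᵢ ℝ ℂ).symm (𝓕 (u t)))
      ((Lp.fourierTransformₗᵢ ℝ ℂ).symm (𝓕 g)) t at h2
    rwa [h3, h4] at h2

theorem hasDerivAt_fourierGroup_iff {a : ℝ → ℝ} (ha : Measurable a) (f g : L2) :
    HasDerivAt (fun t => fourierGroup a t f) g 0 ↔
      (𝓕 g : L2) =ᵐ[volume] fun ξ => Complex.I * a ξ * (𝓕 f : L2) ξ := by
  rw [hasDerivAt_iff_fourier, ← hasDerivAt_mulL2_groupSymbol_iff ha]
  simp only [fourierGroup, fourier_fourierMul]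

theorem continuous_fourierGroup {a : ℝ → ℝ} (ha : Measurable a) (f : L2) :
    Continuous fun t => fourierGroup a t f :=
  (Lp.fourierTransformₗᵢ ℝ ℂ).symm.continuous.comp (continuous_mulL2_groupSymbol ha _)

/-! ### Weak derivatives in `L²(ℝ)` -/

/-- `g` is the weak derivative of `f` in `L²(ℝ)`, expressed on the Fourier side. -/
def HasDerivL2 (f g : L2) : Prop :=
  (𝓕 g : L2) =ᵐ[volume] fun ξ => 2 * Real.pi * ξ * Complex.I * (𝓕 f : L2) ξ

/-- Translations become multiplication by e^{2πitξ} on the Fourier side, so the weak derivative is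
the generator of translations. -/
theorem hasDerivL2_iff_hasDerivAt (f g : L2) :
    HasDerivL2 f g ↔ HasDerivAt (fun t => transL2 t f) g 0 := by
  rw [hasDerivAt_iff_fourier]
  have h : ∀ t, 𝓕 (transL2 t f) = mulL2 (groupSymbol (fun ξ => 2 * Real.pi * ξ) t) (𝓕 f) := by
    intro t
    have : expSymbol t = groupSymbol (fun ξ => 2 * Real.pi * ξ) t := by
      ext ξ
      simp only [expSymbol, groupSymbol]
      push_cast
      ring_nf
    rw [fourier_transL2, this]
  simp_rw [h]
  rw [hasDerivAt_mulL2_groupSymbol_iff (by fun_prop), HasDerivL2]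
  have : (fun ξ : ℝ => Complex.I * ((2 * Real.pi * ξ : ℝ) : ℂ) * (𝓕 f : L2) ξ) =
      fun ξ => 2 * Real.pi * ξ * Complex.I * (𝓕 f : L2) ξ := by
    ext ξ; push_cast; ring
  rw [this]

theorem L2_locallyIntegrable (f : L2) : LocallyIntegrable f volume :=
  (Lp.memLp f).locallyIntegrable (by norm_num)

theorem L2_intervalIntegrable (f : L2) (a b : ℝ) : IntervalIntegrable f volume a b :=
  (L2_locallyIntegrable f).integrableOn_isCompact isCompact_uIcc |>.intervalIntegrable

/-- Paired with an arbitrary χ, this is Fubini for g(x + r) conj χ(x) over r between 0 and t.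
Integrability follows from |gχ| ≤ (|g|² + |χ|²)/2 and the invariance of ‖g‖ under translation. -/
theorem transL2_sub_eq_integral {f g : L2} {F : ℝ → ℂ} (hF : F =ᵐ[volume] f)
    (h : ∀ x y, F y - F x = ∫ t in x..y, g t) (t : ℝ) :
    transL2 t f - f = ∫ r in (0 : ℝ)..t, transL2 r g := by
  refine ext_inner_left ℂ fun χ => ?_
  have hcont := continuous_transL2 g
  have e1 := ((innerSL ℂ χ).restrictScalars ℝ).intervalIntegral_comp_comm
    (hcont.intervalIntegrable (μ := volume) 0 t)
  simp only [ContinuousLinearMap.coe_restrictScalars', innerSL_apply_apply] at e1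
  rw [← e1]
  have e2 : ∀ r, inner ℂ χ (transL2 r g) = ∫ x, g (x + r) * (starRingEnd ℂ) (χ x) := by
    intro r
    rw [L2.inner_def]
    refine integral_congr_ae ?_
    filter_upwards [transL2_ae r g] with x hx
    rw [hx, RCLike.inner_apply]
  simp_rw [e2]
  have e3 : inner ℂ χ (transL2 t f - f) =
      ∫ x, (∫ r in (0 : ℝ)..t, g (x + r) * (starRingEnd ℂ) (χ x)) := by
    rw [L2.inner_def]
    refine integral_congr_ae ?_
    filter_upwards [Lp.coeFn_sub (transL2 t f) f, transL2_ae t f, hF, ae_comp_add hF t]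
      with x h1 h2 h3 h4
    rw [h1, Pi.sub_apply, h2, ← h3, ← h4, h, RCLike.inner_apply, intervalIntegral.integral_mul_const,
      intervalIntegral.integral_comp_add_left (fun r => g r), add_zero]
  rw [e3]
  simp_rw [intervalIntegral.intervalIntegral_eq_integral_uIoc]
  rw [integral_smul]
  congr 1
  refine integral_integral_swap ?_
  have hm : Measurable (Function.uncurry fun x r => g (x + r) * (starRingEnd ℂ) (χ x)) := by
    have h1 := (Lp.stronglyMeasurable g).measurable
    have h2 := (Lp.stronglyMeasurable χ).measurable
    exact (h1.comp (measurable_fst.add measurable_snd)).mul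
      (Complex.continuous_conj.measurable.comp (h2.comp measurable_fst))
  rw [integrable_prod_iff' hm.aestronglyMeasurable]
  constructor
  · refine Eventually.of_forall fun r => ?_
    have h1 : Integrable fun x => transL2 r g x * (starRingEnd ℂ) (χ x) :=
      (Lp.memLp (transL2 r g)).integrable_mul (Lp.memLp χ).star
    refine h1.congr ?_
    filter_upwards [transL2_ae r g] with x hx
    simp [hx]
  · refine Measure.integrableOn_of_bounded (M := (‖g‖ ^ 2 + ‖χ‖ ^ 2) / 2)
      (by rw [uIoc]; simp) ?_ ?_
    · exact (hm.norm.stronglyMeasurable.integral_prod_left').aestronglyMeasurable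
    · refine Eventually.of_forall fun r => ?_
      rw [Real.norm_of_nonneg (by positivity), ← norm_transL2 r g, L2_norm_sq_eq, L2_norm_sq_eq,
        ← integral_add (L2_integrable_norm_sq _) (L2_integrable_norm_sq _), ← integral_div]
      refine integral_mono_of_nonneg (Eventually.of_forall fun x => by positivity)
        (((L2_integrable_norm_sq _).add (L2_integrable_norm_sq _)).div_const 2) ?_
      filter_upwards [transL2_ae r g] with x hx
      simp only [Function.uncurry_apply_pair, norm_mul, RCLike.norm_conj, hx]
      nlinarith [sq_nonneg (‖g (x + r)‖ - ‖χ x‖)]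

/-- The translation orbit of f is f plus the integral of that of g, which is continuous, so it is
differentiable at 0 with derivative g. -/
theorem HasDerivL2.of_ftc {f g : L2} {F : ℝ → ℂ} (hF : F =ᵐ[volume] f)
    (h : ∀ x y, F y - F x = ∫ t in x..y, g t) : HasDerivL2 f g := by
  rw [hasDerivL2_iff_hasDerivAt]
  have h1 : (fun t => transL2 t f) = fun t => f + ∫ r in (0 : ℝ)..t, transL2 r g := by
    ext1 t
    rw [← transL2_sub_eq_integral hF h, add_sub_cancel]
  have h0 : transL2 0 g = g := by
    apply Lp.ext
    filter_upwards [transL2_ae 0 g] with x hx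
    rw [hx, add_zero]
  rw [h1]
  have h2 := (continuous_transL2 g).integral_hasStrictDerivAt 0 0
  rw [h0] at h2
  exact h2.hasDerivAt.const_add f

theorem HasDerivL2.inner_eq {f g h k : L2} (hfg : HasDerivL2 f g) (hhk : HasDerivL2 h k) :
    inner ℂ g h = -inner ℂ f k := by
  rw [← Lp.inner_fourier_eq, ← Lp.inner_fourier_eq f, L2.inner_def, L2.inner_def, ← integral_neg]
  refine integral_congr_ae ?_
  filter_upwards [hfg, hhk] with ξ h1 h2
  simp only [h1, h2, RCLike.inner_apply, map_mul, Complex.conj_ofReal, Complex.conj_I, map_ofNat]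
  ring

theorem HasDerivL2.add {f g h k : L2} (hfg : HasDerivL2 f g) (hhk : HasDerivL2 h k) :
    HasDerivL2 (f + h) (g + k) := by
  rw [hasDerivL2_iff_hasDerivAt] at *
  simp_rw [map_add]
  exact hfg.add hhk

theorem HasDerivL2.const_smul {f g : L2} (hfg : HasDerivL2 f g) (c : ℂ) :
    HasDerivL2 (c • f) (c • g) := by
  rw [hasDerivL2_iff_hasDerivAt] at *
  simp_rw [map_smul]
  exact HasDerivAt.fun_const_smul c hfg

theorem HasDerivL2.unique {f g h : L2} (h1 : HasDerivL2 f g) (h2 : HasDerivL2 f h) : g = h :=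
  fourier_L2_injective (Lp.ext (h1.trans h2.symm))

theorem HasDerivL2.integral_eq {f g : L2} (hfg : HasDerivL2 f g) {φ : ℝ → ℂ}
    (hφ : ContDiff ℝ 1 φ) (hc : HasCompactSupport φ) :
    ∫ x, f x * deriv φ x = -∫ x, g x * φ x := by
  -- Conjugating the test function turns the bilinear pairing into the L² inner product.
  let ψ : ℝ → ℂ := fun x => (starRingEnd ℂ) (φ x)
  have hψ : ContDiff ℝ 1 ψ := Complex.conjCLE.contDiff.comp hφ
  have hψc : HasCompactSupport ψ := hc.comp_left (map_zero _)
  have hd : ∀ x, deriv ψ x = (starRingEnd ℂ) (deriv φ x) := fun x =>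
    ((Complex.conjCLE.toContinuousLinearMap.hasFDerivAt.comp_hasDerivAt x
      ((hφ.differentiable one_ne_zero).differentiableAt.hasDerivAt (x := x)))).deriv
  have h1 : MemLp ψ 2 volume := hψ.continuous.memLp_of_hasCompactSupport hψc
  have h2 : MemLp (deriv ψ) 2 volume :=
    (hψ.continuous_deriv le_rfl).memLp_of_hasCompactSupport hψc.deriv
  have h3 : HasDerivL2 (h1.toLp ψ) (h2.toLp (deriv ψ)) := by
    refine HasDerivL2.of_ftc h1.coeFn_toLp.symm fun x y => ?_
    have h4 : ∫ t in x..y, (h2.toLp (deriv ψ)) t = ∫ t in x..y, deriv ψ t := by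
      refine intervalIntegral.integral_congr_ae ?_
      filter_upwards [h2.coeFn_toLp] with t ht _ using ht
    rw [h4, intervalIntegral.integral_deriv_eq_sub
      (fun t _ => (hψ.differentiable one_ne_zero).differentiableAt)
      ((hψ.continuous_deriv le_rfl).intervalIntegrable _ _)]
  have h4 := h3.inner_eq hfg
  rw [L2.inner_def, L2.inner_def] at h4
  have e1 : ∫ x, inner ℂ (h2.toLp (deriv ψ) x) (f x) = ∫ x, f x * deriv φ x := by
    refine integral_congr_ae ?_
    filter_upwards [h2.coeFn_toLp] with x hx
    rw [hx, hd, RCLike.inner_apply, Complex.conj_conj]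
  have e2 : ∫ x, inner ℂ (h1.toLp ψ x) (g x) = ∫ x, g x * φ x := by
    refine integral_congr_ae ?_
    filter_upwards [h1.coeFn_toLp] with x hx
    rw [hx, RCLike.inner_apply, Complex.conj_conj]
  rwa [e1, e2] at h4

/-! ### The fundamental theorem of calculus for weak derivatives -/

theorem HasDerivL2.hasWeakDerivOn {f g : L2} (h : HasDerivL2 f g) {F : ℝ → ℂ}
    (hF : F =ᵐ[volume] f) : HasWeakDerivOn univ F g := by
  intro φ hφ hc _
  rw [← h.integral_eq (hφ.of_le (by exact_mod_cast le_top)) hc]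
  refine integral_congr_ae ?_
  filter_upwards [hF] with x hx
  rw [hx]

/-- A sequence of bump functions shrinking to the origin. -/
def shrinkingBump (n : ℕ) : ContDiffBump (0 : ℝ) where
  rIn := 1 / ((n : ℝ) + 1) / 2
  rOut := 1 / ((n : ℝ) + 1)
  rIn_pos := by positivity
  rIn_lt_rOut := half_lt_self (by positivity)

theorem tendsto_integral_mul_shrinkingBump {F : ℝ → ℂ} (hF : AEStronglyMeasurable F volume)
    {x : ℝ} (hx : ContinuousAt F x) :
    Tendsto (fun n => ∫ t, F t * ((shrinkingBump n).normed volume (t - x) : ℝ)) atTop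
      (𝓝 (F x)) := by
  have h := ContDiffBump.convolution_tendsto_right (μ := (volume : Measure ℝ)) (φ := shrinkingBump)
    (g := fun _ => F) (k := fun _ => x) (x₀ := x) (z₀ := F x) (l := atTop)
    tendsto_one_div_add_atTop_nhds_zero_nat (Eventually.of_forall fun _ => hF)
    (by
      have : (Function.uncurry fun _ : ℕ => F) = F ∘ Prod.snd := rfl
      rw [this]
      exact hx.tendsto.comp tendsto_snd) tendsto_const_nhds
  refine h.congr fun n => ?_
  rw [convolution_eq_swap]
  refine integral_congr_ae (Eventually.of_forall fun t => ?_)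
  simp only [ContinuousLinearMap.lsmul_apply, Complex.real_smul]
  rw [← ContDiffBump.normed_neg, neg_sub, mul_comm]

/-- The smooth cutoff of the interval `[x, y]` at scale `1 / (n + 1)`. -/
def intervalCutoff (n : ℕ) (x y t : ℝ) : ℝ :=
  ∫ r in (t - y)..(t - x), (shrinkingBump n).normed volume r

theorem hasDerivAt_intervalCutoff (n : ℕ) (x y t : ℝ) :
    HasDerivAt (intervalCutoff n x y)
      ((shrinkingBump n).normed volume (t - x) - (shrinkingBump n).normed volume (t - y)) t := by
  have hc := (shrinkingBump n).continuous_normed (μ := volume)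
  have h : intervalCutoff n x y = fun t => (∫ r in (0 : ℝ)..(t - x), (shrinkingBump n).normed volume r)
      - ∫ r in (0 : ℝ)..(t - y), (shrinkingBump n).normed volume r := by
    ext t
    rw [intervalCutoff, intervalIntegral.integral_interval_sub_left
      (hc.intervalIntegrable _ _) (hc.intervalIntegrable _ _)]
  rw [h]
  have hd : ∀ z : ℝ, HasDerivAt (fun t => ∫ r in (0 : ℝ)..(t - z), (shrinkingBump n).normed volume r)
      ((shrinkingBump n).normed volume (t - z)) t := fun z =>
    (hc.integral_hasStrictDerivAt 0 (t - z)).hasDerivAt.comp_sub_const t z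
  exact (hd x).sub (hd y)

theorem contDiff_intervalCutoff (n : ℕ) (x y : ℝ) : ContDiff ℝ ∞ (intervalCutoff n x y) := by
  rw [contDiff_infty_iff_deriv]
  refine ⟨fun t => (hasDerivAt_intervalCutoff n x y t).differentiableAt, ?_⟩
  have : deriv (intervalCutoff n x y) = fun t =>
      (shrinkingBump n).normed volume (t - x) - (shrinkingBump n).normed volume (t - y) :=
    funext fun t => (hasDerivAt_intervalCutoff n x y t).deriv
  rw [this]
  have hc : ContDiff ℝ ∞ ((shrinkingBump n).normed volume) := (shrinkingBump n).contDiff_normed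
  exact (hc.comp (contDiff_id.sub contDiff_const)).sub (hc.comp (contDiff_id.sub contDiff_const))

theorem shrinkingBump_normed_eq_zero {n : ℕ} {r : ℝ} (h : 1 / ((n : ℝ) + 1) ≤ |r|) :
    (shrinkingBump n).normed volume r = 0 := by
  have h2 : r ∉ Function.support ((shrinkingBump n).normed volume) := by
    rw [ContDiffBump.support_normed_eq, Metric.mem_ball, dist_zero_right, Real.norm_eq_abs, not_lt]
    exact h
  simpa using h2

theorem intervalCutoff_nonneg (n : ℕ) {x y : ℝ} (h : x ≤ y) (t : ℝ) :
    0 ≤ intervalCutoff n x y t :=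
  intervalIntegral.integral_nonneg (by linarith) fun _ _ => (shrinkingBump n).nonneg_normed _

theorem intervalCutoff_le_one (n : ℕ) {x y : ℝ} (h : x ≤ y) (t : ℝ) :
    intervalCutoff n x y t ≤ 1 := by
  rw [intervalCutoff, intervalIntegral.integral_of_le (by linarith),
    ← (shrinkingBump n).integral_normed (μ := volume)]
  exact setIntegral_le_integral (shrinkingBump n).integrable_normed
    (Eventually.of_forall fun _ => (shrinkingBump n).nonneg_normed _)

theorem intervalCutoff_eq_one {n : ℕ} {x y t : ℝ} (h1 : x + 1 / ((n : ℝ) + 1) ≤ t)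
    (h2 : t ≤ y - 1 / ((n : ℝ) + 1)) : intervalCutoff n x y t = 1 := by
  have hr : 0 < 1 / ((n : ℝ) + 1) := by positivity
  rw [intervalCutoff, intervalIntegral.integral_of_le (by linarith),
    ← (shrinkingBump n).integral_normed (μ := volume)]
  refine setIntegral_eq_integral_of_forall_compl_eq_zero fun r hr' => ?_
  apply shrinkingBump_normed_eq_zero
  simp only [mem_Ioc, not_and_or, not_lt, not_le] at hr'
  rcases hr' with h | h
  · exact le_abs.2 (Or.inr (by linarith))
  · exact le_abs.2 (Or.inl (by linarith))

theorem intervalCutoff_eq_zero {n : ℕ} {x y t : ℝ} (hxy : x ≤ y)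
    (h : t ≤ x - 1 / ((n : ℝ) + 1) ∨ y + 1 / ((n : ℝ) + 1) ≤ t) : intervalCutoff n x y t = 0 := by
  have hr : 0 < 1 / ((n : ℝ) + 1) := by positivity
  rw [intervalCutoff, intervalIntegral.integral_of_le (by linarith)]
  refine setIntegral_eq_zero_of_forall_eq_zero fun r hr' => ?_
  apply shrinkingBump_normed_eq_zero
  simp only [mem_Ioc] at hr'
  rcases h with h | h
  · exact le_abs.2 (Or.inr (by linarith))
  · exact le_abs.2 (Or.inl (by linarith))

/-- Test with a smooth cutoff of [x, y]. Its derivative is an approximate delta at x minus one at y,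
so one side tends to F x - F y. The cutoff itself tends almost everywhere to the indicator of (x,
y], so the other side tends to minus the integral of g. Since J is open and order connected, it
contains the supports for all large n. -/
theorem HasWeakDerivOn.ftc_of_lt {J : Set ℝ} (hJ : IsOpen J) (hJ' : J.OrdConnected) {F g : ℝ → ℂ}
    (hFm : AEStronglyMeasurable F volume) (hF : ContinuousOn F J)
    (hg : LocallyIntegrable g volume) (h : HasWeakDerivOn J F g) {x y : ℝ} (hx : x ∈ J)
    (hy : y ∈ J) (hxy : x < y) : F y - F x = ∫ t in x..y, g t := by
  obtain ⟨δ, hδ, hδx⟩ := Metric.isOpen_iff.1 hJ x hx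
  obtain ⟨δ', hδ', hδy⟩ := Metric.isOpen_iff.1 hJ y hy
  have hr := tendsto_one_div_add_atTop_nhds_zero_nat (𝕜 := ℝ)
  have hsupp : ∀ n t, intervalCutoff n x y t ≠ 0 →
      t ∈ Icc (x - 1 / ((n : ℝ) + 1)) (y + 1 / ((n : ℝ) + 1)) := fun n t ht => by
    by_contra hcon
    rw [mem_Icc, not_and_or, not_le, not_le] at hcon
    exact ht (intervalCutoff_eq_zero hxy.le (hcon.imp le_of_lt le_of_lt))
  have e1 : ∀ᶠ n : ℕ in atTop,
      (∫ t, F t * ((shrinkingBump n).normed volume (t - x) : ℝ)) -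
        ∫ t, F t * ((shrinkingBump n).normed volume (t - y) : ℝ) =
      -∫ t, g t * (intervalCutoff n x y t : ℝ) := by
    filter_upwards [hr.eventually (gt_mem_nhds hδ), hr.eventually (gt_mem_nhds hδ')] with n h1 h2
    have hrp : 0 < 1 / ((n : ℝ) + 1) := by positivity
    have hJsub : Icc (x - 1 / ((n : ℝ) + 1)) (y + 1 / ((n : ℝ) + 1)) ⊆ J := by
      refine hJ'.out (hδx ?_) (hδy ?_)
      · rw [Metric.mem_ball, Real.dist_eq, abs_lt]; constructor <;> linarith
      · rw [Metric.mem_ball, Real.dist_eq, abs_lt]; constructor <;> linarith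
    let φ : ℝ → ℂ := fun t => (intervalCutoff n x y t : ℝ)
    have hts : tsupport φ ⊆ Icc (x - 1 / ((n : ℝ) + 1)) (y + 1 / ((n : ℝ) + 1)) := by
      refine closure_minimal (fun t ht => hsupp n t ?_) isClosed_Icc
      simpa [φ] using ht
    have h3 := h φ (Complex.ofRealCLM.contDiff.comp (contDiff_intervalCutoff n x y))
      (HasCompactSupport.of_support_subset_isCompact isCompact_Icc (subset_closure.trans hts))
      (hts.trans hJsub)
    rw [← h3, ← integral_sub]
    · refine integral_congr_ae (Eventually.of_forall fun t => ?_)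
      simp only
      rw [((hasDerivAt_intervalCutoff n x y t).ofReal_comp).deriv]
      push_cast
      ring
    all_goals
      have hsub : ∀ z, z ∈ Icc x y → Integrable fun t =>
          F t * ((shrinkingBump n).normed volume (t - z) : ℝ) := by
        intro z hz
        have hi : IntegrableOn F (Icc (x - 1 / ((n : ℝ) + 1)) (y + 1 / ((n : ℝ) + 1))) :=
          (hF.mono hJsub).integrableOn_compact isCompact_Icc
        have hcont : ContinuousOn (fun t => (((shrinkingBump n).normed volume (t - z) : ℝ) : ℂ))
            (Icc (x - 1 / ((n : ℝ) + 1)) (y + 1 / ((n : ℝ) + 1))) := by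
          have := (shrinkingBump n).continuous_normed (μ := (volume : Measure ℝ))
          fun_prop
        have h4 := hi.mul_continuousOn hcont isCompact_Icc
        refine (integrableOn_iff_integrable_of_support_subset ?_).1 h4
        intro t ht
        by_contra hcon
        apply ht
        beta_reduce
        rw [shrinkingBump_normed_eq_zero]
        · simp
        · rw [mem_Icc, not_and_or, not_le, not_le] at hcon
          rcases hcon with hcon | hcon
          · exact le_abs.2 (Or.inr (by linarith [hz.1]))
          · exact le_abs.2 (Or.inl (by linarith [hz.2]))
    · exact hsub x ⟨le_rfl, hxy.le⟩
    · exact hsub y ⟨hxy.le, le_rfl⟩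
  have e2 := (tendsto_integral_mul_shrinkingBump hFm (hF.continuousAt (hJ.mem_nhds hx))).sub
    (tendsto_integral_mul_shrinkingBump hFm (hF.continuousAt (hJ.mem_nhds hy)))
  have e3 : Tendsto (fun n : ℕ => ∫ t, g t * (intervalCutoff n x y t : ℝ)) atTop
      (𝓝 (∫ t, (Ioc x y).indicator g t)) := by
    refine tendsto_integral_of_dominated_convergence
      (fun t => (Icc (x - 1) (y + 1)).indicator (fun t => ‖g t‖) t) ?_ ?_ ?_ ?_
    · intro n
      refine hg.aestronglyMeasurable.mul (Continuous.aestronglyMeasurable ?_)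
      exact Complex.continuous_ofReal.comp (contDiff_intervalCutoff n x y).continuous
    · rw [integrable_indicator_iff measurableSet_Icc]
      exact (hg.integrableOn_isCompact isCompact_Icc).norm
    · intro n
      refine Eventually.of_forall fun t => ?_
      by_cases h0 : intervalCutoff n x y t = 0
      · simp only [h0, Complex.ofReal_zero, mul_zero, norm_zero]
        exact indicator_nonneg (fun _ _ => norm_nonneg _) _
      · have h1 := hsupp n t h0
        have h2 : 1 / ((n : ℝ) + 1) ≤ 1 := by
          rw [div_le_one (by positivity)]; linarith [n.cast_nonneg (α := ℝ)]
        have h3 : t ∈ Icc (x - 1) (y + 1) := ⟨by linarith [h1.1], by linarith [h1.2]⟩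
        rw [indicator_of_mem h3, norm_mul, Complex.norm_real, Real.norm_of_nonneg (intervalCutoff_nonneg n hxy.le t)]
        exact mul_le_of_le_one_right (norm_nonneg _) (intervalCutoff_le_one n hxy.le t)
    · have hne : ∀ᵐ t : ℝ, t ∉ ({x, y} : Set ℝ) :=
        measure_eq_zero_iff_ae_notMem.1 ((Set.toFinite _).measure_zero volume)
      filter_upwards [hne] with t ht
      simp only [mem_insert_iff, mem_singleton_iff, not_or] at ht
      refine tendsto_const_nhds.congr' ?_
      rcases lt_or_gt_of_ne ht.1 with h1 | h1
      · filter_upwards [hr.eventually (gt_mem_nhds (sub_pos.2 h1))] with n hn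
        rw [intervalCutoff_eq_zero hxy.le (Or.inl (by linarith)),
          indicator_of_notMem (fun hm => by linarith [hm.1])]
        simp
      rcases lt_or_gt_of_ne ht.2 with h2 | h2
      · filter_upwards [hr.eventually (gt_mem_nhds (sub_pos.2 h1)),
          hr.eventually (gt_mem_nhds (sub_pos.2 h2))] with n hn hn'
        rw [intervalCutoff_eq_one (by linarith) (by linarith), indicator_of_mem (mem_Ioc.2 ⟨h1, h2.le⟩)]
        simp
      · filter_upwards [hr.eventually (gt_mem_nhds (sub_pos.2 h2))] with n hn
        rw [intervalCutoff_eq_zero hxy.le (Or.inr (by linarith)),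
          indicator_of_notMem (fun hm => by linarith [hm.2])]
        simp
  have e4 := tendsto_nhds_unique (e2.congr' e1) e3.neg
  rw [integral_indicator measurableSet_Ioc, ← intervalIntegral.integral_of_le hxy.le] at e4
  rw [← neg_inj, ← e4]
  ring

theorem HasWeakDerivOn.ftc {J : Set ℝ} (hJ : IsOpen J) (hJ' : J.OrdConnected) {F g : ℝ → ℂ}
    (hFm : AEStronglyMeasurable F volume) (hF : ContinuousOn F J)
    (hg : LocallyIntegrable g volume) (h : HasWeakDerivOn J F g) {x y : ℝ} (hx : x ∈ J)
    (hy : y ∈ J) : F y - F x = ∫ t in x..y, g t := by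
  rcases lt_trichotomy x y with hxy | rfl | hxy
  · exact h.ftc_of_lt hJ hJ' hFm hF hg hx hy hxy
  · simp
  · rw [intervalIntegral.integral_symm, ← h.ftc_of_lt hJ hJ' hFm hF hg hy hx hxy]
    ring

/-- Two halves of a function that match at the origin give an element of `H¹(ℝ)`. -/
theorem HasDerivL2.of_piecewise {f g : L2} {F : ℝ → ℂ} (hF : F =ᵐ[volume] f) {c : ℂ}
    (hpos : ∀ x y, 0 < x → 0 < y → F y - F x = ∫ t in x..y, g t)
    (hneg : ∀ x y, x < 0 → y < 0 → F y - F x = ∫ t in x..y, g t)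
    (hr : Tendsto F (𝓝[>] 0) (𝓝 c)) (hl : Tendsto F (𝓝[<] 0) (𝓝 c)) : HasDerivL2 f g := by
  have hcont : ∀ y, Continuous fun x => ∫ t in x..y, g t := fun y => by
    have h1 := intervalIntegral.continuous_primitive (L2_intervalIntegrable g) y
    have h2 : (fun x => ∫ t in x..y, g t) = fun x => -∫ t in y..x, g t :=
      funext fun x => intervalIntegral.integral_symm _ _
    rw [h2]
    exact h1.neg
  -- The value of F at the origin is arbitrary. Replacing it by the common one-sided limit gives a
  -- primitive of g on the whole line.
  have key : ∀ y, Function.update F 0 c y = c + ∫ t in (0 : ℝ)..y, g t := by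
    intro y
    rcases lt_trichotomy y 0 with hy | rfl | hy
    · rw [Function.update_of_ne hy.ne]
      have h1 : Tendsto (fun x => F y - F x) (𝓝[<] 0) (𝓝 (F y - c)) := hl.const_sub _
      have h2 : Tendsto (fun x => ∫ t in x..y, g t) (𝓝[<] 0) (𝓝 (∫ t in (0 : ℝ)..y, g t)) :=
        ((hcont y).tendsto 0).mono_left nhdsWithin_le_nhds
      rw [← tendsto_nhds_unique (h1.congr' ?_) h2]
      · ring
      · filter_upwards [self_mem_nhdsWithin] with x hx
        exact hneg x y hx hy
    · simp
    · rw [Function.update_of_ne hy.ne']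
      have h1 : Tendsto (fun x => F y - F x) (𝓝[>] 0) (𝓝 (F y - c)) := hr.const_sub _
      have h2 : Tendsto (fun x => ∫ t in x..y, g t) (𝓝[>] 0) (𝓝 (∫ t in (0 : ℝ)..y, g t)) :=
        ((hcont y).tendsto 0).mono_left nhdsWithin_le_nhds
      rw [← tendsto_nhds_unique (h1.congr' ?_) h2]
      · ring
      · filter_upwards [self_mem_nhdsWithin] with x hx
        exact hpos x y hx hy
  refine HasDerivL2.of_ftc (F := Function.update F 0 c) ?_ fun x y => ?_
  · refine EventuallyEq.trans ?_ hF
    have h0 : ∀ᵐ t : ℝ, t ≠ 0 := by simp [ae_iff, measure_singleton]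
    filter_upwards [h0] with t ht
    rw [Function.update_of_ne ht]
  · rw [key, key, add_sub_add_left_eq_sub, intervalIntegral.integral_interval_sub_left
      (L2_intervalIntegrable g _ _) (L2_intervalIntegrable g _ _)]

/-! ### Fourier inversion for `L²` functions with integrable Fourier transform -/

/-- Inversion holds for f as a tempered distribution. Fubini moves the inverse transform from the
test function to the integrable function 𝓕 f, so both sides have the same pairing with every test
function. -/
theorem ae_eq_fourierInv_of_integrable {f : L2} (hf : Integrable (𝓕 f : L2)) :
    f =ᵐ[volume] 𝓕⁻ ((𝓕 f : L2) : ℝ → ℂ) := by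
  have hcont : Continuous (𝓕⁻ ((𝓕 f : L2) : ℝ → ℂ)) := by
    have := VectorFourier.fourierIntegral_continuous Real.continuous_fourierChar
      (L := innerₗ ℝ) (by exact continuous_inner) hf
    have h2 : 𝓕⁻ ((𝓕 f : L2) : ℝ → ℂ) = (𝓕 ((𝓕 f : L2) : ℝ → ℂ)) ∘ Neg.neg := by
      ext x; exact Real.fourierInv_eq_fourier_neg _ _
    rw [h2]
    exact this.comp continuous_neg
  refine ae_eq_of_integral_contDiff_smul_eq (L2_locallyIntegrable f) hcont.locallyIntegrable ?_
  intro g hg hgc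
  have hg1 : ContDiff ℝ ∞ (fun x => (g x : ℂ)) := Complex.ofRealCLM.contDiff.comp hg
  have hg2 : HasCompactSupport (fun x => (g x : ℂ)) := hgc.comp_left Complex.ofReal_zero
  let ψ : 𝓢(ℝ, ℂ) := hg2.toSchwartzMap hg1
  have hψ : ∀ x, ψ x = g x := fun x => rfl
  have h1 := Lp.fourierInv_toTemperedDistribution_eq (𝓕 f : L2)
  rw [fourierInv_fourier_eq] at h1
  have h2 := congrArg (fun T : 𝓢'(ℝ, ℂ) => T ψ) h1
  simp only [TemperedDistribution.fourierInv_apply, Lp.toTemperedDistribution_apply] at h2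
  have h3 : ∫ x, g x • f x = ∫ x, ψ x • f x :=
    integral_congr_ae (Eventually.of_forall fun x => by simp [hψ])
  have h4 : ∫ x, g x • 𝓕⁻ ((𝓕 f : L2) : ℝ → ℂ) x = ∫ x, ψ x • 𝓕⁻ ((𝓕 f : L2) : ℝ → ℂ) x :=
    integral_congr_ae (Eventually.of_forall fun x => by simp [hψ])
  rw [h3, h4, ← h2]
  -- The sign in `-innerₗ ℝ` makes these Fourier integrals inverse transforms.
  have h5 := VectorFourier.integral_fourierIntegral_smul_eq_flip (μ := volume) (ν := volume)
    (L := -innerₗ ℝ) (f := (ψ : ℝ → ℂ)) (g := ((𝓕 f : L2) : ℝ → ℂ)) Real.continuous_fourierChar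
    (by simp only [LinearMap.neg_apply]; exact continuous_inner.neg) ψ.integrable hf
  rw [SchwartzMap.fourierInv_coe]
  convert! h5 using 3
  simp [Real.fourierInv_eq, VectorFourier.fourierIntegral, mul_comm]

theorem continuous_fourierInv_of_integrable {h : ℝ → ℂ} (hh : Integrable h) :
    Continuous (𝓕⁻ h) := by
  have := VectorFourier.fourierIntegral_continuous Real.continuous_fourierChar
    (L := innerₗ ℝ) (by exact continuous_inner) hh
  have h2 : 𝓕⁻ h = (𝓕 h) ∘ Neg.neg := by
    ext x; exact Real.fourierInv_eq_fourier_neg _ _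
  rw [h2]
  exact this.comp continuous_neg

theorem ae_norm_le_integral_fourier {f : L2} (hf : Integrable (𝓕 f : L2)) :
    ∀ᵐ x, ‖f x‖ ≤ ∫ ξ, ‖(𝓕 f : L2) ξ‖ := by
  filter_upwards [ae_eq_fourierInv_of_integrable hf] with x hx
  rw [hx, Real.fourierInv_eq]
  refine (norm_integral_le_integral_norm _).trans (le_of_eq ?_)
  simp_rw [Circle.norm_smul]

/-- Cauchy–Schwarz with a weight. -/
theorem integrable_of_weight {h : ℝ → ℂ} (hm : AEStronglyMeasurable h volume) {k : ℝ → ℝ}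
    (hk : Measurable k) (hk0 : ∀ ξ, 0 < k ξ) (h1 : Integrable fun ξ => (k ξ)⁻¹ ^ 2)
    (h2 : Integrable fun ξ => k ξ ^ 2 * ‖h ξ‖ ^ 2) :
    Integrable h ∧ ∫ ξ, ‖h ξ‖ ≤ √(∫ ξ, (k ξ)⁻¹ ^ 2) * √(∫ ξ, k ξ ^ 2 * ‖h ξ‖ ^ 2) := by
  have m1 : MemLp (fun ξ => (k ξ)⁻¹) 2 volume :=
    (memLp_two_iff_integrable_sq hk.inv.aestronglyMeasurable).2 h1
  have m2 : MemLp (fun ξ => k ξ * ‖h ξ‖) 2 volume := by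
    refine (memLp_two_iff_integrable_sq (hk.aestronglyMeasurable.mul hm.norm)).2 ?_
    simpa [mul_pow] using h2
  have e : ∀ ξ, (k ξ)⁻¹ * (k ξ * ‖h ξ‖) = ‖h ξ‖ := fun ξ => by
    rw [inv_mul_cancel_left₀ (hk0 ξ).ne']
  have hi := m1.integrable_mul m2
  have hi' : Integrable fun ξ => ‖h ξ‖ := hi.congr (Eventually.of_forall e)
  refine ⟨(integrable_norm_iff hm).1 hi', ?_⟩
  have h3 := integral_mul_le_Lp_mul_Lq_of_nonneg (μ := volume) Real.HolderConjugate.two_two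
    (f := fun ξ => (k ξ)⁻¹) (g := fun ξ => k ξ * ‖h ξ‖)
    (Eventually.of_forall fun ξ => (inv_pos.2 (hk0 ξ)).le)
    (Eventually.of_forall fun ξ => mul_nonneg (hk0 ξ).le (norm_nonneg _))
    (by simpa using m1) (by simpa using m2)
  simp_rw [e] at h3
  refine h3.trans (le_of_eq ?_)
  rw [Real.sqrt_eq_rpow, Real.sqrt_eq_rpow]
  norm_cast
  simp only [mul_pow]

/-- Cauchy–Schwarz with the weight (1 + ξ²)^{1/2} makes 𝓕 f integrable. Fourier inversion then
supplies the continuous representative. -/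
theorem HasDerivL2.exists_continuous {f g : L2} (h : HasDerivL2 f g) :
    ∃ F : ℝ → ℂ, Continuous F ∧ F =ᵐ[volume] f ∧ ∀ x y, F y - F x = ∫ t in x..y, g t := by
  have hi : Integrable (𝓕 f : L2) := by
    refine (integrable_of_weight (k := fun ξ => √(1 + ξ ^ 2)) (Lp.aestronglyMeasurable _)
      (by fun_prop) (fun ξ => by positivity) ?_ ?_).1
    · have : (fun ξ : ℝ => (√(1 + ξ ^ 2))⁻¹ ^ 2) = fun ξ => (1 + ξ ^ 2)⁻¹ := by
        ext ξ
        rw [inv_pow, Real.sq_sqrt (by positivity)]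
      rw [this]
      exact integrable_inv_one_add_sq
    · have : Integrable fun ξ => ‖(𝓕 f : L2) ξ‖ ^ 2 + (2 * Real.pi)⁻¹ ^ 2 * ‖(𝓕 g : L2) ξ‖ ^ 2 :=
        (L2_integrable_norm_sq _).add ((L2_integrable_norm_sq _).const_mul _)
      refine this.congr ?_
      filter_upwards [h] with ξ hξ
      rw [hξ, Real.sq_sqrt (by positivity)]
      simp only [norm_mul, Complex.norm_I, Complex.norm_real, Real.norm_eq_abs, mul_pow, sq_abs,
        Complex.norm_ofNat]
      have := Real.pi_pos
      field_simp
  refine ⟨𝓕⁻ ((𝓕 f : L2) : ℝ → ℂ), continuous_fourierInv_of_integrable hi,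
    (ae_eq_fourierInv_of_integrable hi).symm, fun x y => ?_⟩
  exact (h.hasWeakDerivOn (ae_eq_fourierInv_of_integrable hi).symm).ftc isOpen_univ ordConnected_univ
    (continuous_fourierInv_of_integrable hi).aestronglyMeasurable
    (continuous_fourierInv_of_integrable hi).continuousOn (L2_locallyIntegrable g) trivial trivial

/-! ### The sign function and parity -/

/-- The sign of `x` as a complex number (with value `-1` at the origin). -/
def sgnC (x : ℝ) : ℂ := if 0 < x then 1 else -1

theorem sgnC_of_pos {x : ℝ} (h : 0 < x) : sgnC x = 1 := if_pos h

theorem sgnC_of_neg {x : ℝ} (h : x < 0) : sgnC x = -1 := if_neg (not_lt.2 h.le)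

theorem sgnC_mul_self (x : ℝ) : sgnC x * sgnC x = 1 := by
  unfold sgnC; split_ifs <;> norm_num

theorem norm_sgnC (x : ℝ) : ‖sgnC x‖ = 1 := by
  unfold sgnC; split_ifs <;> simp

theorem sgnC_conj (x : ℝ) : (starRingEnd ℂ) (sgnC x) = sgnC x := by
  unfold sgnC; split_ifs <;> simp

theorem ae_ne_zero : ∀ᵐ x : ℝ, x ≠ 0 := by simp [ae_iff, measure_singleton]

theorem sgnC_neg {x : ℝ} (h : x ≠ 0) : sgnC (-x) = -sgnC x := by
  rcases lt_or_gt_of_ne h with h | h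
  · rw [sgnC_of_neg h, sgnC_of_pos (by linarith), neg_neg]
  · rw [sgnC_of_pos h, sgnC_of_neg (by linarith)]

theorem isBddSymbol_sgnC : IsBddSymbol sgnC :=
  ⟨Measurable.ite measurableSet_Ioi measurable_const measurable_const, 1,
    fun x => (norm_sgnC x).le⟩

/-- Multiplication by the sign function. -/
def sgnL2 : L2 →L[ℂ] L2 := mulL2 sgnC

theorem sgnL2_ae (f : L2) : sgnL2 f =ᵐ[volume] fun x => sgnC x * f x := mulL2_ae isBddSymbol_sgnC f

theorem sgnL2_sgnL2 (f : L2) : sgnL2 (sgnL2 f) = f := by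
  rw [sgnL2, mulL2_mulL2 isBddSymbol_sgnC isBddSymbol_sgnC]
  simp_rw [sgnC_mul_self]
  exact mulL2_one f

theorem reflL2_sgnL2 (f : L2) : reflL2 (sgnL2 f) = -sgnL2 (reflL2 f) := by
  apply Lp.ext
  filter_upwards [reflL2_ae (sgnL2 f), ae_comp_neg (sgnL2_ae f), Lp.coeFn_neg (sgnL2 (reflL2 f)),
    sgnL2_ae (reflL2 f), reflL2_ae f, ae_ne_zero] with x h1 h2 h3 h4 h5 h6
  rw [h1, h2, h3, Pi.neg_apply, h4, h5, sgnC_neg h6, neg_mul]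

theorem inner_sgnL2_left (f g : L2) : inner ℂ (sgnL2 f) g = inner ℂ f (sgnL2 g) := by
  rw [sgnL2, inner_mulL2_left isBddSymbol_sgnC]
  simp_rw [sgnC_conj]

/-- If `f ∈ H¹` vanishes at the origin, so does `sgn · f`, with weak derivative `sgn · f'`. -/
theorem HasDerivL2.sgn {f g : L2} {F : ℝ → ℂ} (hFc : Continuous F) (hF : F =ᵐ[volume] f)
    (hF0 : F 0 = 0) (h : ∀ x y, F y - F x = ∫ t in x..y, g t) :
    HasDerivL2 (sgnL2 f) (sgnL2 g) := by
  refine HasDerivL2.of_piecewise (F := fun x => sgnC x * F x) (c := 0) ?_ ?_ ?_ ?_ ?_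
  · filter_upwards [sgnL2_ae f, hF] with x h1 h2
    rw [h1, h2]
  · intro x y hx hy
    rw [sgnC_of_pos hx, sgnC_of_pos hy, one_mul, one_mul, h]
    refine intervalIntegral.integral_congr_ae ?_
    filter_upwards [sgnL2_ae g] with t ht htm
    have : 0 < t := (lt_min hx hy).trans htm.1
    rw [ht, sgnC_of_pos this, one_mul]
  · intro x y hx hy
    rw [sgnC_of_neg hx, sgnC_of_neg hy, ← mul_sub, h, ← intervalIntegral.integral_const_mul]
    refine intervalIntegral.integral_congr_ae ?_
    filter_upwards [sgnL2_ae g] with t ht htm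
    have : t < 0 := htm.2.trans_lt (max_lt hx hy)
    rw [ht, sgnC_of_neg this]
  · have h1 : Tendsto F (𝓝[>] 0) (𝓝 0) := by
      simpa [hF0] using (hFc.tendsto 0).mono_left (nhdsWithin_le_nhds (s := Ioi 0))
    refine h1.congr' ?_
    filter_upwards [self_mem_nhdsWithin] with x hx
    rw [sgnC_of_pos hx, one_mul]
  · have h1 : Tendsto (fun x => -F x) (𝓝[<] 0) (𝓝 0) := by
      simpa [hF0] using ((hFc.tendsto 0).mono_left (nhdsWithin_le_nhds (s := Iio 0))).neg
    refine h1.congr' ?_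
    filter_upwards [self_mem_nhdsWithin] with x hx
    rw [sgnC_of_neg hx, neg_one_mul]

/-- Continuous functions that agree almost everywhere agree everywhere. At x = 0 this forces F 0 =
0. -/
theorem odd_of_ae {f : L2} (hf : reflL2 f = -f) {F : ℝ → ℂ} (hFc : Continuous F)
    (hF : F =ᵐ[volume] f) (x : ℝ) : F (-x) = -F x := by
  have h : (fun x => F (-x)) =ᵐ[volume] fun x => -F x := by
    have h1 := reflL2_ae f
    rw [hf] at h1
    filter_upwards [h1, Lp.coeFn_neg f, hF, ae_comp_neg hF] with x h1 h2 h3 h4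
    rw [h4, ← h1, h2, Pi.neg_apply, h3]
  exact congrFun ((hFc.comp continuous_neg).ae_eq_iff_eq volume hFc.neg |>.1 h) x

/-- An odd H¹ function vanishes at the origin, so multiplication by the sign creates no jump. All
commutations of sgn with ∂ₓ on odd functions rest on this. -/
theorem HasDerivL2.sgn_of_odd {f g : L2} (hf : reflL2 f = -f) (h : HasDerivL2 f g) :
    HasDerivL2 (sgnL2 f) (sgnL2 g) := by
  obtain ⟨F, hFc, hF, hFTC⟩ := h.exists_continuous
  refine HasDerivL2.sgn hFc hF ?_ hFTC
  have h0 := odd_of_ae hf hFc hF 0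
  rw [neg_zero] at h0
  exact self_eq_neg.1 h0

/-- The projection to the even functions. -/
def evenL2 : L2 →L[ℂ] L2 := (1 / 2 : ℂ) • (ContinuousLinearMap.id ℂ L2 + reflL2)

/-- The projection to the odd functions. -/
def oddL2 : L2 →L[ℂ] L2 := (1 / 2 : ℂ) • (ContinuousLinearMap.id ℂ L2 - reflL2)

theorem evenL2_apply (f : L2) : evenL2 f = (1 / 2 : ℂ) • (f + reflL2 f) := rfl

theorem oddL2_apply (f : L2) : oddL2 f = (1 / 2 : ℂ) • (f - reflL2 f) := rfl

theorem oddL2_add_evenL2 (f : L2) : oddL2 f + evenL2 f = f := by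
  rw [oddL2_apply, evenL2_apply]; module

theorem reflL2_evenL2 (f : L2) : reflL2 (evenL2 f) = evenL2 f := by
  rw [evenL2_apply, map_smul, map_add, reflL2_reflL2, add_comm]

theorem reflL2_oddL2 (f : L2) : reflL2 (oddL2 f) = -oddL2 f := by
  rw [oddL2_apply, map_smul, map_sub, reflL2_reflL2]; module

theorem evenL2_of_even {f : L2} (h : reflL2 f = f) : evenL2 f = f := by
  rw [evenL2_apply, h]; module

theorem evenL2_of_odd {f : L2} (h : reflL2 f = -f) : evenL2 f = 0 := by
  rw [evenL2_apply, h]; module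

theorem oddL2_of_even {f : L2} (h : reflL2 f = f) : oddL2 f = 0 := by
  rw [oddL2_apply, h]; module

theorem oddL2_of_odd {f : L2} (h : reflL2 f = -f) : oddL2 f = f := by
  rw [oddL2_apply, h]; module

theorem inner_evenL2_left (f g : L2) : inner ℂ (evenL2 f) g = inner ℂ f (evenL2 g) := by
  simp only [evenL2_apply, inner_smul_left, inner_smul_right, inner_add_left, inner_add_right,
    inner_reflL2_left]
  simp [Complex.conj_ofNat]

theorem inner_oddL2_left (f g : L2) : inner ℂ (oddL2 f) g = inner ℂ f (oddL2 g) := by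
  simp only [oddL2_apply, inner_smul_left, inner_smul_right, inner_sub_left, inner_sub_right,
    inner_reflL2_left]
  simp [Complex.conj_ofNat]

/-! ### The transform diagonalizing the even part of the delta Laplacian -/

/-- The symbol `(4π²ξ² + κ²)^{1/2}`. -/
def deltaDen (κ ξ : ℝ) : ℝ := √((2 * Real.pi * ξ) ^ 2 + κ ^ 2)

theorem deltaDen_sq (κ ξ : ℝ) : deltaDen κ ξ ^ 2 = (2 * Real.pi * ξ) ^ 2 + κ ^ 2 :=
  Real.sq_sqrt (by positivity)

theorem deltaDen_pos {κ : ℝ} (hκ : κ ≠ 0) (ξ : ℝ) : 0 < deltaDen κ ξ :=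
  Real.sqrt_pos.2 (by positivity)

theorem deltaDen_neg (κ ξ : ℝ) : deltaDen κ (-ξ) = deltaDen κ ξ := by
  simp [deltaDen]

/-- The symbol of `∂ₓ (κ² - ∂ₓ²)^{-1/2}`. -/
def rieszSymbol (κ ξ : ℝ) : ℂ := ((2 * Real.pi * ξ / deltaDen κ ξ : ℝ) : ℂ) * Complex.I

/-- The symbol of `κ (κ² - ∂ₓ²)^{-1/2}`. -/
def besselSymbol (κ ξ : ℝ) : ℂ := ((κ / deltaDen κ ξ : ℝ) : ℂ)

theorem norm_rieszSymbol_le {κ : ℝ} (hκ : κ ≠ 0) (ξ : ℝ) : ‖rieszSymbol κ ξ‖ ≤ 1 := by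
  rw [rieszSymbol, norm_mul, Complex.norm_I, mul_one, Complex.norm_real, Real.norm_eq_abs, abs_div,
    abs_of_pos (deltaDen_pos hκ ξ), div_le_one (deltaDen_pos hκ ξ)]
  exact Real.abs_le_sqrt (by nlinarith [sq_nonneg κ])

theorem norm_besselSymbol_le {κ : ℝ} (hκ : κ ≠ 0) (ξ : ℝ) : ‖besselSymbol κ ξ‖ ≤ 1 := by
  rw [besselSymbol, Complex.norm_real, Real.norm_eq_abs, abs_div,
    abs_of_pos (deltaDen_pos hκ ξ), div_le_one (deltaDen_pos hκ ξ)]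
  exact Real.abs_le_sqrt (by nlinarith [sq_nonneg (2 * Real.pi * ξ)])

theorem measurable_deltaDen (κ : ℝ) : Measurable (deltaDen κ) := by
  unfold deltaDen; fun_prop

theorem isBddSymbol_rieszSymbol {κ : ℝ} (hκ : κ ≠ 0) : IsBddSymbol (rieszSymbol κ) := by
  refine ⟨?_, 1, norm_rieszSymbol_le hκ⟩
  have := measurable_deltaDen κ
  unfold rieszSymbol
  fun_prop

theorem isBddSymbol_besselSymbol {κ : ℝ} (hκ : κ ≠ 0) : IsBddSymbol (besselSymbol κ) := by
  refine ⟨?_, 1, norm_besselSymbol_le hκ⟩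
  have := measurable_deltaDen κ
  unfold besselSymbol
  fun_prop

theorem besselSymbol_sq_sub {κ : ℝ} (hκ : κ ≠ 0) (ξ : ℝ) :
    besselSymbol κ ξ * besselSymbol κ ξ - rieszSymbol κ ξ * rieszSymbol κ ξ = 1 := by
  have h := (deltaDen_pos hκ ξ).ne'
  have h2 := deltaDen_sq κ ξ
  have h3 : besselSymbol κ ξ * besselSymbol κ ξ - rieszSymbol κ ξ * rieszSymbol κ ξ =
      (((κ ^ 2 + (2 * Real.pi * ξ) ^ 2) / deltaDen κ ξ ^ 2 : ℝ) : ℂ) := by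
    rw [besselSymbol, rieszSymbol]
    push_cast
    ring_nf
    rw [Complex.I_sq]
    ring
  rw [h3, h2, add_comm (κ ^ 2), div_self (by positivity), Complex.ofReal_one]

/-- The Fourier multiplier `∂ₓ (κ² - ∂ₓ²)^{-1/2}`. -/
def rieszL2 (κ : ℝ) : L2 →L[ℂ] L2 := fourierMul (rieszSymbol κ)

/-- The Fourier multiplier `κ (κ² - ∂ₓ²)^{-1/2}`. -/
def besselL2 (κ : ℝ) : L2 →L[ℂ] L2 := fourierMul (besselSymbol κ)

section
variable {κ : ℝ}

theorem besselL2_sub_rieszL2 (hκ : κ ≠ 0) (f : L2) :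
    besselL2 κ (besselL2 κ f) - rieszL2 κ (rieszL2 κ f) = f := by
  rw [besselL2, rieszL2, fourierMul_fourierMul (isBddSymbol_besselSymbol hκ)
    (isBddSymbol_besselSymbol hκ), fourierMul_fourierMul (isBddSymbol_rieszSymbol hκ)
    (isBddSymbol_rieszSymbol hκ)]
  apply fourier_L2_injective
  have hm : ∀ f g : L2, 𝓕 (f - g) = 𝓕 f - 𝓕 g := (Lp.fourierTransformₗᵢ ℝ ℂ).map_sub
  rw [hm, fourier_fourierMul, fourier_fourierMul]
  apply Lp.ext
  filter_upwards [Lp.coeFn_sub (mulL2 (fun x => besselSymbol κ x * besselSymbol κ x) (𝓕 f))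
      (mulL2 (fun x => rieszSymbol κ x * rieszSymbol κ x) (𝓕 f)),
    mulL2_ae ((isBddSymbol_besselSymbol hκ).mul (isBddSymbol_besselSymbol hκ)) (𝓕 f),
    mulL2_ae ((isBddSymbol_rieszSymbol hκ).mul (isBddSymbol_rieszSymbol hκ)) (𝓕 f)] with ξ h1 h2 h3
  rw [h1, Pi.sub_apply, h2, h3, ← sub_mul, besselSymbol_sq_sub hκ, one_mul]

theorem fourierMul_neg {m : ℝ → ℂ} (hm : IsBddSymbol m) (f : L2) :
    fourierMul (fun x => -m x) f = -fourierMul m f := by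
  apply fourier_L2_injective
  have hn : 𝓕 (-fourierMul m f) = -𝓕 (fourierMul m f) := (Lp.fourierTransformₗᵢ ℝ ℂ).map_neg _
  rw [hn, fourier_fourierMul, fourier_fourierMul]
  have hm' : IsBddSymbol (fun x => -m x) := ⟨hm.1.neg, by simpa using hm.2⟩
  symm
  refine eq_mulL2 hm' ?_
  filter_upwards [Lp.coeFn_neg (mulL2 m (𝓕 f)), mulL2_ae hm (𝓕 f)] with x h1 h2
  rw [h1, Pi.neg_apply, h2, neg_mul]

theorem reflL2_rieszL2 (hκ : κ ≠ 0) (f : L2) : reflL2 (rieszL2 κ f) = -rieszL2 κ (reflL2 f) := by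
  rw [rieszL2, reflL2_fourierMul (isBddSymbol_rieszSymbol hκ),
    ← fourierMul_neg (isBddSymbol_rieszSymbol hκ)]
  congr 2
  ext ξ
  simp only [rieszSymbol, deltaDen_neg]
  push_cast
  ring

theorem reflL2_besselL2 (hκ : κ ≠ 0) (f : L2) : reflL2 (besselL2 κ f) = besselL2 κ (reflL2 f) := by
  rw [besselL2, reflL2_fourierMul (isBddSymbol_besselSymbol hκ)]
  congr 2
  ext ξ
  simp only [besselSymbol, deltaDen_neg]

theorem inner_rieszL2_left (hκ : κ ≠ 0) (f g : L2) :
    inner ℂ (rieszL2 κ f) g = -inner ℂ f (rieszL2 κ g) := by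
  rw [rieszL2, inner_fourierMul_left (isBddSymbol_rieszSymbol hκ), ← inner_neg_right,
    ← fourierMul_neg (isBddSymbol_rieszSymbol hκ)]
  congr 3
  ext ξ
  simp [rieszSymbol, Complex.conj_ofNat]

theorem inner_besselL2_left (hκ : κ ≠ 0) (f g : L2) :
    inner ℂ (besselL2 κ f) g = inner ℂ f (besselL2 κ g) := by
  rw [besselL2, inner_fourierMul_left (isBddSymbol_besselSymbol hκ)]
  congr 3
  ext ξ
  simp [besselSymbol]

/-- The two symbols have the same denominator, and multiplying the Bessel symbol by 2πiξ gives κ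
times the Riesz symbol. In particular `besselL2 κ` maps all of L² into H¹. -/
theorem hasDerivL2_besselL2 (hκ : κ ≠ 0) (f : L2) :
    HasDerivL2 (besselL2 κ f) ((κ : ℂ) • rieszL2 κ f) := by
  have hs : 𝓕 ((κ : ℂ) • rieszL2 κ f) = (κ : ℂ) • 𝓕 (rieszL2 κ f) :=
    (Lp.fourierTransformₗᵢ ℝ ℂ).map_smul _ _
  rw [HasDerivL2, hs, rieszL2, besselL2, fourier_fourierMul, fourier_fourierMul]
  filter_upwards [Lp.coeFn_smul (κ : ℂ) (mulL2 (rieszSymbol κ) (𝓕 f)),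
    mulL2_ae (isBddSymbol_rieszSymbol hκ) (𝓕 f), mulL2_ae (isBddSymbol_besselSymbol hκ) (𝓕 f)]
    with ξ h1 h2 h3
  rw [h1, Pi.smul_apply, h2, h3, rieszSymbol, besselSymbol, smul_eq_mul]
  push_cast
  ring

theorem HasDerivL2.rieszL2_eq (hκ : κ ≠ 0) {f g : L2} (h : HasDerivL2 f g) :
    (κ : ℂ) • rieszL2 κ f = besselL2 κ g := by
  apply fourier_L2_injective
  have hs : 𝓕 ((κ : ℂ) • rieszL2 κ f) = (κ : ℂ) • 𝓕 (rieszL2 κ f) :=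
    (Lp.fourierTransformₗᵢ ℝ ℂ).map_smul _ _
  rw [hs, rieszL2, besselL2, fourier_fourierMul, fourier_fourierMul]
  apply Lp.ext
  filter_upwards [Lp.coeFn_smul (κ : ℂ) (mulL2 (rieszSymbol κ) (𝓕 f)),
    mulL2_ae (isBddSymbol_rieszSymbol hκ) (𝓕 f), mulL2_ae (isBddSymbol_besselSymbol hκ) (𝓕 g), h]
    with ξ h1 h2 h3 h4
  rw [h1, Pi.smul_apply, h2, h3, h4, rieszSymbol, besselSymbol, smul_eq_mul]
  push_cast
  ring

/-- On odd functions the two multipliers commute across the sign function. -/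
theorem rieszL2_sgn_besselL2 (hκ : κ ≠ 0) {f : L2} (hf : reflL2 f = -f) :
    rieszL2 κ (sgnL2 (besselL2 κ f)) = besselL2 κ (sgnL2 (rieszL2 κ f)) := by
  have h1 : reflL2 (besselL2 κ f) = -besselL2 κ f := by
    rw [reflL2_besselL2 hκ, hf, map_neg]
  -- Write R, Q for the two multipliers. Since Qf is odd, ∂ₓ(sgn Qf) = κ sgn Rf. The identity κR =
  -- Q∂ₓ on H¹, applied to sgn Qf, is κ times the claim.
  have h2 := ((hasDerivL2_besselL2 hκ f).sgn_of_odd h1).rieszL2_eq hκ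
  rw [map_smul, map_smul] at h2
  exact smul_right_injective _ (Complex.ofReal_ne_zero.2 hκ) h2

/-- The generalized cosine transform: from even to odd functions. -/
def deltaC (κ : ℝ) : L2 →L[ℂ] L2 := (rieszL2 κ + besselL2 κ ∘L sgnL2) ∘L evenL2

/-- The adjoint of the generalized cosine transform: from odd to even functions. -/
def deltaB (κ : ℝ) : L2 →L[ℂ] L2 := (-rieszL2 κ + sgnL2 ∘L besselL2 κ) ∘L oddL2

theorem deltaC_apply (κ : ℝ) (f : L2) :
    deltaC κ f = rieszL2 κ (evenL2 f) + besselL2 κ (sgnL2 (evenL2 f)) := rfl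

theorem deltaB_apply (κ : ℝ) (f : L2) :
    deltaB κ f = -rieszL2 κ (oddL2 f) + sgnL2 (besselL2 κ (oddL2 f)) := rfl

theorem reflL2_deltaB (hκ : κ ≠ 0) (f : L2) : reflL2 (deltaB κ f) = deltaB κ f := by
  rw [deltaB_apply, map_add, map_neg, reflL2_rieszL2 hκ, reflL2_oddL2, reflL2_sgnL2,
    reflL2_besselL2 hκ, reflL2_oddL2, map_neg, map_neg, map_neg]
  simp

theorem reflL2_deltaC (hκ : κ ≠ 0) (f : L2) : reflL2 (deltaC κ f) = -deltaC κ f := by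
  rw [deltaC_apply, map_add, reflL2_rieszL2 hκ, reflL2_evenL2, reflL2_besselL2 hκ,
    reflL2_sgnL2, reflL2_evenL2, map_neg]
  abel

/-- The Riesz multiplier is skew-adjoint, while the Bessel multiplier, the sign and the parity
projections are self-adjoint. -/
theorem inner_deltaB_left (hκ : κ ≠ 0) (f g : L2) :
    inner ℂ (deltaB κ f) g = inner ℂ f (deltaC κ g) := by
  have key : ∀ h k : L2, inner ℂ (-rieszL2 κ h + sgnL2 (besselL2 κ h)) k =
      inner ℂ h (rieszL2 κ k + besselL2 κ (sgnL2 k)) := fun h k => by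
    rw [inner_add_left, inner_add_right, inner_neg_left, inner_rieszL2_left hκ, neg_neg,
      inner_sgnL2_left, inner_besselL2_left hκ]
  rw [← evenL2_of_even (reflL2_deltaB hκ f), inner_evenL2_left, deltaB_apply, key,
    ← deltaC_apply, inner_oddL2_left, oddL2_of_odd (reflL2_deltaC hκ g)]

theorem deltaC_oddL2 (f : L2) : deltaC κ (oddL2 f) = 0 := by
  rw [deltaC_apply, evenL2_of_odd (reflL2_oddL2 f)]; simp

theorem deltaC_evenL2 (f : L2) : deltaC κ (evenL2 f) = deltaC κ f := by
  rw [deltaC_apply, evenL2_of_even (reflL2_evenL2 f), deltaC_apply]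

/-- With R, Q the multipliers and S the sign, (R + QS)(-R + SQ) = Q² - R² + (RSQ - QSR). On odd
functions the bracket vanishes, and Q² - R² = 1. Thus `deltaB` is isometric on odd functions, and
`deltaB ∘ deltaC` is the orthogonal projection onto its range. -/
theorem deltaC_deltaB (hκ : κ ≠ 0) (f : L2) : deltaC κ (deltaB κ f) = oddL2 f := by
  rw [deltaC_apply, evenL2_of_even (reflL2_deltaB hκ f), deltaB_apply]
  simp only [map_add, map_neg, sgnL2_sgnL2]
  rw [rieszL2_sgn_besselL2 hκ (reflL2_oddL2 f)]
  conv_rhs => rw [← besselL2_sub_rieszL2 hκ (oddL2 f)]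
  abel

end

/-! ### The propagator -/

/-- The symbol of `-∂ₓ²`, with a minus sign. -/
def freeSymbol (ξ : ℝ) : ℝ := -(2 * Real.pi * ξ) ^ 2

theorem measurable_freeSymbol : Measurable freeSymbol := by unfold freeSymbol; fun_prop

/-- The free Schrödinger propagator. -/
def freeProp (t : ℝ) : L2 →L[ℂ] L2 := fourierGroup freeSymbol t

theorem freeProp_add (t r : ℝ) (f : L2) : freeProp t (freeProp r f) = freeProp (t + r) f := by
  rw [freeProp, freeProp, fourierGroup, fourierGroup,
    fourierMul_fourierMul (isBddSymbol_groupSymbol measurable_freeSymbol t)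
      (isBddSymbol_groupSymbol measurable_freeSymbol r)]
  simp_rw [groupSymbol_add]
  rfl

theorem freeProp_zero (f : L2) : freeProp 0 f = f := by
  rw [freeProp, fourierGroup]
  have : groupSymbol freeSymbol 0 = fun _ => 1 := funext fun ξ => groupSymbol_zero _ ξ
  rw [this, fourierMul_one]

theorem inner_freeProp_left (t : ℝ) (f g : L2) :
    inner ℂ (freeProp t f) g = inner ℂ f (freeProp (-t) g) := by
  rw [freeProp, freeProp, fourierGroup, fourierGroup,
    inner_fourierMul_left (isBddSymbol_groupSymbol measurable_freeSymbol t)]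
  simp_rw [groupSymbol_conj]

theorem reflL2_freeProp (t : ℝ) (f : L2) : reflL2 (freeProp t f) = freeProp t (reflL2 f) := by
  rw [freeProp, fourierGroup, reflL2_fourierMul (isBddSymbol_groupSymbol measurable_freeSymbol t)]
  congr 2
  ext ξ
  simp [groupSymbol, freeSymbol]

theorem oddL2_freeProp (t : ℝ) (f : L2) : oddL2 (freeProp t f) = freeProp t (oddL2 f) := by
  rw [oddL2_apply, oddL2_apply, reflL2_freeProp, map_smul, map_sub]

/-- The bound state phase `e^{itκ²}`. -/
def boundPhase (κ t : ℝ) : ℂ := Complex.exp ((t * κ ^ 2 : ℝ) * Complex.I)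

/-- The projection to the bound state of the delta potential. -/
def boundProj (κ : ℝ) : L2 →L[ℂ] L2 := evenL2 - deltaB κ ∘L deltaC κ

theorem boundProj_apply (κ : ℝ) (f : L2) :
    boundProj κ f = evenL2 f - deltaB κ (deltaC κ f) := rfl

/-- The Schrödinger propagator with a delta potential, as a bounded operator. -/
def deltaProp (κ t : ℝ) : L2 →L[ℂ] L2 :=
  freeProp t ∘L oddL2 + deltaB κ ∘L freeProp t ∘L deltaC κ + boundPhase κ t • boundProj κ

theorem deltaProp_apply (κ t : ℝ) (f : L2) :
    deltaProp κ t f = freeProp t (oddL2 f) + deltaB κ (freeProp t (deltaC κ f)) +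
      boundPhase κ t • boundProj κ f := rfl

section
variable {κ : ℝ}

/-- The maps `oddL2`, `deltaC` and `boundProj` intertwine `deltaProp` with the free flow, the free
flow and a scalar phase respectively. Since f = odd f + BCf + Pf, these three images determine f,
which gives the group law and later the generator. -/
theorem oddL2_deltaProp (hκ : κ ≠ 0) (t : ℝ) (f : L2) :
    oddL2 (deltaProp κ t f) = freeProp t (oddL2 f) := by
  rw [deltaProp_apply, boundProj_apply, map_add, map_add, map_smul, map_sub, oddL2_freeProp,
    oddL2_of_odd (reflL2_oddL2 f), oddL2_of_even (reflL2_deltaB hκ _),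
    oddL2_of_even (reflL2_deltaB hκ _), oddL2_of_even (reflL2_evenL2 f)]
  simp

theorem oddL2_deltaC (hκ : κ ≠ 0) (f : L2) : oddL2 (deltaC κ f) = deltaC κ f :=
  oddL2_of_odd (reflL2_deltaC hκ f)

/-- C(E - BC) = C - (CB)C, and CB is the identity on the odd range of C. -/
theorem deltaC_boundProj (hκ : κ ≠ 0) (f : L2) : deltaC κ (boundProj κ f) = 0 := by
  rw [boundProj_apply, map_sub, deltaC_evenL2, deltaC_deltaB hκ, oddL2_deltaC hκ, sub_self]

theorem evenL2_boundProj (hκ : κ ≠ 0) (f : L2) : evenL2 (boundProj κ f) = boundProj κ f := by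
  rw [boundProj_apply, map_sub, evenL2_of_even (reflL2_deltaB hκ _),
    evenL2_of_even (reflL2_evenL2 f)]

theorem deltaC_deltaProp (hκ : κ ≠ 0) (t : ℝ) (f : L2) :
    deltaC κ (deltaProp κ t f) = freeProp t (deltaC κ f) := by
  rw [deltaProp_apply, map_add, map_add, map_smul, deltaC_boundProj hκ, ← oddL2_freeProp,
    deltaC_oddL2, deltaC_deltaB hκ, oddL2_freeProp, oddL2_deltaC hκ]
  simp

theorem boundProj_deltaProp (hκ : κ ≠ 0) (t : ℝ) (f : L2) :
    boundProj κ (deltaProp κ t f) = boundPhase κ t • boundProj κ f := by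
  rw [boundProj_apply, deltaC_deltaProp hκ]
  have h : evenL2 (deltaProp κ t f) = deltaProp κ t f - oddL2 (deltaProp κ t f) := by
    rw [eq_sub_iff_add_eq, add_comm, oddL2_add_evenL2]
  rw [h, oddL2_deltaProp hκ, deltaProp_apply]
  abel

theorem boundPhase_add (κ t r : ℝ) : boundPhase κ t * boundPhase κ r = boundPhase κ (t + r) := by
  rw [boundPhase, boundPhase, boundPhase, ← Complex.exp_add]
  push_cast
  ring_nf

theorem deltaProp_add (hκ : κ ≠ 0) (t r : ℝ) (f : L2) :
    deltaProp κ t (deltaProp κ r f) = deltaProp κ (t + r) f := by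
  rw [deltaProp_apply κ t, oddL2_deltaProp hκ, deltaC_deltaProp hκ, boundProj_deltaProp hκ,
    freeProp_add, freeProp_add, smul_smul, boundPhase_add, ← deltaProp_apply]

theorem deltaProp_zero (f : L2) : deltaProp κ 0 f = f := by
  rw [deltaProp_apply, freeProp_zero, freeProp_zero, boundProj_apply]
  have : boundPhase κ 0 = 1 := by simp [boundPhase]
  rw [this, one_smul, add_add_sub_cancel, oddL2_add_evenL2]

theorem inner_deltaB_right (hκ : κ ≠ 0) (f g : L2) :
    inner ℂ f (deltaB κ g) = inner ℂ (deltaC κ f) g := by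
  rw [← inner_conj_symm, inner_deltaB_left hκ, inner_conj_symm]

theorem inner_deltaProp_left (hκ : κ ≠ 0) (t : ℝ) (f g : L2) :
    inner ℂ (deltaProp κ t f) g = inner ℂ f (deltaProp κ (-t) g) := by
  have hb : (starRingEnd ℂ) (boundPhase κ t) = boundPhase κ (-t) := by
    rw [boundPhase, boundPhase, ← Complex.exp_conj]; simp
  simp only [deltaProp_apply, boundProj_apply, inner_add_left, inner_add_right, inner_smul_left,
    inner_smul_right, inner_sub_left, inner_sub_right, hb, inner_freeProp_left, inner_oddL2_left,
    inner_evenL2_left, inner_deltaB_left hκ, inner_deltaB_right hκ, oddL2_freeProp]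

theorem norm_deltaProp (hκ : κ ≠ 0) (t : ℝ) (f : L2) : ‖deltaProp κ t f‖ = ‖f‖ := by
  have h := inner_deltaProp_left hκ t f (deltaProp κ t f)
  rw [deltaProp_add hκ, neg_add_cancel, deltaProp_zero, inner_self_eq_norm_sq_to_K,
    inner_self_eq_norm_sq_to_K] at h
  have h2 : ‖deltaProp κ t f‖ ^ 2 = ‖f‖ ^ 2 := by exact_mod_cast h
  exact (sq_eq_sq₀ (norm_nonneg _) (norm_nonneg _)).1 h2

/-- The Schrödinger propagator with a delta potential, as a unitary operator. -/
def deltaUnitary (hκ : κ ≠ 0) (t : ℝ) : L2 ≃ₗᵢ[ℂ] L2 where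
  toFun := deltaProp κ t
  map_add' := map_add _
  map_smul' := map_smul _
  invFun := deltaProp κ (-t)
  left_inv f := by rw [deltaProp_add hκ, neg_add_cancel, deltaProp_zero]
  right_inv f := by rw [deltaProp_add hκ, add_neg_cancel, deltaProp_zero]
  norm_map' := norm_deltaProp hκ t

theorem continuous_boundPhase (κ : ℝ) : Continuous (boundPhase κ) := by
  unfold boundPhase; fun_prop

theorem continuous_deltaProp (κ : ℝ) (f : L2) : Continuous fun t => deltaProp κ t f := by
  simp only [deltaProp_apply]
  exact ((continuous_fourierGroup measurable_freeSymbol _).add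
    ((deltaB κ).continuous.comp (continuous_fourierGroup measurable_freeSymbol _))).add
    ((continuous_boundPhase κ).smul continuous_const)

end

/-! ### Functions that are piecewise in `H¹` -/

/-- `F` is a primitive of `g` on each half-line, with limits `c` and `d` at `0+` and `0-`. -/
structure PiecewisePrimitive (F : ℝ → ℂ) (g : L2) (c d : ℂ) : Prop where
  pos : ∀ x y, 0 < x → 0 < y → F y - F x = ∫ t in x..y, g t
  neg : ∀ x y, x < 0 → y < 0 → F y - F x = ∫ t in x..y, g t
  right : Tendsto F (𝓝[>] 0) (𝓝 c)
  left : Tendsto F (𝓝[<] 0) (𝓝 d)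

namespace PiecewisePrimitive

theorem hasDerivL2 {F : ℝ → ℂ} {f g : L2} {c d : ℂ} (h : PiecewisePrimitive F g c d)
    (hcd : c = d) (hF : F =ᵐ[volume] f) : HasDerivL2 f g := by
  subst hcd
  exact HasDerivL2.of_piecewise hF h.pos h.neg h.right h.left

theorem add {F F₁ : ℝ → ℂ} {g g₁ : L2} {c d c₁ d₁ : ℂ} (h : PiecewisePrimitive F g c d)
    (h₁ : PiecewisePrimitive F₁ g₁ c₁ d₁) :
    PiecewisePrimitive (fun x => F x + F₁ x) (g + g₁) (c + c₁) (d + d₁) := by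
  have key : ∀ x y, ∫ t in x..y, (g + g₁) t = (∫ t in x..y, g t) + ∫ t in x..y, g₁ t := by
    intro x y
    rw [← intervalIntegral.integral_add (L2_intervalIntegrable g _ _)
      (L2_intervalIntegrable g₁ _ _)]
    refine intervalIntegral.integral_congr_ae ?_
    filter_upwards [Lp.coeFn_add g g₁] with t ht _
    rw [ht, Pi.add_apply]
  refine ⟨fun x y hx hy => ?_, fun x y hx hy => ?_, h.right.add h₁.right, h.left.add h₁.left⟩
  · rw [key, ← h.pos x y hx hy, ← h₁.pos x y hx hy]; ring
  · rw [key, ← h.neg x y hx hy, ← h₁.neg x y hx hy]; ring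

theorem const_smul {F : ℝ → ℂ} {g : L2} {c d : ℂ} (h : PiecewisePrimitive F g c d) (k : ℂ) :
    PiecewisePrimitive (fun x => k * F x) (k • g) (k * c) (k * d) := by
  have key : ∀ x y, ∫ t in x..y, (k • g) t = k * ∫ t in x..y, g t := by
    intro x y
    rw [← intervalIntegral.integral_const_mul]
    refine intervalIntegral.integral_congr_ae ?_
    filter_upwards [Lp.coeFn_smul k g] with t ht _
    rw [ht, Pi.smul_apply, smul_eq_mul]
  refine ⟨fun x y hx hy => ?_, fun x y hx hy => ?_, h.right.const_mul k, h.left.const_mul k⟩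
  · rw [key, ← h.pos x y hx hy]; ring
  · rw [key, ← h.neg x y hx hy]; ring

theorem comp_neg {F : ℝ → ℂ} {g : L2} {c d : ℂ} (h : PiecewisePrimitive F g c d) :
    PiecewisePrimitive (fun x => F (-x)) (-reflL2 g) d c := by
  have key : ∀ x y, ∫ t in x..y, (-reflL2 g) t = ∫ t in (-x)..(-y), g t := by
    intro x y
    have h1 : ∫ t in x..y, (-reflL2 g) t = ∫ t in x..y, -g (-t) := by
      refine intervalIntegral.integral_congr_ae ?_
      filter_upwards [Lp.coeFn_neg (reflL2 g), reflL2_ae g] with t ht ht' _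
      rw [ht, Pi.neg_apply, ht']
    rw [h1, intervalIntegral.integral_neg, intervalIntegral.integral_comp_neg (fun t => g t),
      ← intervalIntegral.integral_symm]
  have hr : Tendsto (fun x : ℝ => -x) (𝓝[>] 0) (𝓝[<] 0) := by
    have := tendsto_neg_nhdsGT (a := (0 : ℝ)); rwa [neg_zero] at this
  have hl : Tendsto (fun x : ℝ => -x) (𝓝[<] 0) (𝓝[>] 0) := by
    have := tendsto_neg_nhdsLT (a := (0 : ℝ)); rwa [neg_zero] at this
  refine ⟨fun x y hx hy => ?_, fun x y hx hy => ?_, h.left.comp hr, h.right.comp hl⟩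
  · rw [key, ← h.neg (-x) (-y) (by linarith) (by linarith)]
  · rw [key, ← h.pos (-x) (-y) (by linarith) (by linarith)]

theorem sgn {F : ℝ → ℂ} {g : L2} {c d : ℂ} (h : PiecewisePrimitive F g c d) :
    PiecewisePrimitive (fun x => sgnC x * F x) (sgnL2 g) c (-d) := by
  refine ⟨fun x y hx hy => ?_, fun x y hx hy => ?_, h.right.congr' ?_, h.left.neg.congr' ?_⟩
  · rw [sgnC_of_pos hx, sgnC_of_pos hy, one_mul, one_mul, h.pos x y hx hy]
    refine intervalIntegral.integral_congr_ae ?_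
    filter_upwards [sgnL2_ae g] with t ht htm
    have : 0 < t := (lt_min hx hy).trans htm.1
    rw [ht, sgnC_of_pos this, one_mul]
  · rw [sgnC_of_neg hx, sgnC_of_neg hy, ← mul_sub, h.neg x y hx hy,
      ← intervalIntegral.integral_const_mul]
    refine intervalIntegral.integral_congr_ae ?_
    filter_upwards [sgnL2_ae g] with t ht htm
    have : t < 0 := htm.2.trans_lt (max_lt hx hy)
    rw [ht, sgnC_of_neg this]
  · filter_upwards [self_mem_nhdsWithin] with x hx
    rw [sgnC_of_pos hx, one_mul]
  · filter_upwards [self_mem_nhdsWithin] with x hx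
    rw [sgnC_of_neg hx, neg_one_mul]

end PiecewisePrimitive

/-! ### Weak derivatives of functions on `ℝ` -/

theorem integrable_mul_of_hasCompactSupport {F φ : ℝ → ℂ}
    (hF : LocallyIntegrable F volume) (hφ : Continuous φ) (hc : HasCompactSupport φ) :
    Integrable fun x => F x * φ x := by
  have := hF.integrable_smul_left_of_hasCompactSupport hφ hc
  simpa [smul_eq_mul, mul_comm] using this

theorem HasWeakDerivOn.add {Ω : Set ℝ} {F G F₁ G₁ : ℝ → ℂ} (h : HasWeakDerivOn Ω F G)
    (h₁ : HasWeakDerivOn Ω F₁ G₁) (hF : LocallyIntegrable F volume)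
    (hG : LocallyIntegrable G volume) (hF₁ : LocallyIntegrable F₁ volume)
    (hG₁ : LocallyIntegrable G₁ volume) :
    HasWeakDerivOn Ω (fun x => F x + F₁ x) (fun x => G x + G₁ x) := by
  intro φ hφ hc hs
  have hd : Continuous (deriv φ) := (hφ.of_le (by exact_mod_cast le_top)).continuous_deriv le_rfl
  simp_rw [add_mul]
  rw [integral_add (integrable_mul_of_hasCompactSupport hF hd hc.deriv)
    (integrable_mul_of_hasCompactSupport hF₁ hd hc.deriv),
    integral_add (integrable_mul_of_hasCompactSupport hG hφ.continuous hc)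
    (integrable_mul_of_hasCompactSupport hG₁ hφ.continuous hc), h φ hφ hc hs, h₁ φ hφ hc hs]
  ring

theorem HasWeakDerivOn.const_mul {Ω : Set ℝ} {F G : ℝ → ℂ} (h : HasWeakDerivOn Ω F G) (c : ℂ) :
    HasWeakDerivOn Ω (fun x => c * F x) (fun x => c * G x) := by
  intro φ hφ hc hs
  simp_rw [mul_assoc]
  rw [integral_const_mul, integral_const_mul, h φ hφ hc hs, mul_neg]

theorem HasWeakDerivOn.congr_ae {Ω : Set ℝ} {F G F₁ G₁ : ℝ → ℂ} (h : HasWeakDerivOn Ω F G)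
    (hF : F =ᵐ[volume] F₁) (hG : G =ᵐ[volume] G₁) : HasWeakDerivOn Ω F₁ G₁ := by
  intro φ hφ hc hs
  have e1 : ∫ x, F₁ x * deriv φ x = ∫ x, F x * deriv φ x :=
    integral_congr_ae (by filter_upwards [hF] with x hx; rw [hx])
  have e2 : ∫ x, G₁ x * φ x = ∫ x, G x * φ x :=
    integral_congr_ae (by filter_upwards [hG] with x hx; rw [hx])
  rw [e1, e2, h φ hφ hc hs]

theorem HasWeakDerivOn.mono {Ω Ω₁ : Set ℝ} {F G : ℝ → ℂ} (h : HasWeakDerivOn Ω F G)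
    (hΩ : Ω₁ ⊆ Ω) : HasWeakDerivOn Ω₁ F G := fun φ hφ hc hs => h φ hφ hc (hs.trans hΩ)

theorem sgnC_eventuallyEq {x : ℝ} (hx : x ≠ 0) : sgnC =ᶠ[𝓝 x] fun _ => sgnC x := by
  rcases lt_or_gt_of_ne hx with h | h
  · filter_upwards [Iio_mem_nhds h] with y hy
    rw [sgnC_of_neg h, sgnC_of_neg hy]
  · filter_upwards [Ioi_mem_nhds h] with y hy
    rw [sgnC_of_pos h, sgnC_of_pos hy]

/-- A test function supported off the origin vanishes near it, so its product with the sign is again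
a test function, with derivative sgn · φ'. -/
theorem HasWeakDerivOn.sgn {F G : ℝ → ℂ} (h : HasWeakDerivOn {0}ᶜ F G) :
    HasWeakDerivOn {0}ᶜ (fun x => sgnC x * F x) (fun x => sgnC x * G x) := by
  intro φ hφ hc hs
  have hzero : φ =ᶠ[𝓝 0] 0 := notMem_tsupport_iff_eventuallyEq.1 fun h0 => hs h0 rfl
  have hprod : ∀ x, (fun y => sgnC y * φ y) =ᶠ[𝓝 x] fun y => sgnC x * φ y := by
    intro x
    rcases eq_or_ne x 0 with rfl | hx
    · filter_upwards [hzero] with y hy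
      simp [hy]
    · filter_upwards [sgnC_eventuallyEq hx] with y hy
      rw [hy]
  have h1 : ContDiff ℝ ∞ fun y => sgnC y * φ y := by
    rw [contDiff_iff_contDiffAt]
    intro x
    exact (contDiff_const.mul hφ).contDiffAt.congr_of_eventuallyEq (hprod x)
  have hd : ∀ x, deriv (fun y => sgnC y * φ y) x = sgnC x * deriv φ x := by
    intro x
    rw [(hprod x).deriv_eq, deriv_const_mul_field']
  have h2 : tsupport (fun y => sgnC y * φ y) ⊆ tsupport φ := closure_mono fun x hx => by
    intro h0
    apply hx
    simp [h0]
  have h3 := h _ h1 (hc.mul_left) (h2.trans hs)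
  simp_rw [hd] at h3
  convert! h3 using 1
  · exact integral_congr_ae (Eventually.of_forall fun x => by ring)
  · congr 1
    exact integral_congr_ae (Eventually.of_forall fun x => by ring)

/-! ### The domain of the delta Laplacian -/

namespace NegDeltaLaplacian

variable {γ : ℝ}

theorem add {f g f₁ g₁ : L2} (h : NegDeltaLaplacian γ f g) (h₁ : NegDeltaLaplacian γ f₁ g₁) :
    NegDeltaLaplacian γ (f + f₁) (g + g₁) := by
  obtain ⟨F, F', a, b, hF, hFc, hF', hw, hF'c, hw', ha, hb, hab⟩ := h
  obtain ⟨F₁, F₁', a₁, b₁, hF₁, hFc₁, hF₁', hw₁, hF₁'c, hw₁', ha₁, hb₁, hab₁⟩ := h₁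
  have hl : LocallyIntegrable F' volume := hF'.locallyIntegrable (by norm_num)
  have hl₁ : LocallyIntegrable F₁' volume := hF₁'.locallyIntegrable (by norm_num)
  refine ⟨fun x => F x + F₁ x, fun x => F' x + F₁' x, a + a₁, b + b₁, ?_, hFc.add hFc₁,
    hF'.add hF₁', hw.add hw₁ hFc.locallyIntegrable hl hFc₁.locallyIntegrable hl₁,
    hF'c.add hF₁'c, ?_, ha.add ha₁, hb.add hb₁, ?_⟩
  · filter_upwards [hF, hF₁, Lp.coeFn_add f f₁] with x h1 h2 h3
    rw [h1, h2, h3, Pi.add_apply]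
  · refine (hw'.add hw₁' hl (L2_locallyIntegrable g).neg hl₁
      (L2_locallyIntegrable g₁).neg).congr_ae (ae_eq_refl _) ?_
    filter_upwards [Lp.coeFn_add g g₁] with x h1
    rw [h1, Pi.add_apply]; ring
  · linear_combination hab + hab₁

theorem hasDerivL2 {f : L2} {F F' : ℝ → ℂ} (hF : F =ᵐ[volume] f) (hFc : Continuous F)
    (hF' : MemLp F' 2 volume) (hw : HasWeakDerivOn univ F F') : HasDerivL2 f (hF'.toLp F') := by
  refine HasDerivL2.of_ftc hF fun x y => ?_
  rw [hw.ftc isOpen_univ ordConnected_univ hFc.aestronglyMeasurable hFc.continuousOn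
    (hF'.locallyIntegrable (by norm_num)) trivial trivial]
  refine intervalIntegral.integral_congr_ae ?_
  filter_upwards [hF'.coeFn_toLp] with t ht _ using ht.symm

/-- The derivative F' is determined almost everywhere by f, and test functions off the origin then
determine g away from a null set. -/
theorem unique {f g g₁ : L2} (h : NegDeltaLaplacian γ f g) (h₁ : NegDeltaLaplacian γ f g₁) :
    g = g₁ := by
  obtain ⟨F, F', a, b, hF, hFc, hF', hw, hF'c, hw', ha, hb, hab⟩ := h
  obtain ⟨F₁, F₁', a₁, b₁, hF₁, hFc₁, hF₁', hw₁, hF₁'c, hw₁', ha₁, hb₁, hab₁⟩ := h₁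
  have h1 := (hasDerivL2 hF hFc hF' hw).unique (hasDerivL2 hF₁ hFc₁ hF₁' hw₁)
  have h2 : F' =ᵐ[volume] F₁' := by
    have h3 := hF'.coeFn_toLp
    rw [h1] at h3
    exact h3.symm.trans hF₁'.coeFn_toLp
  have h3 := hw'.congr_ae h2 (ae_eq_refl _)
  have h4 : ∀ᵐ x, x ∈ ({0}ᶜ : Set ℝ) → (g - g₁) x = 0 := by
    refine isOpen_compl_singleton.ae_eq_zero_of_integral_contDiff_smul_eq_zero
      ((L2_locallyIntegrable (g - g₁)).locallyIntegrableOn _) fun φ hφ hc hs => ?_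
    let ψ : ℝ → ℂ := fun x => (φ x : ℂ)
    have hψ : ContDiff ℝ ∞ ψ := Complex.ofRealCLM.contDiff.comp hφ
    have hψc : HasCompactSupport ψ := hc.comp_left Complex.ofReal_zero
    have hψs : tsupport ψ ⊆ {0}ᶜ := (closure_mono fun x (hx : ψ x ≠ 0) (h0 : φ x = 0) => hx (by simp [ψ, h0])).trans hs
    have h5 := (h3 ψ hψ hψc hψs).symm.trans (hw₁' ψ hψ hψc hψs)
    have e : ∫ x, φ x • (g - g₁) x = (∫ x, g x * ψ x) - ∫ x, g₁ x * ψ x := by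
      rw [← integral_sub (integrable_mul_of_hasCompactSupport (L2_locallyIntegrable g)
        hψ.continuous hψc) (integrable_mul_of_hasCompactSupport (L2_locallyIntegrable g₁)
        hψ.continuous hψc)]
      refine integral_congr_ae ?_
      filter_upwards [Lp.coeFn_sub g g₁] with x hx
      rw [hx, Pi.sub_apply, Complex.real_smul]
      simp only [ψ]
      ring
    simp only [neg_mul, integral_neg, neg_inj] at h5
    rw [e, h5, sub_self]
  rw [← sub_eq_zero]
  refine Lp.eq_zero_iff_ae_eq_zero.2 ?_
  filter_upwards [h4, ae_ne_zero] with x hx hx0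
  exact hx hx0

/-- Odd functions in `H²` are in the domain. -/
theorem of_odd {h h₁ h₂ : L2} (ho : reflL2 h = -h) (hd : HasDerivL2 h h₁) (hd₁ : HasDerivL2 h₁ h₂) :
    NegDeltaLaplacian γ h (-h₂) := by
  obtain ⟨F, hFc, hF, -⟩ := hd.exists_continuous
  obtain ⟨F₁, hFc₁, hF₁, -⟩ := hd₁.exists_continuous
  have h0 : F 0 = 0 := by
    have h0 := odd_of_ae ho hFc hF 0
    rw [neg_zero] at h0
    exact self_eq_neg.1 h0
  -- The derivative is continuous, so its jump is zero, and the jump condition holds because F 0 =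
  -- 0.
  refine ⟨F, F₁, F₁ 0, F₁ 0, hF, hFc, (Lp.memLp h₁).ae_eq hF₁.symm,
    (hd.hasWeakDerivOn hF).congr_ae (ae_eq_refl _) hF₁.symm, hFc₁.continuousOn, ?_,
    (hFc₁.tendsto 0).mono_left nhdsWithin_le_nhds, (hFc₁.tendsto 0).mono_left nhdsWithin_le_nhds,
    by simp [h0]⟩
  refine ((hd₁.hasWeakDerivOn hF₁).mono (subset_univ _)).congr_ae (ae_eq_refl _) ?_
  filter_upwards [Lp.coeFn_neg h₂] with x hx
  rw [hx, Pi.neg_apply, neg_neg]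

theorem continuousOn_sgnC : ContinuousOn sgnC {0}ᶜ := fun _ hx =>
  (continuousAt_const.congr (sgnC_eventuallyEq hx).symm).continuousWithinAt

theorem tendsto_sgnC_mul_right {F : ℝ → ℂ} (hF : Continuous F) :
    Tendsto (fun x => sgnC x * F x) (𝓝[>] 0) (𝓝 (F 0)) := by
  refine ((hF.tendsto 0).mono_left nhdsWithin_le_nhds).congr' ?_
  filter_upwards [self_mem_nhdsWithin] with x hx
  rw [sgnC_of_pos hx, one_mul]

theorem tendsto_sgnC_mul_left {F : ℝ → ℂ} (hF : Continuous F) :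
    Tendsto (fun x => sgnC x * F x) (𝓝[<] 0) (𝓝 (-F 0)) := by
  refine ((hF.tendsto 0).mono_left nhdsWithin_le_nhds).neg.congr' ?_
  filter_upwards [self_mem_nhdsWithin] with x hx
  rw [sgnC_of_neg hx, neg_one_mul]

/-- Solutions of `f' = -κ sgn(x) f` are bound states. -/
theorem of_bound {κ : ℝ} {f : L2} (hd : HasDerivL2 f (-(κ : ℂ) • sgnL2 f)) :
    NegDeltaLaplacian (2 * κ) f (-((κ : ℂ) ^ 2) • f) := by
  obtain ⟨F, hFc, hF, -⟩ := hd.exists_continuous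
  have e1 : (-(κ : ℂ) • sgnL2 f : L2) =ᵐ[volume] fun x => -(κ : ℂ) * (sgnC x * F x) := by
    filter_upwards [Lp.coeFn_smul (-(κ : ℂ)) (sgnL2 f), sgnL2_ae f, hF] with x h1 h2 h3
    rw [h1, Pi.smul_apply, h2, h3, smul_eq_mul]
  have hw := (hd.hasWeakDerivOn hF).congr_ae (ae_eq_refl _) e1
  -- The derivative -κ sgn F jumps by -2κ F(0), which is the condition for γ = 2κ. One more
  -- derivative off the origin gives κ² F, because sgn² = 1.
  refine ⟨F, fun x => -(κ : ℂ) * (sgnC x * F x), -κ * F 0, -κ * -F 0, hF, hFc,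
    (Lp.memLp _).ae_eq e1, hw, ?_, ?_, (tendsto_sgnC_mul_right hFc).const_mul _,
    (tendsto_sgnC_mul_left hFc).const_mul _, by push_cast; ring⟩
  · exact continuousOn_const.mul (continuousOn_sgnC.mul hFc.continuousOn)
  · refine ((hw.mono (subset_univ _)).sgn.const_mul (-(κ : ℂ))).congr_ae (ae_eq_refl _) ?_
    filter_upwards [Lp.coeFn_smul (-((κ : ℂ) ^ 2)) f, hF] with x h1 h2
    rw [h1, Pi.smul_apply, ← h2, smul_eq_mul]
    linear_combination (κ : ℂ) ^ 2 * F x * sgnC_mul_self x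

end NegDeltaLaplacian

/-! ### Weak derivatives under multipliers and parity, and the domain in the range of the transform.
-/

theorem HasDerivL2.multiplier {f g : L2} (h : HasDerivL2 f g) {m : ℝ → ℂ} (hm : IsBddSymbol m) :
    HasDerivL2 (fourierMul m f) (fourierMul m g) := by
  rw [HasDerivL2, fourier_fourierMul, fourier_fourierMul]
  filter_upwards [mulL2_ae hm (𝓕 f), mulL2_ae hm (𝓕 g), h] with ξ h1 h2 h3
  rw [h1, h2, h3]; ring

theorem HasDerivL2.neg {f g : L2} (h : HasDerivL2 f g) : HasDerivL2 (-f) (-g) := by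
  simpa using h.const_smul (-1)

theorem HasDerivL2.comp_neg {f g : L2} (h : HasDerivL2 f g) :
    HasDerivL2 (reflL2 f) (-reflL2 g) := by
  have hn : 𝓕 (-reflL2 g) = -𝓕 (reflL2 g) := (Lp.fourierTransformₗᵢ ℝ ℂ).map_neg _
  rw [HasDerivL2, hn, fourier_reflL2, fourier_reflL2]
  filter_upwards [Lp.coeFn_neg (reflL2 (𝓕 g)), reflL2_ae (𝓕 g), reflL2_ae (𝓕 f),
    ae_comp_neg h] with ξ h1 h2 h3 h4
  rw [h1, Pi.neg_apply, h2, h3, h4]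
  push_cast
  ring

theorem HasDerivL2.odd {f g : L2} (h : HasDerivL2 f g) : HasDerivL2 (oddL2 f) (evenL2 g) := by
  have := (h.add h.comp_neg.neg).const_smul (1 / 2)
  rw [oddL2_apply, evenL2_apply, sub_eq_add_neg]
  rwa [neg_neg] at this

theorem HasDerivL2.even {f g : L2} (h : HasDerivL2 f g) : HasDerivL2 (evenL2 f) (oddL2 g) := by
  have := (h.add h.comp_neg).const_smul (1 / 2)
  rwa [oddL2_apply, evenL2_apply, sub_eq_add_neg]

/-- The image of an odd function in `H²` under the generalized cosine transform. -/
theorem NegDeltaLaplacian.of_deltaB {κ : ℝ} (hκ : κ ≠ 0) {h h₁ h₂ : L2} (ho : reflL2 h = -h)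
    (hd : HasDerivL2 h h₁) (hd₁ : HasDerivL2 h₁ h₂) :
    NegDeltaLaplacian (2 * κ) (deltaB κ h) (-deltaB κ h₂) := by
  have hP : HasDerivL2 (rieszL2 κ h) (rieszL2 κ h₁) := hd.multiplier (isBddSymbol_rieszSymbol hκ)
  have hP₁ : HasDerivL2 (rieszL2 κ h₁) (rieszL2 κ h₂) := hd₁.multiplier (isBddSymbol_rieszSymbol hκ)
  have hQ : HasDerivL2 (besselL2 κ h) ((κ : ℂ) • rieszL2 κ h) := hasDerivL2_besselL2 hκ h
  have hQo : reflL2 (besselL2 κ h) = -besselL2 κ h := by rw [reflL2_besselL2 hκ, ho, map_neg]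
  -- Differentiation reverses parity, so the second derivative of an odd function is odd.
  have ho₂ : oddL2 h₂ = h₂ := by
    have h1 := hd.comp_neg
    rw [ho] at h1
    have h2 : reflL2 h₁ = h₁ := neg_injective (h1.unique hd.neg)
    have h3 := hd₁.comp_neg
    rw [h2] at h3
    exact oddL2_of_odd (neg_eq_iff_eq_neg.1 (hd₁.unique h3).symm)
  have hκ₁ : (κ : ℂ) • rieszL2 κ h₁ = besselL2 κ h₂ := hd₁.rieszL2_eq hκ
  obtain ⟨P, hPc, hPe, -⟩ := hP.exists_continuous
  obtain ⟨P₁, hPc₁, hPe₁, -⟩ := hP₁.exists_continuous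
  obtain ⟨Q, hQc, hQe, -⟩ := hQ.exists_continuous
  have hQ0 : Q 0 = 0 := by
    have h0 := odd_of_ae hQo hQc hQe 0
    rw [neg_zero] at h0
    exact self_eq_neg.1 h0
  have hf : deltaB κ h = -rieszL2 κ h + sgnL2 (besselL2 κ h) := by
    rw [deltaB_apply, oddL2_of_odd ho]
  have hd' : HasDerivL2 (deltaB κ h) (-rieszL2 κ h₁ + sgnL2 ((κ : ℂ) • rieszL2 κ h)) := by
    rw [hf]
    exact hP.neg.add (hQ.sgn_of_odd hQo)
  have eF : (fun x => -P x + sgnC x * Q x) =ᵐ[volume] deltaB κ h := by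
    rw [hf]
    filter_upwards [Lp.coeFn_add (-rieszL2 κ h) (sgnL2 (besselL2 κ h)),
      Lp.coeFn_neg (rieszL2 κ h), sgnL2_ae (besselL2 κ h), hPe, hQe] with x h1 h2 h3 h4 h5
    rw [h1, Pi.add_apply, h2, h3, Pi.neg_apply, h4, h5]
  have eF' : (-rieszL2 κ h₁ + sgnL2 ((κ : ℂ) • rieszL2 κ h) : L2) =ᵐ[volume]
      fun x => -1 * P₁ x + κ * (sgnC x * P x) := by
    filter_upwards [Lp.coeFn_add (-rieszL2 κ h₁) (sgnL2 ((κ : ℂ) • rieszL2 κ h)),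
      Lp.coeFn_neg (rieszL2 κ h₁), sgnL2_ae ((κ : ℂ) • rieszL2 κ h),
      Lp.coeFn_smul (κ : ℂ) (rieszL2 κ h), hPe, hPe₁] with x h1 h2 h3 h4 h5 h6
    rw [h1, Pi.add_apply, h2, h3, Pi.neg_apply, h4, Pi.smul_apply, h5, h6, smul_eq_mul]
    ring
  -- The derivative -P₁ + κ sgn P jumps by 2κ P(0). The function itself equals -P(0) at the origin
  -- because Q(0) = 0, so the jump condition holds with γ = 2κ.
  refine ⟨fun x => -P x + sgnC x * Q x, fun x => -1 * P₁ x + κ * (sgnC x * P x),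
    -1 * P₁ 0 + κ * P 0, -1 * P₁ 0 + κ * -P 0, eF, ?_, (Lp.memLp _).ae_eq eF',
    (hd'.hasWeakDerivOn eF).congr_ae (ae_eq_refl _) eF', ?_, ?_, ?_, ?_, ?_⟩
  · refine hPc.neg.add (continuous_iff_continuousAt.2 fun x => ?_)
    rcases eq_or_ne x 0 with rfl | hx
    · rw [continuousAt_iff_punctured_nhds, ← nhdsLT_sup_nhdsGT, tendsto_sup]
      have h1 := tendsto_sgnC_mul_left hQc
      have h2 := tendsto_sgnC_mul_right hQc
      simp only [hQ0, neg_zero, mul_zero] at h1 h2 ⊢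
      exact ⟨h1, h2⟩
    · exact (continuousOn_sgnC.continuousAt (isOpen_compl_singleton.mem_nhds hx)).mul
        hQc.continuousAt
  · exact (continuousOn_const.mul hPc₁.continuousOn).add
      (continuousOn_const.mul (continuousOn_sgnC.mul hPc.continuousOn))
  · have w1 := ((hP₁.hasWeakDerivOn hPe₁).mono (subset_univ {0}ᶜ)).const_mul (-1)
    have w2 := (((hP.hasWeakDerivOn hPe).mono (subset_univ {0}ᶜ)).sgn).const_mul (κ : ℂ)
    have l2 : LocallyIntegrable (fun x => (κ : ℂ) * (sgnC x * P x)) volume := by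
      have : LocallyIntegrable (sgnL2 ((κ : ℂ) • rieszL2 κ h)) volume := L2_locallyIntegrable _
      refine this.congr ?_
      filter_upwards [sgnL2_ae ((κ : ℂ) • rieszL2 κ h),
        Lp.coeFn_smul (κ : ℂ) (rieszL2 κ h), hPe] with x h3 h4 h5
      rw [h3, h4, Pi.smul_apply, h5, smul_eq_mul]; ring
    have l3 : LocallyIntegrable (fun x => (κ : ℂ) * (sgnC x * rieszL2 κ h₁ x)) volume := by
      have : LocallyIntegrable (sgnL2 ((κ : ℂ) • rieszL2 κ h₁)) volume := L2_locallyIntegrable _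
      refine this.congr ?_
      filter_upwards [sgnL2_ae ((κ : ℂ) • rieszL2 κ h₁),
        Lp.coeFn_smul (κ : ℂ) (rieszL2 κ h₁)] with x h3 h4
      rw [h3, h4, Pi.smul_apply, smul_eq_mul]; ring
    refine (w1.add w2 (hPc₁.const_mul _ |>.locallyIntegrable)
      ((L2_locallyIntegrable (rieszL2 κ h₂)).smul (-1 : ℂ)) l2 l3).congr_ae (ae_eq_refl _) ?_
    rw [deltaB_apply, ho₂, ← hκ₁]
    filter_upwards [Lp.coeFn_neg (-rieszL2 κ h₂ + sgnL2 ((κ : ℂ) • rieszL2 κ h₁)),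
      Lp.coeFn_add (-rieszL2 κ h₂) (sgnL2 ((κ : ℂ) • rieszL2 κ h₁)),
      Lp.coeFn_neg (rieszL2 κ h₂), sgnL2_ae ((κ : ℂ) • rieszL2 κ h₁),
      Lp.coeFn_smul (κ : ℂ) (rieszL2 κ h₁)] with x h1 h2 h3 h4 h5
    rw [h1, Pi.neg_apply, h2, Pi.add_apply, h3, h4, Pi.neg_apply, h5, Pi.smul_apply, smul_eq_mul]
    ring
  · exact (((hPc₁.tendsto 0).mono_left nhdsWithin_le_nhds).const_mul _).add
      ((tendsto_sgnC_mul_right hPc).const_mul _)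
  · exact (((hPc₁.tendsto 0).mono_left nhdsWithin_le_nhds).const_mul _).add
      ((tendsto_sgnC_mul_left hPc).const_mul _)
  · simp only [hQ0]; push_cast; ring

/-! ### The generator of the propagator -/

theorem CLM_hasDerivAt (T : L2 →L[ℂ] L2) {u : ℝ → L2} {g : L2} {t : ℝ} (h : HasDerivAt u g t) :
    HasDerivAt (fun t => T (u t)) (T g) t :=
  (T.restrictScalars ℝ).hasFDerivAt.comp_hasDerivAt t h

theorem fourier_smul_L2 (c : ℂ) (f : L2) : 𝓕 (c • f) = c • 𝓕 f :=
  (Lp.fourierTransformₗᵢ ℝ ℂ).map_smul _ _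

theorem fourier_neg_L2 (f : L2) : 𝓕 (-f) = -𝓕 f := (Lp.fourierTransformₗᵢ ℝ ℂ).map_neg _

theorem hasDerivAt_freeProp_iff (f g : L2) :
    HasDerivAt (fun t => freeProp t f) (-Complex.I • g) 0 ↔
      (𝓕 g : L2) =ᵐ[volume] fun ξ => ((2 * Real.pi * ξ) ^ 2 : ℝ) * (𝓕 f : L2) ξ := by
  simp only [freeProp]
  rw [hasDerivAt_fourierGroup_iff measurable_freeSymbol, fourier_smul_L2]
  have h := Lp.coeFn_smul (-Complex.I) (𝓕 g : L2)
  constructor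
  · intro h1
    filter_upwards [h, h1] with ξ h2 h3
    rw [h2, Pi.smul_apply, smul_eq_mul, freeSymbol] at h3
    have := congrArg (fun z => Complex.I * z) h3
    simp only [← mul_assoc, mul_neg, Complex.I_mul_I, neg_neg, one_mul] at this
    rw [this]; push_cast; ring
  · intro h1
    filter_upwards [h, h1] with ξ h2 h3
    rw [h2, Pi.smul_apply, smul_eq_mul, freeSymbol, h3]
    push_cast; ring

theorem hasDerivAt_freeProp {f f₁ f₂ : L2} (h : HasDerivL2 f f₁) (h₁ : HasDerivL2 f₁ f₂) :
    HasDerivAt (fun t => freeProp t f) (-Complex.I • -f₂) 0 := by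
  rw [hasDerivAt_freeProp_iff, fourier_neg_L2]
  filter_upwards [h, h₁, Lp.coeFn_neg (𝓕 f₂ : L2)] with ξ h1 h2 h3
  rw [h3, Pi.neg_apply, h2, h1]
  push_cast
  linear_combination -(2 * Real.pi * ξ) ^ 2 * (𝓕 f : L2) ξ * Complex.I_mul_I

/-- Differentiability of the orbit only says that ξ² 𝓕f is in L². The intermediate derivative is in
L² because r ≤ 1 + r², with r = (2πξ)². -/
theorem exists_derivatives_of_hasDerivAt_freeProp {f g : L2}
    (h : HasDerivAt (fun t => freeProp t f) (-Complex.I • g) 0) :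
    ∃ f₁, HasDerivL2 f f₁ ∧ HasDerivL2 f₁ (-g) := by
  rw [hasDerivAt_freeProp_iff] at h
  have hm : AEStronglyMeasurable (fun ξ : ℝ => 2 * Real.pi * ξ * Complex.I * (𝓕 f : L2) ξ)
      volume := by
    refine AEStronglyMeasurable.mul (Continuous.aestronglyMeasurable (by fun_prop))
      (Lp.aestronglyMeasurable _)
  have hL : MemLp (fun ξ : ℝ => 2 * Real.pi * ξ * Complex.I * (𝓕 f : L2) ξ) 2 volume := by
    rw [memLp_two_iff_integrable_sq_norm hm]
    refine ((L2_integrable_norm_sq (𝓕 f)).add (L2_integrable_norm_sq (𝓕 g))).mono'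
      (hm.norm.pow 2) ?_
    filter_upwards [h] with ξ hξ
    rw [Real.norm_of_nonneg (by positivity), Pi.add_apply, hξ]
    simp only [norm_mul, Complex.norm_I, Complex.norm_real, mul_pow, Complex.norm_ofNat,
      Real.norm_eq_abs, sq_abs]
    have : (2 ^ 2 * Real.pi ^ 2 * ξ ^ 2) ≤ 1 + (2 ^ 2 * Real.pi ^ 2 * ξ ^ 2) ^ 2 := by
      nlinarith [sq_nonneg (2 ^ 2 * Real.pi ^ 2 * ξ ^ 2 - 1)]
    calc _ = (2 ^ 2 * Real.pi ^ 2 * ξ ^ 2) * ‖(𝓕 f : L2) ξ‖ ^ 2 := by ring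
      _ ≤ (1 + (2 ^ 2 * Real.pi ^ 2 * ξ ^ 2) ^ 2) * ‖(𝓕 f : L2) ξ‖ ^ 2 := by gcongr
      _ = _ := by ring
  have e : 𝓕 (𝓕⁻ (hL.toLp _) : L2) = hL.toLp _ := fourier_fourierInv_eq _
  refine ⟨𝓕⁻ (hL.toLp _), ?_, ?_⟩
  · rw [HasDerivL2, e]
    exact hL.coeFn_toLp
  · rw [HasDerivL2, e, fourier_neg_L2]
    filter_upwards [hL.coeFn_toLp, h, Lp.coeFn_neg (𝓕 g : L2)] with ξ h1 h2 h3
    rw [h1, h3, Pi.neg_apply, h2]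
    push_cast
    linear_combination -(2 * Real.pi * ξ) ^ 2 * (𝓕 f : L2) ξ * Complex.I_mul_I

theorem hasDerivAt_boundPhase (κ : ℝ) : HasDerivAt (boundPhase κ) (κ ^ 2 * Complex.I) 0 := by
  have h : HasDerivAt (fun t : ℝ => ((t * κ ^ 2 : ℝ) : ℂ) * Complex.I) (κ ^ 2 * Complex.I) 0 := by
    have := ((hasDerivAt_id (0 : ℝ)).mul_const (κ ^ 2)).ofReal_comp.mul_const Complex.I
    simpa using this
  have e : boundPhase κ = fun t : ℝ => Complex.exp (((t * κ ^ 2 : ℝ) : ℂ) * Complex.I) := rfl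
  rw [e]
  simpa using h.cexp

section
variable {κ : ℝ}

/-- Functions in the range of the bound state projection solve `f' = -κ sgn(x) f`. -/
theorem hasDerivL2_boundProj (hκ : κ ≠ 0) (f : L2) :
    HasDerivL2 (boundProj κ f) (-(κ : ℂ) • sgnL2 (boundProj κ f)) := by
  -- For an even k, `deltaC κ k = 0` says on the Fourier side that the transform of k' + κ sgn k,
  -- divided by `deltaDen`, is zero.
  have h := deltaC_boundProj hκ f
  rw [deltaC_apply, evenL2_boundProj hκ] at h
  set k := boundProj κ f
  have h2 := congrArg (fun z : L2 => (𝓕 z : L2)) h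
  have hadd : 𝓕 (rieszL2 κ k + besselL2 κ (sgnL2 k)) =
      𝓕 (rieszL2 κ k) + 𝓕 (besselL2 κ (sgnL2 k)) := (Lp.fourierTransformₗᵢ ℝ ℂ).map_add _ _
  have h0 : 𝓕 (0 : L2) = 0 := (Lp.fourierTransformₗᵢ ℝ ℂ).map_zero
  simp only [hadd, h0] at h2
  rw [rieszL2, besselL2, fourier_fourierMul, fourier_fourierMul] at h2
  rw [HasDerivL2, fourier_smul_L2]
  have h3 : (mulL2 (rieszSymbol κ) (𝓕 k) + mulL2 (besselSymbol κ) (𝓕 (sgnL2 k)) : L2)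
      =ᵐ[volume] 0 := by rw [h2]; exact Lp.coeFn_zero _ _ _
  filter_upwards [h3, Lp.coeFn_add (mulL2 (rieszSymbol κ) (𝓕 k))
    (mulL2 (besselSymbol κ) (𝓕 (sgnL2 k))), mulL2_ae (isBddSymbol_rieszSymbol hκ) (𝓕 k),
    mulL2_ae (isBddSymbol_besselSymbol hκ) (𝓕 (sgnL2 k)),
    Lp.coeFn_smul (-(κ : ℂ)) (𝓕 (sgnL2 k))] with ξ h3 h4 h5 h6 h7
  rw [h4, Pi.add_apply, h5, h6, rieszSymbol, besselSymbol, Pi.zero_apply] at h3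
  rw [h7, Pi.smul_apply, smul_eq_mul]
  have hd : (deltaDen κ ξ : ℂ) ≠ 0 := Complex.ofReal_ne_zero.2 (deltaDen_pos hκ ξ).ne'
  push_cast at h3
  field_simp at h3
  linear_combination -h3

/-- Apply the three intertwining maps to the orbit. The odd part and the C-transform are
differentiable under the free flow, hence in H², and the bound component solves its first-order
equation. So each summand of f = odd f + BCf + Pf is in the domain, and the images sum to g by the
same decomposition of g. -/
theorem NegDeltaLaplacian.of_hasDerivAt (hκ : κ ≠ 0) {f g : L2}
    (h : HasDerivAt (fun t => deltaProp κ t f) (-Complex.I • g) 0) :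
    NegDeltaLaplacian (2 * κ) f g := by
  have ho := CLM_hasDerivAt oddL2 h
  have hC := CLM_hasDerivAt (deltaC κ) h
  have hP := CLM_hasDerivAt (boundProj κ) h
  simp only [oddL2_deltaProp hκ, deltaC_deltaProp hκ, boundProj_deltaProp hκ, map_smul]
    at ho hC hP
  obtain ⟨f₁, ho1, ho2⟩ := exists_derivatives_of_hasDerivAt_freeProp ho
  obtain ⟨k₁, hC1, hC2⟩ := exists_derivatives_of_hasDerivAt_freeProp hC
  have n1 := NegDeltaLaplacian.of_odd (γ := 2 * κ) (reflL2_oddL2 f) ho1 ho2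
  have n2 := NegDeltaLaplacian.of_deltaB hκ (reflL2_deltaC hκ f) hC1 hC2
  have n3 := NegDeltaLaplacian.of_bound (hasDerivL2_boundProj hκ f)
  have hP2 : boundProj κ g = -((κ : ℂ) ^ 2) • boundProj κ f := by
    have h4 := hP.unique ((hasDerivAt_boundPhase κ).smul_const (boundProj κ f))
    have h5 := congrArg (fun z : L2 => Complex.I • z) h4
    simp only [smul_smul, mul_neg, Complex.I_mul_I, neg_neg, one_smul] at h5
    rw [h5]
    congr 1
    linear_combination (κ : ℂ) ^ 2 * Complex.I_mul_I
  rw [← hP2] at n3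
  have n := (n1.add n2).add n3
  have hdec : ∀ u : L2, oddL2 u + deltaB κ (deltaC κ u) + boundProj κ u = u := fun u => by
    rw [boundProj_apply, add_add_sub_cancel, oddL2_add_evenL2]
  rw [neg_neg, map_neg, neg_neg, hdec, hdec] at n
  exact n

theorem hasDerivAt_deltaProp_of_parts {f g k : L2}
    (ho : HasDerivAt (fun t => freeProp t (oddL2 f)) (-Complex.I • g) 0)
    (hC : HasDerivAt (fun t => freeProp t (deltaC κ f)) (-Complex.I • k) 0) :
    HasDerivAt (fun t => deltaProp κ t f)
      (-Complex.I • (g + deltaB κ k - (κ : ℂ) ^ 2 • boundProj κ f)) 0 := by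
  have h := (ho.add (CLM_hasDerivAt (deltaB κ) hC)).add
    ((hasDerivAt_boundPhase κ).smul_const (boundProj κ f))
  convert! h using 1
  rw [map_smul]
  module

/-- The even part of F' has no jump, so the odd part of f is in H². For the even part of f, the jump
condition says precisely that F'_odd + κ sgn F_even has no jump, so this function is in H¹. The
Bessel multiplier maps it to κ Cf, which therefore is in H². Both free orbits are then
differentiable. -/
theorem hasDerivAt_deltaProp (hκ : κ ≠ 0) {f g : L2} (h : NegDeltaLaplacian (2 * κ) f g) :
    HasDerivAt (fun t => deltaProp κ t f) (-Complex.I • g) 0 := by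
  obtain ⟨F, F', a, b, hF, hFc, hF', hw, hF'c, hw', ha, hb, hab⟩ := id h
  set f₁ : L2 := hF'.toLp F' with hf₁
  have hFf₁ : F' =ᵐ[volume] f₁ := hF'.coeFn_toLp.symm
  have hd : HasDerivL2 f f₁ := NegDeltaLaplacian.hasDerivL2 hF hFc hF' hw
  have ftc := fun x y => hw.ftc isOpen_univ ordConnected_univ hFc.aestronglyMeasurable
    hFc.continuousOn (hF'.locallyIntegrable (by norm_num)) (x := x) (y := y) trivial trivial
  have hcongr : ∀ x y, ∫ t in x..y, F' t = ∫ t in x..y, f₁ t := fun x y => by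
    refine intervalIntegral.integral_congr_ae ?_
    filter_upwards [hFf₁] with t ht _ using ht
  have pF : PiecewisePrimitive F f₁ (F 0) (F 0) :=
    ⟨fun x y _ _ => by rw [ftc, hcongr], fun x y _ _ => by rw [ftc, hcongr],
      (hFc.tendsto 0).mono_left nhdsWithin_le_nhds, (hFc.tendsto 0).mono_left nhdsWithin_le_nhds⟩
  have hneg : ∀ x y, ∫ t in x..y, -g t = ∫ t in x..y, (-g) t := fun x y => by
    refine intervalIntegral.integral_congr_ae ?_
    filter_upwards [Lp.coeFn_neg g] with t ht _
    rw [ht, Pi.neg_apply]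
  have pF' : PiecewisePrimitive F' (-g) a b := by
    refine ⟨fun x y hx hy => ?_, fun x y hx hy => ?_, ha, hb⟩
    · rw [← hneg]
      exact (hw'.mono (Ω₁ := Ioi 0) fun x hx => ne_of_gt hx).ftc isOpen_Ioi ordConnected_Ioi
        hF'.1 (hF'c.mono fun x hx => ne_of_gt hx) (L2_locallyIntegrable g).neg hx hy
    · rw [← hneg]
      exact (hw'.mono (Ω₁ := Iio 0) fun x hx => ne_of_lt hx).ftc isOpen_Iio ordConnected_Iio
        hF'.1 (hF'c.mono fun x hx => ne_of_lt hx) (L2_locallyIntegrable g).neg hx hy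
  -- almost everywhere representatives of the even and odd parts
  have refl_ae : ∀ {u : L2} {K : ℝ → ℂ}, K =ᵐ[volume] u → (fun x => K (-x)) =ᵐ[volume] reflL2 u :=
    fun {u K} hK => by
      filter_upwards [reflL2_ae u, ae_comp_neg hK] with x h1 h2
      rw [h1, h2]
  have even_ae : ∀ {u : L2} {K : ℝ → ℂ}, K =ᵐ[volume] u →
      (fun x => (1 / 2 : ℂ) * (K x + K (-x))) =ᵐ[volume] evenL2 u := fun {u K} hK => by
    rw [evenL2_apply]
    filter_upwards [Lp.coeFn_smul (1 / 2 : ℂ) (u + reflL2 u), Lp.coeFn_add u (reflL2 u), hK,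
      refl_ae hK] with x h1 h2 h3 h4
    rw [h1, Pi.smul_apply, h2, Pi.add_apply, h3, h4, smul_eq_mul]
  have odd_ae : ∀ {u : L2} {K : ℝ → ℂ}, K =ᵐ[volume] u →
      (fun x => (1 / 2 : ℂ) * (K x + -1 * K (-x))) =ᵐ[volume] oddL2 u := fun {u K} hK => by
    rw [oddL2_apply]
    filter_upwards [Lp.coeFn_smul (1 / 2 : ℂ) (u - reflL2 u), Lp.coeFn_sub u (reflL2 u), hK,
      refl_ae hK] with x h1 h2 h3 h4
    rw [h1, Pi.smul_apply, h2, Pi.sub_apply, h3, h4, smul_eq_mul]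
    ring
  have sgn_ae : ∀ {u : L2} {K : ℝ → ℂ}, K =ᵐ[volume] u →
      (fun x => sgnC x * K x) =ᵐ[volume] sgnL2 u := fun {u K} hK => by
    filter_upwards [sgnL2_ae u, hK] with x h1 h2
    rw [h1, h2]
  -- the odd part
  have pE' := (pF'.add pF'.comp_neg).const_smul (1 / 2)
  have ho1 : HasDerivL2 (evenL2 f₁) (-oddL2 g) := by
    have h1 := pE'.hasDerivL2 (by ring) (even_ae hFf₁)
    have e : (1 / 2 : ℂ) • (-g + -reflL2 (-g)) = -oddL2 g := by
      rw [oddL2_apply, map_neg]; module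
    rwa [e] at h1
  have ho := hasDerivAt_freeProp hd.odd ho1
  rw [neg_neg] at ho
  -- the even part
  have pO' := (pF'.add (pF'.comp_neg.const_smul (-1))).const_smul (1 / 2)
  have eO : (1 / 2 : ℂ) • (-g + (-1 : ℂ) • -reflL2 (-g)) = -evenL2 g := by
    rw [evenL2_apply, map_neg]; module
  rw [eO] at pO'
  -- The odd part of F' has opposite limits at 0+ and 0-, so multiplication by the sign removes its
  -- jump.
  have hs : HasDerivL2 (sgnL2 (oddL2 f₁)) (-sgnL2 (evenL2 g)) := by
    have h1 := pO'.sgn.hasDerivL2 (by ring) (sgn_ae (odd_ae hFf₁))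
    rwa [map_neg] at h1
  have pE := (pF.add pF.comp_neg).const_smul (1 / 2)
  have eE : (1 / 2 : ℂ) • (f₁ + -reflL2 f₁) = oddL2 f₁ := by
    rw [oddL2_apply]; module
  rw [eE] at pE
  have hq : HasDerivL2 (oddL2 f₁ + (κ : ℂ) • sgnL2 (evenL2 f))
      (-evenL2 g + (κ : ℂ) • sgnL2 (oddL2 f₁)) := by
    refine (pO'.add (pE.sgn.const_smul κ)).hasDerivL2 ?_ ?_
    · push_cast at hab
      linear_combination hab
    · filter_upwards [odd_ae hFf₁, sgn_ae (even_ae hF), Lp.coeFn_add (oddL2 f₁)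
        ((κ : ℂ) • sgnL2 (evenL2 f)), Lp.coeFn_smul (κ : ℂ) (sgnL2 (evenL2 f))] with x h1 h2 h3 h4
      rw [h1, h2, h3, Pi.add_apply, h4, Pi.smul_apply, smul_eq_mul]
  have hκC : besselL2 κ (oddL2 f₁ + (κ : ℂ) • sgnL2 (evenL2 f)) = (κ : ℂ) • deltaC κ f := by
    rw [map_add, map_smul, ← hd.even.rieszL2_eq hκ, deltaC_apply, smul_add]
  have hq1 := hq.multiplier (isBddSymbol_besselSymbol hκ)
  have hq2 := hasDerivL2_besselL2 hκ (-evenL2 g + (κ : ℂ) • sgnL2 (oddL2 f₁))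
  have e2 : (κ : ℂ) • rieszL2 κ (-evenL2 g + (κ : ℂ) • sgnL2 (oddL2 f₁)) =
      (κ : ℂ) • -deltaC κ g := by
    congr 1
    rw [map_add, map_smul, hs.rieszL2_eq hκ, deltaC_apply, map_neg, map_neg]
    abel
  rw [e2] at hq2
  have hκ' : (κ : ℂ) ≠ 0 := Complex.ofReal_ne_zero.2 hκ
  have hq1' := hq1.const_smul (κ : ℂ)⁻¹
  have hq2' := hq2.const_smul (κ : ℂ)⁻¹
  rw [smul_smul, inv_mul_cancel₀ hκ', one_smul] at hq2'
  have e3 : (κ : ℂ)⁻¹ • fourierMul (besselSymbol κ) (oddL2 f₁ + (κ : ℂ) • sgnL2 (evenL2 f)) =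
      deltaC κ f := by
    change (κ : ℂ)⁻¹ • besselL2 κ _ = _
    rw [hκC, smul_smul, inv_mul_cancel₀ hκ', one_smul]
  rw [e3] at hq1'
  have hC := hasDerivAt_freeProp hq1' hq2'
  have hfin := hasDerivAt_deltaProp_of_parts ho hC
  -- The derivative has been computed with some value. The converse direction and uniqueness of -Δ_γ
  -- f identify that value with g.
  rwa [h.unique (NegDeltaLaplacian.of_hasDerivAt hκ hfin)]

theorem isDeltaPropagator_deltaUnitary {γ : ℝ} (hκ : γ / 2 ≠ 0) :
    IsDeltaPropagator γ (deltaUnitary hκ) where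
  zero f := deltaProp_zero f
  add t r f := (deltaProp_add hκ t r f).symm
  continuous f := continuous_deltaProp (γ / 2) f
  generator f g := by
    have e : 2 * (γ / 2) = γ := by ring
    have h1 := hasDerivAt_deltaProp (κ := γ / 2) hκ (f := f) (g := g)
    have h2 := NegDeltaLaplacian.of_hasDerivAt (κ := γ / 2) hκ (f := f) (g := g)
    rw [e] at h1 h2
    exact ⟨h1, h2⟩

end

/-! ### A unitary group is determined by its generator -/

/-- For k in the common domain, V(-r)U(r)k has zero derivative in r, so U and V agree on k. The
averages h⁻¹∫₀ʰ U(r)f dr lie in the domain and tend to f, which extends this to all f. -/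
theorem IsDeltaPropagator.eq {γ : ℝ} {U V : ℝ → (L2 ≃ₗᵢ[ℂ] L2)} (hU : IsDeltaPropagator γ U)
    (hV : IsDeltaPropagator γ V) (t : ℝ) (f : L2) : U t f = V t f := by
  have hdom : ∀ k g, HasDerivAt (fun t => U t k) (-Complex.I • g) 0 → ∀ t, U t k = V t k := by
    intro k g hk t
    have hVV : ∀ r (x : L2), V (-r) (V r x) = x := fun r x => by
      rw [← hV.add, neg_add_cancel, hV.zero]
    have hderiv : ∀ r, HasDerivAt (fun r => V (-r) (U r k)) 0 r := by
      intro r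
      have hUr : HasDerivAt (fun s => U s (U r k)) (-Complex.I • U r g) 0 := by
        have h1 := CLM_hasDerivAt ((U r).toContinuousLinearEquiv : L2 →L[ℂ] L2) hk
        have h2 : (fun s => U s (U r k)) = fun s => U r (U s k) := by
          ext1 s; rw [← hU.add, ← hU.add, add_comm]
        rw [h2]
        simpa using h1
      have hVr := (hV.generator _ _).1 ((hU.generator _ _).2 hUr)
      have hdiff := hUr.sub hVr
      rw [sub_self, hasDerivAt_iff_isLittleO_nhds_zero] at hdiff
      rw [hasDerivAt_iff_isLittleO_nhds_zero]
      refine Asymptotics.IsLittleO.congr_left (Asymptotics.IsLittleO.of_norm_left ?_) (fun s => rfl)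
      refine hdiff.norm_left.congr_left fun s => ?_
      simp only [zero_add, Pi.sub_apply, smul_zero, sub_zero, hU.zero, hV.zero, sub_self]
      -- The increment is an isometry applied to (U(s) - V(s))U(r)k, which is o(s) since both orbits
      -- of U(r)k have the same derivative at 0.
      have h3 : V (-(r + s)) (U (r + s) k) - V (-r) (U r k) =
          V (-(r + s)) (U s (U r k) - V s (U r k)) := by
        rw [map_sub, ← hU.add, add_comm s r]
        congr 1
        rw [← hV.add]
        congr 2
        ring
      rw [h3, LinearIsometryEquiv.norm_map]
    have hconst := is_const_of_deriv_eq_zero (fun r => (hderiv r).differentiableAt)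
      (fun r => (hderiv r).deriv) t 0
    simp only [neg_zero, hU.zero, hV.zero] at hconst
    calc U t k = V t (V (-t) (U t k)) := by rw [← hV.add, add_neg_cancel, hV.zero]
      _ = V t k := by rw [hconst]
  have hd : HasDerivAt (fun h => ∫ r in (0 : ℝ)..h, U r f) f 0 := by
    have := ((hU.continuous f).integral_hasStrictDerivAt 0 0).hasDerivAt
    rwa [hU.zero] at this
  have hav : ∀ h : ℝ, U t (∫ r in (0 : ℝ)..h, U r f) = V t (∫ r in (0 : ℝ)..h, U r f) := by
    intro h
    -- U(s) maps the average to the integral over [s, s + h], whose derivative at s = 0 is U(h)f - f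
    -- = -i · i(U(h)f - f).
    refine hdom _ (Complex.I • (U h f - f)) ?_ t
    have h1 : (fun s => U s (∫ r in (0 : ℝ)..h, U r f)) =
        fun s => (∫ r in (0 : ℝ)..(s + h), U r f) - ∫ r in (0 : ℝ)..s, U r f := by
      ext1 s
      have h2 := (((U s).toContinuousLinearEquiv : L2 →L[ℂ] L2).restrictScalars
        ℝ).intervalIntegral_comp_comm ((hU.continuous f).intervalIntegrable (μ := volume) 0 h)
      have h3 : U s (∫ r in (0 : ℝ)..h, U r f) = ∫ r in (0 : ℝ)..h, U s (U r f) := h2.symm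
      rw [h3]
      simp_rw [← hU.add]
      rw [intervalIntegral.integral_comp_add_left (fun r => U r f),
        intervalIntegral.integral_interval_sub_left
          ((hU.continuous f).intervalIntegrable _ _) ((hU.continuous f).intervalIntegrable _ _),
        add_zero]
    rw [h1]
    have h4 := ((hU.continuous f).integral_hasStrictDerivAt 0 (0 + h)).hasDerivAt.comp_add_const 0 h
    have h5 := ((hU.continuous f).integral_hasStrictDerivAt 0 0).hasDerivAt
    have h6 := h4.sub h5
    rw [zero_add, hU.zero] at h6
    convert! h6 using 1
    rw [smul_smul]; simp
  have hslope := hasDerivAt_iff_tendsto_slope.1 hd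
  have key : ∀ h, U t (slope (fun h => ∫ r in (0 : ℝ)..h, U r f) 0 h) =
      V t (slope (fun h => ∫ r in (0 : ℝ)..h, U r f) 0 h) := by
    intro h
    simp only [slope_def_module, intervalIntegral.integral_same, sub_zero]
    rw [RCLike.real_smul_eq_coe_smul (K := ℂ), map_smul, map_smul, hav]
  have l1 := ((U t).continuous.tendsto f).comp hslope
  have l2 := ((V t).continuous.tendsto f).comp hslope
  exact tendsto_nhds_unique l1 (l2.congr fun h => (key h).symm)

theorem isDeltaPropagator_deltaPropagator {γ : ℝ} (hγ : γ ≠ 0) :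
    IsDeltaPropagator γ (deltaPropagator γ) :=
  Classical.epsilon_spec_aux _ _ ⟨_, isDeltaPropagator_deltaUnitary (γ := γ) (by positivity)⟩

theorem deltaPropagator_apply {γ : ℝ} (hγ : γ ≠ 0) (t : ℝ) (f : L2) :
    deltaPropagator γ t f = deltaProp (γ / 2) t f :=
  (isDeltaPropagator_deltaPropagator hγ).eq
    (isDeltaPropagator_deltaUnitary (γ := γ) (by positivity)) t f

/-! ### The Fourier description of `H^s` -/

/-- The Bessel weight `(1 + ξ²)^{s/2}`. -/
def besselWeight (s ξ : ℝ) : ℝ := (1 + ξ ^ 2) ^ (s / 2)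

theorem besselWeight_pos (s ξ : ℝ) : 0 < besselWeight s ξ := by
  unfold besselWeight; positivity

theorem measurable_besselWeight (s : ℝ) : Measurable (besselWeight s) := by
  unfold besselWeight; fun_prop

theorem continuous_besselWeight (s : ℝ) : Continuous (besselWeight s) := by
  unfold besselWeight
  exact (by fun_prop : Continuous fun ξ : ℝ => 1 + ξ ^ 2).rpow_const
    fun ξ => Or.inl (by positivity)

theorem besselWeight_sq (s ξ : ℝ) : besselWeight s ξ ^ 2 = (1 + ξ ^ 2) ^ s := by
  rw [besselWeight, ← Real.rpow_natCast, ← Real.rpow_mul (by positivity)]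
  congr 1
  push_cast
  ring

theorem one_le_besselWeight {s : ℝ} (hs : 0 ≤ s) (ξ : ℝ) : 1 ≤ besselWeight s ξ :=
  Real.one_le_rpow (by nlinarith [sq_nonneg ξ]) (by positivity)

theorem hasTemperateGrowth_besselWeight (s : ℝ) :
    (fun ξ : ℝ => ((besselWeight s ξ : ℝ) : ℂ)).HasTemperateGrowth := by
  have h : (fun ξ : ℝ => ((besselWeight s ξ : ℝ) : ℂ)) =
      fun ξ : ℝ => (((1 + ‖ξ‖ ^ 2) ^ (s / 2) : ℝ) : ℂ) := by
    ext ξ; simp [besselWeight]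
  rw [h]
  fun_prop

theorem smulLeftCLM_besselWeight_eq_iff (s : ℝ) (f k : L2) :
    TemperedDistribution.smulLeftCLM ℂ (fun ξ : ℝ => (((1 + ‖ξ‖ ^ 2) ^ (s / 2) : ℝ) : ℂ))
      (f : 𝓢'(ℝ, ℂ)) = (k : 𝓢'(ℝ, ℂ)) ↔ k =ᵐ[volume] fun ξ => (besselWeight s ξ : ℂ) * f ξ := by
  have hw : (fun ξ : ℝ => (((1 + ‖ξ‖ ^ 2) ^ (s / 2) : ℝ) : ℂ)) =
      fun ξ : ℝ => ((besselWeight s ξ : ℝ) : ℂ) := by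
    ext ξ; simp [besselWeight]
  rw [hw]
  have key : ∀ ψ : 𝓢(ℝ, ℂ), TemperedDistribution.smulLeftCLM ℂ
      (fun ξ : ℝ => ((besselWeight s ξ : ℝ) : ℂ)) (f : 𝓢'(ℝ, ℂ)) ψ =
      ∫ ξ, ψ ξ • ((besselWeight s ξ : ℂ) * f ξ) := by
    intro ψ
    rw [TemperedDistribution.smulLeftCLM_apply_apply, Lp.toTemperedDistribution_apply]
    refine integral_congr_ae (Eventually.of_forall fun ξ => ?_)
    simp only
    rw [SchwartzMap.smulLeftCLM_apply_apply (hasTemperateGrowth_besselWeight s)]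
    simp only [smul_eq_mul]
    ring
  constructor
  · intro h
    have hl : LocallyIntegrable (fun ξ => (besselWeight s ξ : ℂ) * f ξ) volume :=
      (L2_locallyIntegrable f).continuous_smul
        (Complex.continuous_ofReal.comp (continuous_besselWeight s))
    refine ae_eq_of_integral_contDiff_smul_eq (L2_locallyIntegrable k) hl fun g hg hgc => ?_
    have hg1 : ContDiff ℝ ∞ (fun x => (g x : ℂ)) := Complex.ofRealCLM.contDiff.comp hg
    have hg2 : HasCompactSupport (fun x => (g x : ℂ)) := hgc.comp_left Complex.ofReal_zero
    let ψ : 𝓢(ℝ, ℂ) := hg2.toSchwartzMap hg1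
    have hψ : ∀ x, ψ x = g x := fun x => rfl
    have h2 := key ψ
    rw [h, Lp.toTemperedDistribution_apply] at h2
    simpa only [hψ, Complex.real_smul, smul_eq_mul] using h2
  · intro h
    ext ψ
    rw [key, Lp.toTemperedDistribution_apply]
    refine integral_congr_ae ?_
    filter_upwards [h] with ξ hξ
    rw [hξ]

/-- The Fourier transform is injective on tempered distributions and turns the Bessel potential into
multiplication by the weight. -/
theorem besselPotential_eq_iff (s : ℝ) (f k : L2) :
    TemperedDistribution.besselPotential ℝ ℂ s (f : 𝓢'(ℝ, ℂ)) = (k : 𝓢'(ℝ, ℂ)) ↔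
      (𝓕 k : L2) =ᵐ[volume] fun ξ => (besselWeight s ξ : ℂ) * (𝓕 f : L2) ξ := by
  rw [← smulLeftCLM_besselWeight_eq_iff, ← Lp.fourier_toTemperedDistribution_eq,
    ← Lp.fourier_toTemperedDistribution_eq,
    ← TemperedDistribution.fourier_besselPotential_eq_smulLeftCLM_fourier_apply]
  constructor
  · intro h; rw [h]
  · intro h
    have hi : Function.Injective (𝓕 : 𝓢'(ℝ, ℂ) → 𝓢'(ℝ, ℂ)) :=
      Function.LeftInverse.injective (g := (𝓕⁻ : 𝓢'(ℝ, ℂ) → 𝓢'(ℝ, ℂ))) fourierInv_fourier_eq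
    exact hi h

namespace Hs

variable {s : ℝ}

theorem fourier_bessel (f : Hs s) :
    (𝓕 f.bessel : L2) =ᵐ[volume] fun ξ => (besselWeight s ξ : ℂ) * (𝓕 f.toL2 : L2) ξ :=
  (besselPotential_eq_iff s _ _).1 f.bessel_spec

theorem norm_eq_bessel (f : Hs s) : ‖f‖ = ‖f.bessel‖ := rfl

theorem bessel_eq_of_fourier {f : Hs s} {k : L2}
    (h : (𝓕 k : L2) =ᵐ[volume] fun ξ => (besselWeight s ξ : ℂ) * (𝓕 f.toL2 : L2) ξ) :
    f.bessel = k :=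
  fourier_L2_injective (Lp.ext (f.fourier_bessel.trans h.symm))

theorem exists_of_fourier {f k : L2}
    (h : (𝓕 k : L2) =ᵐ[volume] fun ξ => (besselWeight s ξ : ℂ) * (𝓕 f : L2) ξ) :
    ∃ u : Hs s, u.toL2 = f ∧ u.bessel = k := by
  let u : Hs s := ⟨f, k, (besselPotential_eq_iff s f k).2 h⟩
  exact ⟨u, rfl, bessel_eq_of_fourier (f := u) h⟩

theorem exists_of_memLp {f : L2}
    (h : MemLp (fun ξ => (besselWeight s ξ : ℂ) * (𝓕 f : L2) ξ) 2 volume) :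
    ∃ u : Hs s, u.toL2 = f := by
  have e : 𝓕 (𝓕⁻ (h.toLp _) : L2) = h.toLp _ := fourier_fourierInv_eq _
  obtain ⟨u, hu, -⟩ := exists_of_fourier (s := s) (f := f) (k := 𝓕⁻ (h.toLp _))
    (by rw [e]; exact h.coeFn_toLp)
  exact ⟨u, hu⟩

theorem norm_sq_eq (f : Hs s) :
    ‖f‖ ^ 2 = ∫ ξ, besselWeight s ξ ^ 2 * ‖(𝓕 f.toL2 : L2) ξ‖ ^ 2 := by
  rw [norm_eq_bessel, ← Lp.norm_fourier_eq, L2_norm_sq_eq]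
  refine integral_congr_ae ?_
  filter_upwards [f.fourier_bessel] with ξ hξ
  rw [hξ, norm_mul, mul_pow, Complex.norm_real, Real.norm_eq_abs, sq_abs]

theorem integrable_weight_sq (f : Hs s) :
    Integrable fun ξ => besselWeight s ξ ^ 2 * ‖(𝓕 f.toL2 : L2) ξ‖ ^ 2 := by
  refine (L2_integrable_norm_sq (𝓕 f.bessel)).congr ?_
  filter_upwards [f.fourier_bessel] with ξ hξ
  rw [hξ, norm_mul, mul_pow, Complex.norm_real, Real.norm_eq_abs, sq_abs]

theorem isBddSymbol_inv_weight (hs : 0 ≤ s) :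
    IsBddSymbol (fun ξ => (((besselWeight s ξ)⁻¹ : ℝ) : ℂ)) := by
  refine ⟨Complex.measurable_ofReal.comp (measurable_besselWeight s).inv, 1, fun ξ => ?_⟩
  rw [Complex.norm_real, Real.norm_of_nonneg (inv_pos.2 (besselWeight_pos s ξ)).le]
  exact inv_le_one_of_one_le₀ (one_le_besselWeight hs ξ)

theorem bessel_surjective (hs : 0 ≤ s) : Function.Surjective (bessel : Hs s →ₗ[ℂ] L2) := by
  intro k
  obtain ⟨u, -, hu⟩ := exists_of_fourier (s := s)
    (f := fourierMul (fun ξ => (((besselWeight s ξ)⁻¹ : ℝ) : ℂ)) k) (k := k) (by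
      rw [fourier_fourierMul]
      filter_upwards [mulL2_ae (isBddSymbol_inv_weight hs) (𝓕 k)] with ξ hξ
      rw [hξ, ← mul_assoc, ← Complex.ofReal_mul, mul_inv_cancel₀ (besselWeight_pos s ξ).ne',
        Complex.ofReal_one, one_mul])
  exact ⟨u, hu⟩

/-- The Bessel potential as an isometric isomorphism. -/
def besselEquiv (hs : 0 ≤ s) : Hs s ≃ₗᵢ[ℂ] L2 where
  toLinearEquiv := LinearEquiv.ofBijective bessel ⟨bessel_injective, bessel_surjective hs⟩
  norm_map' _ := rfl

theorem completeSpace (hs : 0 ≤ s) : CompleteSpace (Hs s) :=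
  (completeSpace_congr (e := (besselEquiv hs).toEquiv)
    (besselEquiv hs).isometry.isUniformEmbedding).2 inferInstance

theorem norm_toL2_le (hs : 0 ≤ s) (f : Hs s) : ‖f.toL2‖ ≤ ‖f‖ := by
  rw [← Lp.norm_fourier_eq, norm_eq_bessel, ← Lp.norm_fourier_eq f.bessel]
  refine Lp.norm_le_norm_of_ae_le ?_
  filter_upwards [f.fourier_bessel] with ξ hξ
  rw [hξ, norm_mul, Complex.norm_real, Real.norm_of_nonneg (besselWeight_pos s ξ).le]
  exact le_mul_of_one_le_left (norm_nonneg _) (one_le_besselWeight hs ξ)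

/-- The inclusion of `H^s` into `L²` as a bounded operator. -/
def toL2L (hs : 0 ≤ s) : Hs s →L[ℂ] L2 :=
  toL2.mkContinuous 1 fun f => by simpa using norm_toL2_le hs f

theorem toL2L_apply (hs : 0 ≤ s) (f : Hs s) : toL2L hs f = f.toL2 := rfl

/-- `H¹` embeds into `H^s` for `0 ≤ s ≤ 1`. -/
theorem exists_of_hasDerivL2 (hs' : s ≤ 1) {f g : L2} (h : HasDerivL2 f g) :
    ∃ u : Hs s, u.toL2 = f ∧ ‖u‖ ≤ ‖f‖ + ‖g‖ := by
  have hpt : ∀ᵐ ξ, ‖(besselWeight s ξ : ℂ) * (𝓕 f : L2) ξ‖ ^ 2 ≤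
      ‖(𝓕 f : L2) ξ‖ ^ 2 + ‖(𝓕 g : L2) ξ‖ ^ 2 := by
    filter_upwards [h] with ξ hξ
    rw [hξ]
    simp only [norm_mul, Complex.norm_I, Complex.norm_real, mul_pow, Complex.norm_ofNat,
      Real.norm_eq_abs, sq_abs, besselWeight_sq]
    have h1 : (1 + ξ ^ 2) ^ s ≤ 1 + ξ ^ 2 := by
      conv_rhs => rw [← Real.rpow_one (1 + ξ ^ 2)]
      exact Real.rpow_le_rpow_of_exponent_le (by nlinarith [sq_nonneg ξ]) hs'
    have h2 : ξ ^ 2 ≤ 2 ^ 2 * Real.pi ^ 2 * ξ ^ 2 := by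
      have := Real.pi_gt_three
      nlinarith [sq_nonneg ξ, mul_nonneg (sq_nonneg ξ) (by nlinarith : 0 ≤ Real.pi ^ 2 - 9)]
    calc _ ≤ (1 + 2 ^ 2 * Real.pi ^ 2 * ξ ^ 2) * ‖(𝓕 f : L2) ξ‖ ^ 2 := by gcongr; linarith
      _ = _ := by ring
  have hm : AEStronglyMeasurable (fun ξ => (besselWeight s ξ : ℂ) * (𝓕 f : L2) ξ) volume :=
    (Complex.measurable_ofReal.comp (measurable_besselWeight s)).aestronglyMeasurable.mul
      (Lp.aestronglyMeasurable _)
  have hi := (L2_integrable_norm_sq (𝓕 f)).add (L2_integrable_norm_sq (𝓕 g))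
  obtain ⟨u, hu⟩ := exists_of_memLp (s := s) (f := f) (by
    rw [memLp_two_iff_integrable_sq_norm hm]
    refine hi.mono' (hm.norm.pow 2) ?_
    filter_upwards [hpt] with ξ hξ
    rwa [Real.norm_of_nonneg (by positivity)])
  refine ⟨u, hu, ?_⟩
  have h3 : ‖u‖ ^ 2 ≤ ‖f‖ ^ 2 + ‖g‖ ^ 2 := by
    rw [norm_sq_eq, ← Lp.norm_fourier_eq f, ← Lp.norm_fourier_eq g, L2_norm_sq_eq, L2_norm_sq_eq,
      ← integral_add (L2_integrable_norm_sq _) (L2_integrable_norm_sq _)]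
    refine integral_mono_ae u.integrable_weight_sq hi ?_
    filter_upwards [hpt] with ξ hξ
    rw [norm_mul, mul_pow, Complex.norm_real, Real.norm_eq_abs, sq_abs] at hξ
    rwa [hu]
  exact le_of_sq_le_sq (h3.trans (by nlinarith [norm_nonneg f, norm_nonneg g])) (by positivity)

end Hs

/-! ### Bounded operators on `H^s` -/

/-- The operator `T` on `L²` maps `H^s` to itself with norm at most `K`. -/
def BddOnHs (s : ℝ) (T : L2 →L[ℂ] L2) (K : ℝ) : Prop :=
  ∀ f : Hs s, ∃ u : Hs s, u.toL2 = T f.toL2 ∧ ‖u‖ ≤ K * ‖f‖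

namespace BddOnHs

variable {s : ℝ} {T T₁ : L2 →L[ℂ] L2} {K K₁ : ℝ}

theorem add (h : BddOnHs s T K) (h₁ : BddOnHs s T₁ K₁) : BddOnHs s (T + T₁) (K + K₁) := by
  intro f
  obtain ⟨u, hu, hu'⟩ := h f
  obtain ⟨v, hv, hv'⟩ := h₁ f
  exact ⟨u + v, by rw [map_add, hu, hv]; rfl, (norm_add_le _ _).trans (by linarith)⟩

theorem sub (h : BddOnHs s T K) (h₁ : BddOnHs s T₁ K₁) : BddOnHs s (T - T₁) (K + K₁) := by
  intro f
  obtain ⟨u, hu, hu'⟩ := h f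
  obtain ⟨v, hv, hv'⟩ := h₁ f
  exact ⟨u - v, by rw [map_sub, hu, hv]; rfl, (norm_sub_le _ _).trans (by linarith)⟩

theorem smul (h : BddOnHs s T K) {c : ℂ} (hc : ‖c‖ ≤ 1) : BddOnHs s (c • T) K := by
  intro f
  obtain ⟨u, hu, hu'⟩ := h f
  refine ⟨c • u, by rw [map_smul, hu]; rfl, ?_⟩
  rw [norm_smul]
  exact (mul_le_mul hc hu' (norm_nonneg _) zero_le_one).trans (by rw [one_mul])

theorem comp (h : BddOnHs s T K) (h₁ : BddOnHs s T₁ K₁) (hK : 0 ≤ K) :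
    BddOnHs s (T ∘L T₁) (K * K₁) := by
  intro f
  obtain ⟨v, hv, hv'⟩ := h₁ f
  obtain ⟨u, hu, hu'⟩ := h v
  refine ⟨u, by rw [hu, hv]; rfl, hu'.trans ?_⟩
  rw [mul_assoc]
  gcongr

theorem id : BddOnHs s (ContinuousLinearMap.id ℂ L2) 1 := fun f => ⟨f, rfl, by simp⟩

theorem fourierMul {m : ℝ → ℂ} (hm : IsBddSymbol m) (h1 : ∀ ξ, ‖m ξ‖ ≤ 1) :
    BddOnHs s (fourierMul m) 1 := by
  intro f
  obtain ⟨u, hu, hu'⟩ := Hs.exists_of_fourier (s := s) (f := _root_.fourierMul m f.toL2)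
    (k := _root_.fourierMul m f.bessel) (by
      rw [fourier_fourierMul, fourier_fourierMul]
      filter_upwards [mulL2_ae hm (𝓕 f.bessel), mulL2_ae hm (𝓕 f.toL2), f.fourier_bessel]
        with ξ h1 h2 h3
      rw [h1, h2, h3]; ring)
  refine ⟨u, hu, ?_⟩
  rw [Hs.norm_eq_bessel, hu', Hs.norm_eq_bessel]
  exact norm_fourierMul_le hm h1 _

theorem reflL2 : BddOnHs s reflL2 1 := by
  intro f
  obtain ⟨u, hu, hu'⟩ := Hs.exists_of_fourier (s := s) (f := _root_.reflL2 f.toL2)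
    (k := _root_.reflL2 f.bessel) (by
      rw [fourier_reflL2, fourier_reflL2]
      filter_upwards [reflL2_ae (𝓕 f.bessel), reflL2_ae (𝓕 f.toL2), ae_comp_neg f.fourier_bessel]
        with ξ h1 h2 h3
      rw [h1, h2, h3, besselWeight, besselWeight, neg_sq])
  refine ⟨u, hu, ?_⟩
  rw [Hs.norm_eq_bessel, hu', Hs.norm_eq_bessel, one_mul]
  exact (LinearIsometry.norm_map (Lp.compMeasurePreservingₗᵢ ℂ (fun x : ℝ => -x)
    (Measure.measurePreserving_neg volume)) f.bessel).le

theorem evenL2 : BddOnHs s evenL2 2 := by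
  have := (BddOnHs.id.add BddOnHs.reflL2 (s := s)).smul (c := 1 / 2) (by norm_num)
  rwa [one_add_one_eq_two] at this

theorem oddL2 : BddOnHs s oddL2 2 := by
  have := (BddOnHs.id.sub BddOnHs.reflL2 (s := s)).smul (c := 1 / 2) (by norm_num)
  rwa [one_add_one_eq_two] at this

theorem neg (h : BddOnHs s T K) : BddOnHs s (-T) K := by
  intro f
  obtain ⟨u, hu, hu'⟩ := h f
  exact ⟨-u, by rw [map_neg, hu]; rfl, by rwa [norm_neg]⟩

theorem freeProp (t : ℝ) : BddOnHs s (freeProp t) 1 :=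
  BddOnHs.fourierMul (isBddSymbol_groupSymbol measurable_freeSymbol t)
    fun _ => (norm_groupSymbol _ _ _).le

/-- An operator from L² to H¹ acts on H^s through H^s ⊂ L² → H¹ ⊂ H^s. -/
theorem of_smoothing (hs : 0 ≤ s) (hs' : s ≤ 1) {D : L2 →L[ℂ] L2}
    (h : ∀ f, HasDerivL2 (T f) (D f)) : BddOnHs s T (‖T‖ + ‖D‖) := by
  intro f
  obtain ⟨u, hu, hu'⟩ := Hs.exists_of_hasDerivL2 hs' (h f.toL2)
  refine ⟨u, hu, hu'.trans ?_⟩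
  rw [add_mul]
  have hf := Hs.norm_toL2_le hs f
  exact add_le_add ((T.le_opNorm _).trans (by gcongr)) ((D.le_opNorm _).trans (by gcongr))

/-- Multiplication by the sign does not preserve H^s for s > 1/2, but it is followed by the Bessel
multiplier, which maps L² into H¹. -/
theorem exists_deltaC (hs : 0 ≤ s) (hs' : s ≤ 1) {κ : ℝ} (hκ : κ ≠ 0) :
    ∃ K, 0 ≤ K ∧ BddOnHs s (deltaC κ) K := by
  have h1 : BddOnHs s (rieszL2 κ) 1 :=
    BddOnHs.fourierMul (isBddSymbol_rieszSymbol hκ) (norm_rieszSymbol_le hκ)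
  have h2 : BddOnHs s (besselL2 κ ∘L sgnL2) _ :=
    of_smoothing hs hs' (D := (κ : ℂ) • rieszL2 κ ∘L sgnL2)
      fun f => hasDerivL2_besselL2 hκ (sgnL2 f)
  exact ⟨_, by positivity, (h1.add h2).comp evenL2 (by positivity)⟩

/-- Here the sign comes last. It acts on an odd H¹ function, so the result stays in H¹. -/
theorem exists_deltaB (hs : 0 ≤ s) (hs' : s ≤ 1) {κ : ℝ} (hκ : κ ≠ 0) :
    ∃ K, 0 ≤ K ∧ BddOnHs s (deltaB κ) K := by
  have h1 : BddOnHs s (rieszL2 κ) 1 :=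
    BddOnHs.fourierMul (isBddSymbol_rieszSymbol hκ) (norm_rieszSymbol_le hκ)
  have h2 : BddOnHs s (sgnL2 ∘L besselL2 κ ∘L _root_.oddL2) _ :=
    of_smoothing hs hs' (D := sgnL2 ∘L ((κ : ℂ) • rieszL2 κ) ∘L _root_.oddL2) fun f =>
      (hasDerivL2_besselL2 hκ (_root_.oddL2 f)).sgn_of_odd
        (by
          change _root_.reflL2 (besselL2 κ (_root_.oddL2 f)) = -besselL2 κ (_root_.oddL2 f)
          rw [reflL2_besselL2 hκ, reflL2_oddL2, map_neg])
  refine ⟨_, ?_, (h1.neg.comp oddL2 (by positivity)).add h2⟩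
  positivity

/-- A bounded operator on `H^s` obtained from an operator on `L²`. -/
def toCLM (h : BddOnHs s T K) : Hs s →L[ℂ] Hs s :=
  LinearMap.mkContinuous
    { toFun := fun f => (h f).choose
      map_add' := fun f g => Hs.toL2_injective (by
        rw [(h (f + g)).choose_spec.1, map_add, map_add, map_add, (h f).choose_spec.1,
          (h g).choose_spec.1])
      map_smul' := fun c f => Hs.toL2_injective (by
        rw [(h (c • f)).choose_spec.1, map_smul, map_smul, RingHom.id_apply, map_smul,
          (h f).choose_spec.1]) } K fun f => (h f).choose_spec.2

theorem toL2_toCLM (h : BddOnHs s T K) (f : Hs s) : (h.toCLM f).toL2 = T f.toL2 :=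
  (h f).choose_spec.1

theorem norm_toCLM_le (h : BddOnHs s T K) (f : Hs s) : ‖h.toCLM f‖ ≤ K * ‖f‖ :=
  (h f).choose_spec.2

end BddOnHs

/-! ### The propagator on H^s. -/

theorem bessel_freeProp {s : ℝ} (t : ℝ) (f : Hs s) :
    ((BddOnHs.freeProp (s := s) t).toCLM f).bessel = freeProp t f.bessel := by
  apply Hs.bessel_eq_of_fourier
  rw [BddOnHs.toL2_toCLM, freeProp, fourierGroup, fourier_fourierMul, fourier_fourierMul]
  have hm := isBddSymbol_groupSymbol measurable_freeSymbol t
  filter_upwards [mulL2_ae hm (𝓕 f.bessel), mulL2_ae hm (𝓕 f.toL2), f.fourier_bessel]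
    with ξ h1 h2 h3
  rw [h1, h2, h3]; ring

theorem continuous_freeProp_Hs {s : ℝ} (f : Hs s) :
    Continuous fun t => (BddOnHs.freeProp (s := s) t).toCLM f := by
  have hi : IsInducing (Hs.bessel : Hs s → L2) :=
    (AddMonoidHomClass.isometry_of_norm (Hs.bessel : Hs s →ₗ[ℂ] L2)
      fun _ => rfl).isUniformInducing.isInducing
  rw [hi.continuous_iff]
  have : (Hs.bessel ∘ fun t => (BddOnHs.freeProp (s := s) t).toCLM f) =
      fun t => freeProp t f.bessel := by
    ext1 t; exact bessel_freeProp t f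
  rw [this]
  exact continuous_fourierGroup measurable_freeSymbol _

/-- The propagator acts on `H^s` for `0 ≤ s ≤ 1`, with uniform bounds. -/
theorem exists_propagator_Hs {γ s : ℝ} (hγ : γ ≠ 0) (hs : 0 ≤ s) (hs' : s ≤ 1) :
    ∃ (W : ℝ → (Hs s →L[ℂ] Hs s)) (K : ℝ), 1 ≤ K ∧
      (∀ t f, (W t f).toL2 = deltaPropagator γ t f.toL2) ∧ (∀ t f, ‖W t f‖ ≤ K * ‖f‖) ∧
      ∀ f, Continuous fun t => W t f := by
  have hκ : γ / 2 ≠ 0 := by positivity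
  obtain ⟨KC, hKC, hC⟩ := BddOnHs.exists_deltaC hs hs' hκ
  obtain ⟨KB, hKB, hB⟩ := BddOnHs.exists_deltaB hs hs' hκ
  have hO := BddOnHs.oddL2 (s := s)
  have hP : BddOnHs s (boundProj (γ / 2)) _ := BddOnHs.evenL2.sub (hB.comp hC hKB)
  have hF := BddOnHs.freeProp (s := s)
  let W : ℝ → (Hs s →L[ℂ] Hs s) := fun t =>
    (hF t).toCLM ∘L hO.toCLM + hB.toCLM ∘L (hF t).toCLM ∘L hC.toCLM +
      boundPhase (γ / 2) t • hP.toCLM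
  have hW : ∀ t f, W t f = (hF t).toCLM (hO.toCLM f) + hB.toCLM ((hF t).toCLM (hC.toCLM f)) +
      boundPhase (γ / 2) t • hP.toCLM f := fun t f => rfl
  -- The contributions are 2 from the odd part, KB·KC from the conjugated free flow, and 2 + KB·KC
  -- from the bound state projection E - BC.
  refine ⟨W, 2 + KB * KC + (2 + KB * KC), by nlinarith [mul_nonneg hKB hKC], fun t f => ?_,
    fun t f => ?_, fun f => ?_⟩
  · rw [deltaPropagator_apply hγ, hW, deltaProp_apply, map_add, map_add, map_smul]
    simp only [BddOnHs.toL2_toCLM]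
  · rw [hW]
    have n1 : ‖(hF t).toCLM (hO.toCLM f)‖ ≤ 2 * ‖f‖ :=
      ((hF t).norm_toCLM_le _).trans (by rw [one_mul]; exact hO.norm_toCLM_le f)
    have n2 : ‖hB.toCLM ((hF t).toCLM (hC.toCLM f))‖ ≤ KB * (KC * ‖f‖) := by
      refine (hB.norm_toCLM_le _).trans ?_
      gcongr
      refine ((hF t).norm_toCLM_le _).trans ?_
      rw [one_mul]
      exact hC.norm_toCLM_le f
    have n3 : ‖boundPhase (γ / 2) t • hP.toCLM f‖ ≤ (2 + KB * KC) * ‖f‖ := by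
      rw [norm_smul, boundPhase, Complex.norm_exp_ofReal_mul_I, one_mul]
      exact hP.norm_toCLM_le f
    refine (norm_add₃_le).trans ?_
    linarith
  · simp only [hW]
    exact ((continuous_freeProp_Hs _).add (hB.toCLM.continuous.comp (continuous_freeProp_Hs _))).add
      ((continuous_boundPhase _).smul continuous_const)

/-! ### Sobolev embedding into `L^∞` -/

theorem integrable_inv_weight_sq {s : ℝ} (hs : 1 / 2 < s) :
    Integrable fun ξ : ℝ => (besselWeight s ξ)⁻¹ ^ 2 := by
  have h := integrable_rpow_neg_one_add_norm_sq (E := ℝ) (μ := volume) (r := 2 * s)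
    (by simp; linarith)
  refine h.congr (Eventually.of_forall fun ξ => ?_)
  simp only
  rw [inv_pow, besselWeight_sq, Real.norm_eq_abs, sq_abs, ← Real.rpow_neg (by positivity)]
  congr 1
  ring

/-- The constant in the interpolated Sobolev inequality. -/
def sobolevConst (s l : ℝ) : ℝ := √(∫ ξ, (√(l ^ 2 + besselWeight s ξ ^ 2))⁻¹ ^ 2)

theorem inv_sqrt_sq (s l ξ : ℝ) : (√(l ^ 2 + besselWeight s ξ ^ 2))⁻¹ ^ 2 =
    (l ^ 2 + besselWeight s ξ ^ 2)⁻¹ := by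
  rw [inv_pow, Real.sq_sqrt (by positivity)]

/-- The integrand tends to 0 and is dominated by (1 + ξ²)^{-s}. Hence on bounded sets of H^s,
closeness in L² implies closeness in L^∞. -/
theorem tendsto_sobolevConst {s : ℝ} (hs : 1 / 2 < s) :
    Tendsto (fun n : ℕ => sobolevConst s n) atTop (𝓝 0) := by
  have h : Tendsto (fun n : ℕ => ∫ ξ, (√((n : ℝ) ^ 2 + besselWeight s ξ ^ 2))⁻¹ ^ 2) atTop
      (𝓝 (∫ _ : ℝ, (0 : ℝ))) := by
    refine tendsto_integral_of_dominated_convergence (fun ξ => (besselWeight s ξ)⁻¹ ^ 2) ?_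
      (integrable_inv_weight_sq hs) ?_ ?_
    · intro n
      have := measurable_besselWeight s
      exact Measurable.aestronglyMeasurable (by fun_prop)
    · intro n
      refine Eventually.of_forall fun ξ => ?_
      have := besselWeight_pos s ξ
      rw [inv_sqrt_sq, Real.norm_of_nonneg (by positivity), inv_pow]
      gcongr
      exact le_add_of_nonneg_left (by positivity)
    · refine Eventually.of_forall fun ξ => ?_
      simp_rw [inv_sqrt_sq]
      refine Tendsto.inv_tendsto_atTop ?_
      exact tendsto_atTop_add_const_right _ _
        ((tendsto_pow_atTop two_ne_zero).comp tendsto_natCast_atTop_atTop)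
  rw [integral_zero] at h
  have h2 := (Real.continuous_sqrt.tendsto 0).comp h
  rwa [Real.sqrt_zero] at h2

/-- The L¹ norm of 𝓕 f is bounded by Cauchy–Schwarz with the weight (l² + (1 + ξ²)^s)^{1/2}. A large
l shrinks the coefficient of the H^s norm at the expense of that of the L² norm; l = 0 is the
Sobolev embedding. -/
theorem Hs.ae_norm_le {s : ℝ} (hs : 1 / 2 < s) (l : ℝ) (f : Hs s) :
    ∀ᵐ x, ‖f.toL2 x‖ ≤ sobolevConst s l * (|l| * ‖f.toL2‖ + ‖f‖) := by
  have hk0 : ∀ ξ, 0 < √(l ^ 2 + besselWeight s ξ ^ 2) := fun ξ => by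
    have := besselWeight_pos s ξ
    positivity
  have e : ∀ ξ, √(l ^ 2 + besselWeight s ξ ^ 2) ^ 2 * ‖(𝓕 f.toL2 : L2) ξ‖ ^ 2 =
      l ^ 2 * ‖(𝓕 f.toL2 : L2) ξ‖ ^ 2 + besselWeight s ξ ^ 2 * ‖(𝓕 f.toL2 : L2) ξ‖ ^ 2 :=
    fun ξ => by rw [Real.sq_sqrt (by positivity), add_mul]
  have hm := measurable_besselWeight s
  obtain ⟨h1, h2⟩ := integrable_of_weight (h := (𝓕 f.toL2 : L2)) (Lp.aestronglyMeasurable _)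
    (k := fun ξ => √(l ^ 2 + besselWeight s ξ ^ 2)) (by fun_prop) hk0
    (by
      refine (integrable_inv_weight_sq hs).mono' (Measurable.aestronglyMeasurable (by fun_prop)) ?_
      refine Eventually.of_forall fun ξ => ?_
      have := besselWeight_pos s ξ
      rw [inv_sqrt_sq, Real.norm_of_nonneg (by positivity), inv_pow]
      gcongr
      exact le_add_of_nonneg_left (by positivity))
    (by
      simp_rw [e]
      exact ((L2_integrable_norm_sq _).const_mul _).add f.integrable_weight_sq)
  have h3 : √(∫ ξ, √(l ^ 2 + besselWeight s ξ ^ 2) ^ 2 * ‖(𝓕 f.toL2 : L2) ξ‖ ^ 2) ≤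
      |l| * ‖f.toL2‖ + ‖f‖ := by
    simp_rw [e]
    rw [integral_add ((L2_integrable_norm_sq _).const_mul _) f.integrable_weight_sq,
      integral_const_mul, ← f.norm_sq_eq, ← L2_norm_sq_eq, Lp.norm_fourier_eq, ← sq_abs l]
    apply Real.sqrt_le_iff.2
    constructor
    · positivity
    · nlinarith [mul_nonneg (mul_nonneg (abs_nonneg l) (norm_nonneg f.toL2)) (norm_nonneg f)]
  filter_upwards [ae_norm_le_integral_fourier h1] with x hx
  refine hx.trans (h2.trans ?_)
  exact mul_le_mul_of_nonneg_left h3 (Real.sqrt_nonneg _)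

/-! ### The Gagliardo seminorm -/

/-- The integrand `h^{-1-2s} (2 sin (π h ξ))²`. -/
def gagKernel (s h ξ : ℝ) : ℝ := h ^ (-1 - 2 * s) * (2 * Real.sin (Real.pi * h * ξ)) ^ 2

theorem measurable_gagKernel (s : ℝ) : Measurable fun q : ℝ × ℝ => gagKernel s q.1 q.2 := by
  unfold gagKernel; fun_prop

/-- The constant relating the Gagliardo seminorm to the Fourier transform. -/
def gagConst (s : ℝ) : ENNReal := ∫⁻ h in Ioi 0, ENNReal.ofReal (gagKernel s h 1)

/-- Near 0, sin² ≤ (πh)² leaves h^{1-2s}, integrable since s < 1. At infinity sin² ≤ 1 leaves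
h^{-1-2s}, integrable since s > 0. -/
theorem gagConst_lt_top {s : ℝ} (hs : 0 < s) (hs' : s < 1) : gagConst s < ⊤ := by
  have h1 : IntegrableOn (fun h : ℝ => 4 * Real.pi ^ 2 * h ^ (1 - 2 * s)) (Ioc 0 1) := by
    refine Integrable.const_mul ?_ _
    have := intervalIntegral.intervalIntegrable_rpow' (a := 0) (b := 1) (r := 1 - 2 * s)
      (by linarith)
    rwa [intervalIntegrable_iff_integrableOn_Ioc_of_le zero_le_one] at this
  have h2 : IntegrableOn (fun h : ℝ => 4 * h ^ (-1 - 2 * s)) (Ioi 1) :=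
    (integrableOn_Ioi_rpow_of_lt (by linarith) one_pos).const_mul _
  rw [gagConst, ← Ioc_union_Ioi_eq_Ioi zero_le_one, lintegral_union measurableSet_Ioi
    (Ioc_disjoint_Ioi le_rfl)]
  refine ENNReal.add_lt_top.2 ⟨?_, ?_⟩
  · refine lt_of_le_of_lt (setLIntegral_mono_ae' measurableSet_Ioc (Eventually.of_forall ?_))
      h1.lintegral_lt_top
    intro h hh
    refine ENNReal.ofReal_le_ofReal ?_
    have e : h ^ (1 - 2 * s) = h ^ (-1 - 2 * s) * h ^ 2 := by
      rw [← Real.rpow_natCast h 2, ← Real.rpow_add hh.1]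
      congr 1; push_cast; ring
    have h3 : (Real.sin (Real.pi * h * 1)) ^ 2 ≤ (Real.pi * h) ^ 2 := by
      rw [mul_one]
      exact sq_le_sq.2 Real.abs_sin_le_abs
    rw [gagKernel, e]
    have := Real.rpow_nonneg hh.1.le (-1 - 2 * s)
    nlinarith
  · refine lt_of_le_of_lt (setLIntegral_mono_ae' measurableSet_Ioi (Eventually.of_forall ?_))
      h2.lintegral_lt_top
    intro h hh
    refine ENNReal.ofReal_le_ofReal ?_
    have h3 : (Real.sin (Real.pi * h * 1)) ^ 2 ≤ 1 := Real.sin_sq_le_one _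
    rw [gagKernel]
    have := Real.rpow_nonneg (zero_le_one.trans (le_of_lt hh)) (-1 - 2 * s)
    nlinarith

theorem gagConst_ne_zero (s : ℝ) : gagConst s ≠ 0 := by
  have hm : Measurable fun h => ENNReal.ofReal (gagKernel s h 1) :=
    ((measurable_gagKernel s).comp (measurable_id.prodMk measurable_const)).ennreal_ofReal
  refine (lt_of_lt_of_le ?_ (lintegral_mono_set
    (show Ioo (0 : ℝ) 1 ⊆ Ioi 0 from fun _ h => h.1))).ne'
  rw [setLIntegral_pos_iff hm, inter_eq_right.2]
  · simp
  · intro h hh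
    have h1 : 0 < Real.sin (Real.pi * h * 1) :=
      Real.sin_pos_of_pos_of_lt_pi (by have := hh.1; have := Real.pi_pos; positivity)
        (by nlinarith [hh.2, Real.pi_pos])
    have h2 : 0 < gagKernel s h 1 := by
      have := Real.rpow_pos_of_pos hh.1 (-1 - 2 * s)
      unfold gagKernel; positivity
    simpa using h2

/-- Scaling h by |ξ| reduces the integral to frequency 1. -/
theorem lintegral_gagKernel {s : ℝ} (hs : 0 < s) (ξ : ℝ) :
    ∫⁻ h in Ioi 0, ENNReal.ofReal (gagKernel s h ξ) =
      ENNReal.ofReal (|ξ| ^ (2 * s)) * gagConst s := by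
  rcases eq_or_ne ξ 0 with rfl | hξ
  · simp [gagKernel, Real.zero_rpow (by linarith : 2 * s ≠ 0)]
  have ha : 0 < |ξ| := abs_pos.2 hξ
  have himg : (fun h => |ξ| * h) '' Ioi 0 = Ioi 0 := by
    rw [image_mul_left_Ioi ha, mul_zero]
  have key : gagConst s = ∫⁻ h in Ioi 0, ENNReal.ofReal (|ξ| ^ (-(2 * s))) *
      ENNReal.ofReal (gagKernel s h ξ) := by
    rw [gagConst]
    conv_lhs => rw [← himg]
    rw [lintegral_image_eq_lintegral_abs_deriv_mul measurableSet_Ioi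
      (f' := fun _ => |ξ|) (fun x _ => by
        simpa using ((hasDerivAt_id x).const_mul |ξ|).hasDerivWithinAt)
      (mul_right_injective₀ ha.ne').injOn]
    refine setLIntegral_congr_fun measurableSet_Ioi fun h hh => ?_
    rw [← ENNReal.ofReal_mul (by positivity), ← ENNReal.ofReal_mul (by positivity)]
    congr 1
    have e1 : (2 * Real.sin (Real.pi * (|ξ| * h) * 1)) ^ 2 =
        (2 * Real.sin (Real.pi * h * ξ)) ^ 2 := by
      rcases abs_cases ξ with ⟨e, -⟩ | ⟨e, -⟩
      · rw [e]; ring_nf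
      · rw [e, show Real.pi * (-ξ * h) * 1 = -(Real.pi * h * ξ) by ring, Real.sin_neg]; ring
    have e2 : |ξ| * |ξ| ^ (-1 - 2 * s) = |ξ| ^ (-(2 * s)) := by
      conv_lhs => rw [← Real.rpow_one |ξ|, ← Real.rpow_mul (by positivity), one_mul,
        ← Real.rpow_add ha]
      congr 1; ring
    rw [gagKernel, gagKernel, e1, Real.mul_rpow ha.le (le_of_lt hh), abs_abs, ← e2]
    ring
  rw [key, lintegral_const_mul' _ _ ENNReal.ofReal_ne_top, ← mul_assoc,
    ← ENNReal.ofReal_mul (by positivity), ← Real.rpow_add ha, add_neg_cancel, Real.rpow_zero,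
    ENNReal.ofReal_one, one_mul]

theorem norm_expSymbol_sub_one_sq (h ξ : ℝ) :
    ‖expSymbol h ξ - 1‖ ^ 2 = (2 * Real.sin (Real.pi * h * ξ)) ^ 2 := by
  have e : expSymbol h ξ = Complex.exp (Complex.I * ((2 * Real.pi * h * ξ : ℝ) : ℂ)) := by
    rw [expSymbol]; congr 1; push_cast; ring
  rw [e, Complex.norm_exp_I_mul_ofReal_sub_one, Real.norm_eq_abs, sq_abs]
  congr 4
  ring

/-- The square of the `L²` norm as a lower Lebesgue integral. -/
theorem L2_ofReal_norm_sq (f : L2) :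
    ENNReal.ofReal (‖f‖ ^ 2) = ∫⁻ x, ENNReal.ofReal (‖f x‖ ^ 2) := by
  rw [L2_norm_sq_eq, ofReal_integral_eq_lintegral_ofReal (L2_integrable_norm_sq f)
    (Eventually.of_forall fun x => by positivity)]

theorem norm_transL2_sub_sq (h : ℝ) (f : L2) : ENNReal.ofReal (‖transL2 h f - f‖ ^ 2) =
    ∫⁻ ξ, ENNReal.ofReal ((2 * Real.sin (Real.pi * h * ξ)) ^ 2) *
      ENNReal.ofReal (‖(𝓕 f : L2) ξ‖ ^ 2) := by
  have hF : 𝓕 (transL2 h f - f) = mulL2 (expSymbol h) (𝓕 f) - 𝓕 f := by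
    rw [← fourier_transL2, sub_eq_add_neg, FourierTransform.fourier_add, fourier_neg_L2,
      ← sub_eq_add_neg]
  rw [← Lp.norm_fourier_eq, L2_ofReal_norm_sq, hF]
  refine lintegral_congr_ae ?_
  filter_upwards [Lp.coeFn_sub (mulL2 (expSymbol h) (𝓕 f)) (𝓕 f),
    mulL2_ae (isBddSymbol_expSymbol h) (𝓕 f)] with ξ h1 h2
  rw [h1, Pi.sub_apply, h2, ← sub_one_mul, norm_mul, mul_pow, norm_expSymbol_sub_one_sq,
    ENNReal.ofReal_mul (by positivity)]

/-- The square of the Gagliardo seminorm of order `s`. -/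
def gagliardo (s : ℝ) (f : L2) : ENNReal :=
  ∫⁻ h in Ioi (0 : ℝ), ENNReal.ofReal (h ^ (-1 - 2 * s)) * ENNReal.ofReal (‖transL2 h f - f‖ ^ 2)

/-- The square of the homogeneous Sobolev seminorm of order `s`. -/
def homSobolev (s : ℝ) (f : L2) : ENNReal :=
  ∫⁻ ξ, ENNReal.ofReal (|ξ| ^ (2 * s)) * ENNReal.ofReal (‖(𝓕 f : L2) ξ‖ ^ 2)

/-- By Plancherel, the squared increment is the integral of (2 sin πhξ)² |𝓕f|². Tonelli then allows
integration in h first. -/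
theorem gagliardo_eq {s : ℝ} (hs : 0 < s) (hs' : s < 1) (f : L2) :
    gagliardo s f = gagConst s * homSobolev s f := by
  have hf : AEMeasurable (fun ξ => ENNReal.ofReal (‖(𝓕 f : L2) ξ‖ ^ 2)) volume :=
    ((Lp.aestronglyMeasurable (𝓕 f : L2)).norm.aemeasurable.pow_const 2).ennreal_ofReal
  have e1 : gagliardo s f = ∫⁻ h in Ioi (0 : ℝ), ∫⁻ ξ, ENNReal.ofReal (gagKernel s h ξ) *
      ENNReal.ofReal (‖(𝓕 f : L2) ξ‖ ^ 2) := by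
    refine setLIntegral_congr_fun measurableSet_Ioi fun h hh => ?_
    have hn := Real.rpow_nonneg (le_of_lt hh) (-1 - 2 * s)
    rw [norm_transL2_sub_sq, ← lintegral_const_mul' _ _ ENNReal.ofReal_ne_top]
    refine lintegral_congr fun ξ => ?_
    rw [gagKernel, ENNReal.ofReal_mul hn, ← mul_assoc]
  have hm : AEMeasurable (Function.uncurry fun h ξ => ENNReal.ofReal (gagKernel s h ξ) *
      ENNReal.ofReal (‖(𝓕 f : L2) ξ‖ ^ 2)) ((volume.restrict (Ioi 0)).prod volume) :=
    (measurable_gagKernel s).ennreal_ofReal.aemeasurable.mul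
      (hf.comp_quasiMeasurePreserving Measure.quasiMeasurePreserving_snd)
  rw [e1, lintegral_lintegral_swap hm, homSobolev,
    ← lintegral_const_mul' _ _ (gagConst_lt_top hs hs').ne]
  refine lintegral_congr fun ξ => ?_
  rw [lintegral_mul_const' _ _ ENNReal.ofReal_ne_top, lintegral_gagKernel hs]
  ring

theorem gagliardo_mono {s : ℝ} {u f g : L2} {A B : ℝ} (hA : 0 ≤ A) (hB : 0 ≤ B)
    (h : ∀ t, ‖transL2 t u - u‖ ^ 2 ≤ A * ‖transL2 t f - f‖ ^ 2 + B * ‖transL2 t g - g‖ ^ 2) :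
    gagliardo s u ≤ ENNReal.ofReal A * gagliardo s f + ENNReal.ofReal B * gagliardo s g := by
  have hm : ∀ k : L2, Measurable fun t => ENNReal.ofReal (t ^ (-1 - 2 * s)) *
      ENNReal.ofReal (‖transL2 t k - k‖ ^ 2) := fun k =>
    (by fun_prop : Measurable fun t : ℝ => t ^ (-1 - 2 * s)).ennreal_ofReal.mul
      ((((continuous_transL2 k).sub continuous_const).norm.pow 2).measurable).ennreal_ofReal
  rw [gagliardo, gagliardo, gagliardo, ← lintegral_const_mul _ (hm f),
    ← lintegral_const_mul _ (hm g), ← lintegral_add_left ((hm f).const_mul _)]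
  refine lintegral_mono fun t => ?_
  rw [mul_left_comm, mul_left_comm (ENNReal.ofReal B), ← mul_add, ← ENNReal.ofReal_mul hA,
    ← ENNReal.ofReal_mul hB, ← ENNReal.ofReal_add (by positivity) (by positivity)]
  gcongr
  exact h t

/-- The square of the norm of `H^s`, for any element of `L²`. -/
def sobolevSq (s : ℝ) (f : L2) : ENNReal :=
  ∫⁻ ξ, ENNReal.ofReal (besselWeight s ξ ^ 2 * ‖(𝓕 f : L2) ξ‖ ^ 2)

theorem Hs.ofReal_norm_sq {s : ℝ} (f : Hs s) : ENNReal.ofReal (‖f‖ ^ 2) = sobolevSq s f.toL2 := by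
  rw [f.norm_sq_eq, sobolevSq, ofReal_integral_eq_lintegral_ofReal f.integrable_weight_sq
    (Eventually.of_forall fun x => by positivity)]

theorem ae_fourier_sq_measurable (f : L2) :
    AEMeasurable (fun ξ => ENNReal.ofReal (‖(𝓕 f : L2) ξ‖ ^ 2)) volume :=
  ((Lp.aestronglyMeasurable (𝓕 f : L2)).norm.aemeasurable.pow_const 2).ennreal_ofReal

theorem norm_sq_add_homSobolev (s : ℝ) (f : L2) : ENNReal.ofReal (‖f‖ ^ 2) + homSobolev s f =
    ∫⁻ ξ, ENNReal.ofReal ((1 + |ξ| ^ (2 * s)) * ‖(𝓕 f : L2) ξ‖ ^ 2) := by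
  rw [← Lp.norm_fourier_eq, L2_ofReal_norm_sq, homSobolev,
    ← lintegral_add_left' (ae_fourier_sq_measurable f)]
  refine lintegral_congr fun ξ => ?_
  rw [← ENNReal.ofReal_mul (by positivity), ← ENNReal.ofReal_add (by positivity) (by positivity)]
  ring_nf

theorem sobolevSq_le {s : ℝ} (hs : 0 ≤ s) (hs' : s ≤ 1) (f : L2) :
    sobolevSq s f ≤ ENNReal.ofReal (‖f‖ ^ 2) + homSobolev s f := by
  rw [norm_sq_add_homSobolev]
  refine lintegral_mono fun ξ => ENNReal.ofReal_le_ofReal ?_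
  gcongr
  rw [besselWeight_sq, Real.rpow_mul (abs_nonneg ξ), Real.rpow_two, sq_abs]
  have := Real.rpow_add_le_add_rpow (p := s) (zero_le_one' ℝ) (sq_nonneg ξ) hs hs'
  rwa [Real.one_rpow] at this

theorem le_sobolevSq {s : ℝ} (hs : 0 ≤ s) (f : L2) :
    ENNReal.ofReal (‖f‖ ^ 2) + homSobolev s f ≤ 2 * sobolevSq s f := by
  rw [norm_sq_add_homSobolev, sobolevSq, ← lintegral_const_mul' _ _ (by simp)]
  refine lintegral_mono fun ξ => ?_
  have e : (2 : ENNReal) * ENNReal.ofReal (besselWeight s ξ ^ 2 * ‖(𝓕 f : L2) ξ‖ ^ 2) =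
      ENNReal.ofReal (2 * besselWeight s ξ ^ 2 * ‖(𝓕 f : L2) ξ‖ ^ 2) := by
    rw [mul_assoc, ENNReal.ofReal_mul (p := 2) (by norm_num), ENNReal.ofReal_ofNat]
  rw [e]
  refine ENNReal.ofReal_le_ofReal ?_
  gcongr
  rw [besselWeight_sq, Real.rpow_mul (abs_nonneg ξ), Real.rpow_two, sq_abs]
  have h1 : 1 ≤ (1 + ξ ^ 2) ^ s := Real.one_le_rpow (by nlinarith [sq_nonneg ξ]) hs
  have h2 : (ξ ^ 2) ^ s ≤ (1 + ξ ^ 2) ^ s :=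
    Real.rpow_le_rpow (sq_nonneg ξ) (by linarith) hs
  linarith

theorem Hs.exists_of_sobolevSq_lt_top {s : ℝ} {f : L2} (h : sobolevSq s f < ⊤) :
    ∃ u : Hs s, u.toL2 = f := by
  have hm : AEStronglyMeasurable (fun ξ => (besselWeight s ξ : ℂ) * (𝓕 f : L2) ξ) volume :=
    (Complex.measurable_ofReal.comp (measurable_besselWeight s)).aestronglyMeasurable.mul
      (Lp.aestronglyMeasurable _)
  refine Hs.exists_of_memLp ((memLp_two_iff_integrable_sq_norm hm).2 ⟨(hm.norm.pow 2), ?_⟩)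
  rw [hasFiniteIntegral_iff_ofReal (Eventually.of_forall fun x => by positivity)]
  refine lt_of_le_of_lt (lintegral_mono fun ξ => ?_) h
  simp only
  rw [norm_mul, mul_pow, Complex.norm_real, Real.norm_eq_abs, sq_abs]

/-- An element of `L²` whose translation increments are controlled by those of elements of `H^s`
belongs to `H^s`. -/
theorem Hs.exists_of_increments {s : ℝ} (hs : 0 < s) (hs' : s < 1) {u : L2} {f g : Hs s} {A B : ℝ}
    (hA : 0 ≤ A) (hB : 0 ≤ B)
    (h : ∀ t, ‖transL2 t u - u‖ ^ 2 ≤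
      A * ‖transL2 t f.toL2 - f.toL2‖ ^ 2 + B * ‖transL2 t g.toL2 - g.toL2‖ ^ 2)
    (h0 : ‖u‖ ^ 2 ≤ A * ‖f.toL2‖ ^ 2 + B * ‖g.toL2‖ ^ 2) :
    ∃ u' : Hs s, u'.toL2 = u ∧ ‖u'‖ ^ 2 ≤ 2 * (A * ‖f‖ ^ 2 + B * ‖g‖ ^ 2) := by
  have h1 := gagliardo_mono (s := s) hA hB h
  simp only [gagliardo_eq hs hs'] at h1
  have h2 : homSobolev s u ≤
      ENNReal.ofReal A * homSobolev s f.toL2 + ENNReal.ofReal B * homSobolev s g.toL2 := by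
    -- The constant relating the two seminorms is neither 0 nor infinite, so it cancels.
    rw [← ENNReal.mul_le_mul_iff_right (gagConst_ne_zero s) (gagConst_lt_top hs hs').ne]
    refine h1.trans_eq ?_
    ring
  have h3 : ENNReal.ofReal (‖u‖ ^ 2) ≤
      ENNReal.ofReal A * ENNReal.ofReal (‖f.toL2‖ ^ 2) +
      ENNReal.ofReal B * ENNReal.ofReal (‖g.toL2‖ ^ 2) := by
    rw [← ENNReal.ofReal_mul hA, ← ENNReal.ofReal_mul hB,
      ← ENNReal.ofReal_add (by positivity) (by positivity)]
    exact ENNReal.ofReal_le_ofReal h0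
  have h4 : sobolevSq s u ≤ ENNReal.ofReal (2 * (A * ‖f‖ ^ 2 + B * ‖g‖ ^ 2)) := by
    calc sobolevSq s u ≤ _ := sobolevSq_le hs.le hs'.le u
      _ ≤ _ := add_le_add h3 h2
      _ = ENNReal.ofReal A * (ENNReal.ofReal (‖f.toL2‖ ^ 2) + homSobolev s f.toL2) +
          ENNReal.ofReal B * (ENNReal.ofReal (‖g.toL2‖ ^ 2) + homSobolev s g.toL2) := by ring
      _ ≤ ENNReal.ofReal A * (2 * sobolevSq s f.toL2) +
          ENNReal.ofReal B * (2 * sobolevSq s g.toL2) := by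
        gcongr <;> exact le_sobolevSq hs.le _
      _ = _ := by
        rw [← f.ofReal_norm_sq, ← g.ofReal_norm_sq, ENNReal.ofReal_mul (by norm_num),
          ENNReal.ofReal_add (by positivity) (by positivity), ENNReal.ofReal_mul hA,
          ENNReal.ofReal_mul hB, ENNReal.ofReal_ofNat]
        ring
  obtain ⟨u', hu'⟩ := Hs.exists_of_sobolevSq_lt_top (h4.trans_lt ENNReal.ofReal_lt_top)
  refine ⟨u', hu', ?_⟩
  rw [← hu', ← u'.ofReal_norm_sq] at h4
  exact (ENNReal.ofReal_le_ofReal_iff (by positivity)).1 h4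

/-! ### The power nonlinearity and its truncation -/

/-- The function `z ↦ |z|^{p-1} z` on `ℂ`. -/
def powerC (p : ℝ) (z : ℂ) : ℂ := ((‖z‖ ^ (p - 1) : ℝ) : ℂ) * z

theorem powerC_zero (p : ℝ) : powerC p 0 = 0 := by simp [powerC]

theorem norm_powerC (p : ℝ) (z : ℂ) : ‖powerC p z‖ = ‖z‖ ^ (p - 1) * ‖z‖ := by
  rw [powerC, norm_mul, Complex.norm_real, Real.norm_of_nonneg (by positivity)]

theorem powerC_eq_smul (p : ℝ) : powerC p = (fun z : ℂ => ‖z‖ ^ (p - 1)) • (fun z : ℂ => z) := by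
  ext1 z; simp [powerC]

theorem tendsto_norm_rpow_zero {p : ℝ} (hp : 1 < p) :
    Tendsto (fun z : ℂ => ‖z‖ ^ (p - 1)) (𝓝 0) (𝓝 0) := by
  have h : Continuous fun z : ℂ => ‖z‖ ^ (p - 1) :=
    continuous_norm.rpow_const fun _ => Or.inr (by linarith)
  have := h.tendsto 0
  rwa [norm_zero, Real.zero_rpow (by linarith)] at this

theorem hasFDerivAt_powerC_zero {p : ℝ} (hp : 1 < p) :
    HasFDerivAt (powerC p) (0 : ℂ →L[ℝ] ℂ) 0 := by
  rw [hasFDerivAt_iff_isLittleO_nhds_zero]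
  simp only [zero_add, powerC_zero, sub_zero, zero_apply]
  refine Asymptotics.isLittleO_iff.2 fun c hc => ?_
  filter_upwards [(tendsto_norm_rpow_zero hp).eventually (gt_mem_nhds hc)] with z hz
  rw [norm_powerC]
  gcongr

theorem contDiffAt_powerC (p : ℝ) {z : ℂ} (hz : z ≠ 0) : ContDiffAt ℝ 1 (powerC p) z := by
  rw [powerC_eq_smul]
  exact ((contDiffAt_norm ℝ hz).rpow_const_of_ne (norm_ne_zero_iff.2 hz)).smul contDiffAt_id

theorem norm_fderiv_powerC_le {p : ℝ} (hp : 1 < p) {z : ℂ} (hz : z ≠ 0) :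
    ‖fderiv ℝ (powerC p) z‖ ≤ p * ‖z‖ ^ (p - 1) := by
  have hz' : 0 < ‖z‖ := norm_pos_iff.2 hz
  have h1 : HasFDerivAt (fun z : ℂ => ‖z‖) (fderiv ℝ (fun z : ℂ => ‖z‖) z) z :=
    ((contDiffAt_norm ℝ (n := 1) hz).differentiableAt (by norm_num)).hasFDerivAt
  have h2 := (h1.rpow_const (p := p - 1) (Or.inl hz'.ne')).smul
    (f := fun z : ℂ => z) (hasFDerivAt_id (𝕜 := ℝ) z)
  have h3 : ‖fderiv ℝ (fun z : ℂ => ‖z‖) z‖ ≤ 1 := by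
    simpa using norm_fderiv_le_of_lipschitz ℝ (x₀ := z) (lipschitzWith_one_norm (E := ℂ))
  rw [← powerC_eq_smul] at h2
  rw [h2.fderiv]
  refine (norm_add_le _ _).trans ?_
  have e2 : ‖z‖ ^ (p - 1 - 1) * ‖z‖ = ‖z‖ ^ (p - 1) := by
    rw [← Real.rpow_add_one hz'.ne']; congr 1; ring
  have n1 : ‖‖z‖ ^ (p - 1) • ContinuousLinearMap.id ℝ ℂ‖ ≤ ‖z‖ ^ (p - 1) := by
    rw [norm_smul, Real.norm_of_nonneg (by positivity)]
    exact mul_le_of_le_one_right (by positivity) ContinuousLinearMap.norm_id_le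
  have n2 : ‖(((p - 1) * ‖z‖ ^ (p - 1 - 1)) • fderiv ℝ (fun z : ℂ => ‖z‖) z).smulRight z‖ ≤
      (p - 1) * ‖z‖ ^ (p - 1) := by
    rw [ContinuousLinearMap.norm_smulRight_apply, norm_smul,
      Real.norm_of_nonneg (mul_nonneg (by linarith) (by positivity)), ← e2]
    have : 0 ≤ (p - 1) * ‖z‖ ^ (p - 1 - 1) := mul_nonneg (by linarith) (by positivity)
    calc _ ≤ (p - 1) * ‖z‖ ^ (p - 1 - 1) * 1 * ‖z‖ := by gcongr
      _ = _ := by ring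
  calc _ ≤ ‖z‖ ^ (p - 1) + (p - 1) * ‖z‖ ^ (p - 1) := add_le_add n1 n2
    _ = _ := by ring

/-- The bound p|z|^{p-1} on the derivative tends to 0 at the origin since p > 1. For p < 2 the
derivative is not Lipschitz there, so only its uniform continuity on compact sets is used later. -/
theorem contDiff_powerC {p : ℝ} (hp : 1 < p) : ContDiff ℝ 1 (powerC p) := by
  rw [contDiff_one_iff_fderiv]
  refine ⟨fun z => ?_, continuous_iff_continuousAt.2 fun z => ?_⟩
  · rcases eq_or_ne z 0 with rfl | hz
    · exact (hasFDerivAt_powerC_zero hp).differentiableAt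
    · exact (contDiffAt_powerC p hz).differentiableAt (by norm_num)
  · rcases eq_or_ne z 0 with rfl | hz
    · rw [ContinuousAt, (hasFDerivAt_powerC_zero hp).fderiv]
      refine squeeze_zero_norm (a := fun z => p * ‖z‖ ^ (p - 1)) (fun z => ?_) ?_
      · rcases eq_or_ne z 0 with rfl | hz
        · rw [(hasFDerivAt_powerC_zero hp).fderiv, norm_zero]
          positivity
        · exact norm_fderiv_powerC_le hp hz
      · simpa using (tendsto_norm_rpow_zero hp).const_mul p
    · exact (contDiffAt_powerC p hz).continuousAt_fderiv (by norm_num)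

/-- Double differences of a `C¹` function. -/
theorem norm_double_difference_le {G : ℂ → ℂ} (hG : ContDiff ℝ 1 G) {L ε η : ℝ}
    (h1 : ∀ z, ‖fderiv ℝ G z‖ ≤ L)
    (h2 : ∀ z w, ‖z - w‖ ≤ η → ‖fderiv ℝ G z - fderiv ℝ G w‖ ≤ ε) {a b c d : ℂ}
    (hac : ‖a - c‖ ≤ η) (hbd : ‖b - d‖ ≤ η) :
    ‖G a - G b - (G c - G d)‖ ≤ L * ‖a - b - (c - d)‖ + ε * ‖c - d‖ := by
  have hline : ∀ (u v : ℂ) (θ : ℝ), HasDerivAt (fun θ : ℝ => G (v + θ • (u - v)))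
      (fderiv ℝ G (v + θ • (u - v)) (u - v)) θ := by
    intro u v θ
    have h3 : HasDerivAt (fun θ : ℝ => v + θ • (u - v)) (u - v) θ := by
      simpa using ((hasDerivAt_id θ).smul_const (u - v)).const_add v
    exact (hG.differentiable (by norm_num) _).hasFDerivAt.comp_hasDerivAt θ h3
  -- Mean value inequality along the segments from b to a and from d to c with a common parameter.
  -- The two moving points differ by a convex combination of a - c and b - d, hence by at most η.
  have h := norm_image_sub_le_of_norm_deriv_le_segment_01'
    (f := fun θ : ℝ => G (b + θ • (a - b)) - G (d + θ • (c - d)))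
    (C := L * ‖a - b - (c - d)‖ + ε * ‖c - d‖)
    (fun θ _ => ((hline a b θ).sub (hline c d θ)).hasDerivWithinAt) (fun θ hθ => ?_)
  · simp only [one_smul, zero_smul, add_zero, add_sub_cancel] at h
    rwa [sub_sub_sub_comm] at h
  · set x := b + θ • (a - b)
    set y := d + θ • (c - d)
    have e : fderiv ℝ G x (a - b) - fderiv ℝ G y (c - d) =
        fderiv ℝ G x (a - b - (c - d)) + (fderiv ℝ G x - fderiv ℝ G y) (c - d) := by
      rw [map_sub _ (a - b), sub_apply]; ring
    have hxy : ‖x - y‖ ≤ η := by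
      have e2 : x - y = (1 - θ) • (b - d) + θ • (a - c) := by
        simp only [x, y, Complex.real_smul]; push_cast; ring
      rw [e2]
      refine (norm_add_le _ _).trans ?_
      rw [norm_smul, norm_smul, Real.norm_of_nonneg hθ.1,
        Real.norm_of_nonneg (by linarith [hθ.2] : 0 ≤ 1 - θ)]
      nlinarith [hθ.1, hθ.2]
    rw [e]
    refine (norm_add_le _ _).trans (add_le_add ?_ ?_)
    · exact (ContinuousLinearMap.le_opNorm _ _).trans (by gcongr; exact h1 x)
    · exact (ContinuousLinearMap.le_opNorm _ _).trans (by gcongr; exact h2 x y hxy)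

/-- A function which agrees with `z ↦ |z|^{p-1} z` on the disc of radius `M`, is globally Lipschitz,
and whose double differences are controlled. -/
theorem exists_truncated_powerC {p : ℝ} (hp : 1 < p) (M : ℝ) :
    ∃ (G : ℂ → ℂ) (L : NNReal), G 0 = 0 ∧ LipschitzWith L G ∧
      (∀ z, ‖z‖ ≤ M → G z = powerC p z) ∧
      ∀ ε > 0, ∃ η > 0, ∀ a b c d : ℂ, ‖a - c‖ ≤ η → ‖b - d‖ ≤ η →
        ‖G a - G b - (G c - G d)‖ ≤ L * ‖a - b - (c - d)‖ + ε * ‖c - d‖ := by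
  -- The cutoff is 1 on the disc of radius M. Compact support makes the derivative of the product
  -- bounded and uniformly continuous. The absolute value keeps the radii positive for every real M.
  let χ : ContDiffBump (0 : ℂ) := ⟨|M| + 1, |M| + 2, by positivity, by linarith⟩
  have hG : ContDiff ℝ 1 fun z => χ z • powerC p z := χ.contDiff.smul (contDiff_powerC hp)
  have hc : HasCompactSupport fun z => χ z • powerC p z := χ.hasCompactSupport.smul_right
  obtain ⟨L, hL⟩ := ContDiff.lipschitzWith_of_hasCompactSupport hc hG (by norm_num)
  have hu := (hc.fderiv ℝ).uniformContinuous_of_continuous (hG.continuous_fderiv (by norm_num))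
  refine ⟨_, L, by simp [powerC_zero], hL, fun z hz => ?_, fun ε hε => ?_⟩
  · have : χ z = 1 := χ.one_of_mem_closedBall (by
      rw [mem_closedBall_zero_iff]
      exact hz.trans ((le_abs_self M).trans (by change |M| ≤ |M| + 1; linarith)))
    simp only [this, one_smul]
  · obtain ⟨η, hη, h⟩ := Metric.uniformContinuous_iff.1 hu ε hε
    refine ⟨η / 2, by positivity, fun a b c d hac hbd => ?_⟩
    refine norm_double_difference_le hG (fun z => norm_fderiv_le_of_lipschitz ℝ hL)
      (fun z w hzw => ?_) hac hbd
    rw [← dist_eq_norm]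
    exact (h (by rw [dist_eq_norm]; linarith)).le

/-! ### Composition operators on `H^s` -/

theorem L2_norm_sq_le_of_ae {w k l : L2} {A B : ℝ}
    (h : ∀ᵐ x, ‖w x‖ ≤ A * ‖k x‖ + B * ‖l x‖) :
    ‖w‖ ^ 2 ≤ 2 * A ^ 2 * ‖k‖ ^ 2 + 2 * B ^ 2 * ‖l‖ ^ 2 := by
  rw [L2_norm_sq_eq, L2_norm_sq_eq, L2_norm_sq_eq, ← integral_const_mul, ← integral_const_mul,
    ← integral_add ((L2_integrable_norm_sq _).const_mul _) ((L2_integrable_norm_sq _).const_mul _)]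
  refine integral_mono_ae (L2_integrable_norm_sq _)
    (((L2_integrable_norm_sq _).const_mul _).add ((L2_integrable_norm_sq _).const_mul _)) ?_
  filter_upwards [h] with x hx
  have h1 := pow_le_pow_left₀ (norm_nonneg _) hx 2
  nlinarith [sq_nonneg (A * ‖k x‖ - B * ‖l x‖)]

section Composition

variable {G : ℂ → ℂ} {L : NNReal} (hL : LipschitzWith L G) (h0 : G 0 = 0)

theorem transL2_compLp_ae (t : ℝ) (f : L2) :
    ∀ᵐ x, (transL2 t (hL.compLp h0 f) : L2) x = G (transL2 t f x) := by
  filter_upwards [transL2_ae t (hL.compLp h0 f), transL2_ae t f,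
    ae_comp_add (hL.coeFn_compLp h0 f) t] with x h1 h2 h3
  rw [h1, h2, h3, Function.comp_apply]

/-- A Lipschitz map multiplies every translation increment by at most L, and these increments
control the H^s norm. -/
theorem Hs.exists_compLp {s : ℝ} (hs : 0 < s) (hs' : s < 1) (f : Hs s) :
    ∃ u : Hs s, u.toL2 = hL.compLp h0 f.toL2 ∧ ‖u‖ ≤ 2 * L * ‖f‖ := by
  have h1 : ∀ t, ‖transL2 t (hL.compLp h0 f.toL2) - hL.compLp h0 f.toL2‖ ^ 2 ≤
      (L : ℝ) ^ 2 * ‖transL2 t f.toL2 - f.toL2‖ ^ 2 + 0 * ‖transL2 t f.toL2 - f.toL2‖ ^ 2 := by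
    intro t
    rw [zero_mul, add_zero, ← mul_pow]
    refine pow_le_pow_left₀ (norm_nonneg _) (Lp.norm_le_mul_norm_of_ae_le_mul ?_) 2
    filter_upwards [transL2_compLp_ae hL h0 t f.toL2, hL.coeFn_compLp h0 f.toL2,
      Lp.coeFn_sub (transL2 t (hL.compLp h0 f.toL2)) (hL.compLp h0 f.toL2),
      Lp.coeFn_sub (transL2 t f.toL2) f.toL2] with x h1 h2 h3 h4
    rw [h3, h4, Pi.sub_apply, Pi.sub_apply, h1, h2, Function.comp_apply]
    exact hL.norm_sub_le _ _
  have h2 : ‖hL.compLp h0 f.toL2‖ ^ 2 ≤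
      (L : ℝ) ^ 2 * ‖f.toL2‖ ^ 2 + 0 * ‖f.toL2‖ ^ 2 := by
    rw [zero_mul, add_zero, ← mul_pow]
    exact pow_le_pow_left₀ (norm_nonneg _) (hL.norm_compLp_le h0 _) 2
  obtain ⟨u, hu, hu'⟩ := Hs.exists_of_increments hs hs' (by positivity) le_rfl h1 h2
  refine ⟨u, hu, le_of_sq_le_sq (hu'.trans ?_) (by positivity)⟩
  nlinarith [mul_nonneg (sq_nonneg (L : ℝ)) (sq_nonneg ‖f‖)]

/-- The translation increment of G(f) - G(g) is a double difference of G at f(x+t), f(x), g(x+t),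
g(x), and closeness of f and g in L^∞ is what the double-difference bound asks for. The ε-term is
the price of G being only C¹. -/
theorem Hs.norm_compLp_sub_le {s : ℝ} (hs : 0 < s) (hs' : s < 1) {ε η : ℝ} (hε : 0 ≤ ε)
    (hG : ∀ a b c d : ℂ, ‖a - c‖ ≤ η → ‖b - d‖ ≤ η →
      ‖G a - G b - (G c - G d)‖ ≤ L * ‖a - b - (c - d)‖ + ε * ‖c - d‖)
    {f g u v : Hs s} (hu : u.toL2 = hL.compLp h0 f.toL2) (hv : v.toL2 = hL.compLp h0 g.toL2)
    (hfg : ∀ᵐ x, ‖f.toL2 x - g.toL2 x‖ ≤ η) :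
    ‖u - v‖ ≤ 2 * L * ‖f - g‖ + 2 * ε * ‖g‖ := by
  have h1 : ∀ t, ‖transL2 t (u - v).toL2 - (u - v).toL2‖ ^ 2 ≤
      2 * (L : ℝ) ^ 2 * ‖transL2 t (f - g).toL2 - (f - g).toL2‖ ^ 2 +
        2 * ε ^ 2 * ‖transL2 t g.toL2 - g.toL2‖ ^ 2 := by
    intro t
    refine L2_norm_sq_le_of_ae ?_
    rw [map_sub Hs.toL2 f, map_sub Hs.toL2 u, map_sub (transL2 t), map_sub (transL2 t), hu, hv]
    filter_upwards [transL2_compLp_ae hL h0 t f.toL2, hL.coeFn_compLp h0 f.toL2,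
      transL2_compLp_ae hL h0 t g.toL2, hL.coeFn_compLp h0 g.toL2,
      Lp.coeFn_sub (transL2 t (hL.compLp h0 f.toL2) - transL2 t (hL.compLp h0 g.toL2))
        (hL.compLp h0 f.toL2 - hL.compLp h0 g.toL2),
      Lp.coeFn_sub (transL2 t (hL.compLp h0 f.toL2)) (transL2 t (hL.compLp h0 g.toL2)),
      Lp.coeFn_sub (hL.compLp h0 f.toL2) (hL.compLp h0 g.toL2),
      Lp.coeFn_sub (transL2 t f.toL2 - transL2 t g.toL2) (f.toL2 - g.toL2),
      Lp.coeFn_sub (transL2 t f.toL2) (transL2 t g.toL2),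
      Lp.coeFn_sub f.toL2 g.toL2, Lp.coeFn_sub (transL2 t g.toL2) g.toL2, hfg,
      ae_comp_add hfg t, transL2_ae t f.toL2, transL2_ae t g.toL2]
      with x a1 a2 a3 a4 b1 b2 b3 c1 c2 c3 c4 d1 d2 e1 e2
    rw [b1, c1, c4, Pi.sub_apply, Pi.sub_apply, Pi.sub_apply, b2, b3, c2, c3, Pi.sub_apply,
      Pi.sub_apply, Pi.sub_apply, Pi.sub_apply, a1, a2, a3, a4, Function.comp_apply,
      Function.comp_apply]
    have := hG (transL2 t f.toL2 x) (f.toL2 x) (transL2 t g.toL2 x) (g.toL2 x)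
      (by rw [e1, e2]; exact d2) d1
    rwa [sub_sub_sub_comm, sub_sub_sub_comm (transL2 t f.toL2 x)] at this
  have h2 : ‖(u - v).toL2‖ ^ 2 ≤
      2 * (L : ℝ) ^ 2 * ‖(f - g).toL2‖ ^ 2 + 2 * ε ^ 2 * ‖g.toL2‖ ^ 2 := by
    have h1 : ‖(u - v).toL2‖ ^ 2 ≤ (L * ‖(f - g).toL2‖) ^ 2 := by
      refine pow_le_pow_left₀ (norm_nonneg _) ?_ 2
      rw [map_sub Hs.toL2, map_sub Hs.toL2, hu, hv]
      exact hL.norm_compLp_sub_le h0 _ _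
    nlinarith [mul_nonneg (sq_nonneg ε) (sq_nonneg ‖g.toL2‖),
      mul_nonneg (sq_nonneg (L : ℝ)) (sq_nonneg ‖(f - g).toL2‖)]
  obtain ⟨w, hw, hw'⟩ := Hs.exists_of_increments hs hs' (by positivity) (by positivity) h1 h2
  rw [← Hs.toL2_injective hw]
  refine le_of_sq_le_sq (hw'.trans ?_) (by positivity)
  nlinarith [mul_nonneg (mul_nonneg L.coe_nonneg (norm_nonneg (f - g)))
    (mul_nonneg hε (norm_nonneg g))]

end Composition

/-- A truncation of the power nonlinearity, acting on `H^s`, which agrees with it on functions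
bounded by `M`. -/
theorem exists_truncated_powerNL {p s : ℝ} (hp : 1 < p) (hs : 1 / 2 < s) (hs' : s < 1) (M : ℝ) :
    ∃ (Φ : Hs s → Hs s) (L : ℝ), 0 < L ∧ (∀ f, ‖Φ f‖ ≤ L * ‖f‖) ∧
      (∀ f g, ‖(Φ f - Φ g).toL2‖ ≤ L * ‖(f - g).toL2‖) ∧
      (∀ R ε : ℝ, 0 < ε → ∃ η > 0, ∀ f g, ‖f‖ ≤ R → ‖g‖ ≤ R → ‖(f - g).toL2‖ ≤ η →
        ‖Φ f - Φ g‖ ≤ L * ‖f - g‖ + ε) ∧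
      ∀ f : Hs s, (∀ᵐ x, ‖f.toL2 x‖ ≤ M) →
        MemLp (powerFun p f.toL2) 2 volume ∧ powerNL p f.toL2 = (Φ f).toL2 := by
  have hs0 : 0 < s := by linarith
  obtain ⟨G, L, h0, hL, hM, hG⟩ := exists_truncated_powerC hp M
  choose Φ hΦ hΦ' using fun f : Hs s => Hs.exists_compLp hL h0 hs0 hs' f
  have hL0 : (0 : ℝ) ≤ L := L.2
  refine ⟨Φ, 2 * L + 1, by positivity, fun f => (hΦ' f).trans ?_, fun f g => ?_,
    fun R ε hε => ?_, fun f hf => ?_⟩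
  · nlinarith [norm_nonneg f]
  · rw [map_sub Hs.toL2, map_sub Hs.toL2, hΦ, hΦ]
    refine (hL.norm_compLp_sub_le h0 _ _).trans ?_
    nlinarith [norm_nonneg (f.toL2 - g.toL2)]
  · obtain ⟨η, hη, hη'⟩ := hG (ε / (2 * (|R| + 1))) (by positivity)
    -- The parameter n is chosen so that the H^s contribution to ‖f - g‖_∞ is below η/2. The L²
    -- contribution, of coefficient `sobolevConst s n * n`, is then kept below η/2 by the smallness
    -- of ‖f - g‖ in L².
    have ht := (tendsto_sobolevConst hs).mul_const (2 * |R|)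
    rw [zero_mul] at ht
    obtain ⟨n, hn⟩ := (ht.eventually (gt_mem_nhds (half_pos hη))).exists
    have hsc : 0 ≤ sobolevConst s n := Real.sqrt_nonneg _
    refine ⟨η / (2 * (sobolevConst s n * n + 1)), by positivity, fun f g hf hg hfg => ?_⟩
    have hae : ∀ᵐ x, ‖f.toL2 x - g.toL2 x‖ ≤ η := by
      have h1 := Hs.ae_norm_le hs n (f - g)
      rw [map_sub Hs.toL2] at h1 hfg
      filter_upwards [h1, Lp.coeFn_sub f.toL2 g.toL2] with x h1 h2
      rw [h2, Pi.sub_apply] at h1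
      refine h1.trans ?_
      have h3 : ‖f - g‖ ≤ 2 * |R| :=
        (norm_sub_le _ _).trans (by linarith [le_abs_self R])
      have h4 : (sobolevConst s n * n + 1) * ‖f.toL2 - g.toL2‖ ≤ η / 2 := by
        rw [le_div_iff₀ (by positivity)] at hfg
        linarith
      have h5 := mul_le_mul_of_nonneg_left h3 hsc
      rw [Nat.abs_cast]
      nlinarith [norm_nonneg (f.toL2 - g.toL2)]
    refine (Hs.norm_compLp_sub_le hL h0 hs0 hs' (by positivity) hη' (hΦ f) (hΦ g) hae).trans ?_
    have h6 : 2 * (ε / (2 * (|R| + 1))) * ‖g‖ ≤ ε := by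
      have : ‖g‖ ≤ |R| + 1 := by linarith [le_abs_self R]
      calc _ ≤ 2 * (ε / (2 * (|R| + 1))) * (|R| + 1) := by gcongr
        _ = ε := by field_simp
    nlinarith [norm_nonneg (f - g)]
  · have e : powerFun p f.toL2 =ᵐ[volume] (Φ f).toL2 := by
      rw [hΦ]
      filter_upwards [hf, hL.coeFn_compLp h0 f.toL2] with x h1 h2
      rw [h2, Function.comp_apply, hM _ h1]
      rfl
    have hm : MemLp (powerFun p f.toL2) 2 volume := (memLp_congr_ae e).2 (Lp.memLp _)
    refine ⟨hm, ?_⟩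
    rw [powerNL, dif_pos hm]
    exact Lp.ext (hm.coeFn_toLp.trans e)

/-! ### Mild solutions of semilinear equations -/

/-- Integrating the weight e^{l|τ|} gains a factor 1/l. With l = 2KL this makes the nonlinear
Duhamel term a contraction by 1/2 on any time interval. -/
theorem norm_integral_le_exp {Z : Type*} [NormedAddCommGroup Z] [NormedSpace ℝ Z] {f : ℝ → Z}
    {A C l t : ℝ} (hl : 0 < l) (hC : 0 ≤ C)
    (h : ∀ τ ∈ uIcc 0 t, ‖f τ‖ ≤ A + C * Real.exp (l * |τ|)) :
    ‖∫ τ in (0 : ℝ)..t, f τ‖ ≤ A * |t| + C / l * Real.exp (l * |t|) := by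
  have main : ∀ {g : ℝ → Z} {r : ℝ}, 0 ≤ r →
      (∀ τ ∈ Icc 0 r, ‖g τ‖ ≤ A + C * Real.exp (l * |τ|)) →
      ‖∫ τ in (0 : ℝ)..r, g τ‖ ≤ A * r + C / l * Real.exp (l * r) := by
    intro g r hr hg
    have hd : ∀ τ ∈ uIcc 0 r, HasDerivAt (fun τ => A * τ + C / l * Real.exp (l * τ))
        (A + C * Real.exp (l * τ)) τ := by
      intro τ _
      have h1 := ((hasDerivAt_id τ).const_mul l).exp.const_mul (C / l)
      have h2 := ((hasDerivAt_id τ).const_mul A).add h1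
      refine HasDerivAt.congr_deriv (f := fun τ => A * τ + C / l * Real.exp (l * τ)) h2 ?_
      simp only [id_eq, mul_one]
      field_simp
    have hc : Continuous fun τ => A + C * Real.exp (l * τ) := by fun_prop
    refine (intervalIntegral.norm_integral_le_of_norm_le hr (Eventually.of_forall fun τ hτ => ?_)
      (hc.intervalIntegrable 0 r)).trans ?_
    · have := hg τ (Ioc_subset_Icc_self hτ)
      rwa [abs_of_pos hτ.1] at this
    · rw [intervalIntegral.integral_eq_sub_of_hasDerivAt hd (hc.intervalIntegrable 0 r)]
      simp only [mul_zero, Real.exp_zero, mul_one, zero_add]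
      linarith [div_nonneg hC hl.le]
  rcases le_total 0 t with ht | ht
  · rw [abs_of_nonneg ht]
    rw [uIcc_of_le ht] at h
    exact main ht h
  · rw [abs_of_nonpos ht]
    have e : ∫ τ in (0 : ℝ)..t, f τ = -∫ τ in (0 : ℝ)..(-t), f (-τ) := by
      rw [intervalIntegral.integral_comp_neg, neg_neg, neg_zero, ← intervalIntegral.integral_symm]
    rw [e, norm_neg]
    refine main (by linarith) fun τ hτ => ?_
    have := h (-τ) (by rw [uIcc_of_ge ht]; constructor <;> linarith [hτ.1, hτ.2])
    rwa [abs_neg] at this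

/-- A substitute for Grönwall. Let S be the maximum of φ(τ)e^{-l|τ|}. The hypothesis at a maximizer
gives S e^{l|τ|} ≤ A + (S/2) e^{l|τ|}, hence S ≤ 2A. -/
theorem le_exp_of_bootstrap {φ : ℝ → ℝ} {t l A : ℝ} (hl : 0 ≤ l)
    (hφ : ContinuousOn φ (uIcc 0 t)) (hφ0 : ∀ τ, 0 ≤ φ τ)
    (h : ∀ S, 0 ≤ S → (∀ τ ∈ uIcc 0 t, φ τ ≤ S * Real.exp (l * |τ|)) →
      ∀ τ ∈ uIcc 0 t, φ τ ≤ A + S / 2 * Real.exp (l * |τ|)) :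
    ∀ τ ∈ uIcc 0 t, φ τ ≤ 2 * A * Real.exp (l * |τ|) := by
  have hc : ContinuousOn (fun τ => φ τ * Real.exp (-(l * |τ|))) (uIcc 0 t) :=
    hφ.mul (by fun_prop)
  obtain ⟨τ₀, hτ₀, hmax⟩ := isCompact_uIcc.exists_isMaxOn nonempty_uIcc hc
  have hS : ∀ τ ∈ uIcc 0 t, φ τ ≤ φ τ₀ * Real.exp (-(l * |τ₀|)) * Real.exp (l * |τ|) := by
    intro τ hτ
    have h1 : φ τ * Real.exp (-(l * |τ|)) ≤ φ τ₀ * Real.exp (-(l * |τ₀|)) := hmax hτ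
    calc φ τ = φ τ * Real.exp (-(l * |τ|)) * Real.exp (l * |τ|) := by
          rw [mul_assoc, ← Real.exp_add, neg_add_cancel, Real.exp_zero, mul_one]
      _ ≤ _ := by gcongr
  set S := φ τ₀ * Real.exp (-(l * |τ₀|)) with hSd
  have hS0 : 0 ≤ S := mul_nonneg (hφ0 _) (Real.exp_pos _).le
  have h2 := h S hS0 hS τ₀ hτ₀
  have h3 : φ τ₀ = S * Real.exp (l * |τ₀|) := by
    rw [hSd, mul_assoc, ← Real.exp_add, neg_add_cancel, Real.exp_zero, mul_one]
  have h4 : 1 ≤ Real.exp (l * |τ₀|) := Real.one_le_exp (by positivity)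
  have h5 : S ≤ 2 * A := by nlinarith
  intro τ hτ
  exact (hS τ hτ).trans (by gcongr)

/-- The hypotheses on a semilinear evolution equation in the space `X`, with a weaker norm given by
the embedding `J` into `Y`: the nonlinearity `Φ` is Lipschitz for the weak norm, and almost
Lipschitz for the strong norm on bounded sets of elements which are close in the weak norm. -/
structure SemilinearSetting {X Y : Type*} [NormedAddCommGroup X] [NormedSpace ℂ X]
    [NormedAddCommGroup Y] [NormedSpace ℂ Y] (J : X →L[ℂ] Y) (W : ℝ → X →L[ℂ] X) (Φ : X → X)
    (K L : ℝ) : Prop where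
  one_le : 1 ≤ K
  pos : 0 < L
  injective : Function.Injective J
  norm_W : ∀ t x, ‖W t x‖ ≤ K * ‖x‖
  norm_JW : ∀ t x, ‖J (W t x)‖ ≤ ‖J x‖
  continuous_W : ∀ x, Continuous fun t => W t x
  norm_Φ : ∀ x, ‖Φ x‖ ≤ L * ‖x‖
  norm_J_Φ : ∀ x y, ‖J (Φ x - Φ y)‖ ≤ L * ‖J (x - y)‖
  norm_Φ_sub : ∀ R ε : ℝ, 0 < ε → ∃ η > 0, ∀ x y, ‖x‖ ≤ R → ‖y‖ ≤ R → ‖J (x - y)‖ ≤ η →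
    ‖Φ x - Φ y‖ ≤ L * ‖x - y‖ + ε

/-- The right-hand side of Duhamel's formula. -/
def duhamelMap {X : Type*} [NormedAddCommGroup X] [NormedSpace ℂ X] (W : ℝ → X →L[ℂ] X)
    (Φ : X → X) (u₀ : X) (u : ℝ → X) (t : ℝ) : X :=
  W t u₀ + Complex.I • ∫ τ in (0 : ℝ)..t, W (t - τ) (Φ (u τ))

namespace SemilinearSetting

variable {X Y : Type*} [NormedAddCommGroup X] [NormedSpace ℂ X]
  [NormedAddCommGroup Y] [NormedSpace ℂ Y] {J : X →L[ℂ] Y} {W : ℝ → X →L[ℂ] X}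
  {Φ : X → X} {K L : ℝ}

theorem continuous_prod (H : SemilinearSetting J W Φ K L) :
    Continuous fun q : ℝ × X => W q.1 q.2 := by
  have hK : 0 ≤ K := zero_le_one.trans H.one_le
  refine continuous_iff_continuousAt.2 fun ⟨t₀, x₀⟩ => ?_
  rw [ContinuousAt, tendsto_iff_norm_sub_tendsto_zero]
  have h : Tendsto (fun q : ℝ × X => K * ‖q.2 - x₀‖ + ‖W q.1 x₀ - W t₀ x₀‖) (𝓝 (t₀, x₀))
      (𝓝 0) := by
    have hc : Continuous fun q : ℝ × X => K * ‖q.2 - x₀‖ + ‖W q.1 x₀ - W t₀ x₀‖ :=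
      (continuous_const.mul (continuous_snd.sub continuous_const).norm).add
        (((H.continuous_W x₀).comp continuous_fst).sub continuous_const).norm
    simpa using hc.tendsto (t₀, x₀)
  refine squeeze_zero (fun q => norm_nonneg _) (fun q => ?_) h
  have e : W q.1 q.2 - W t₀ x₀ = W q.1 (q.2 - x₀) + (W q.1 x₀ - W t₀ x₀) := by
    rw [map_sub]; abel
  rw [e]
  exact (norm_add_le _ _).trans (by gcongr; exact H.norm_W _ _)

theorem continuous_Φ (H : SemilinearSetting J W Φ K L) : Continuous Φ := by
  refine continuous_iff_continuousAt.2 fun y => Metric.tendsto_nhds.2 fun ε hε => ?_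
  obtain ⟨η, hη, h⟩ := H.norm_Φ_sub (‖y‖ + 1) (ε / 2) (by positivity)
  have hL := H.pos
  have h1 : ∀ᶠ x in 𝓝 y, ‖x - y‖ < min 1 (ε / (2 * L)) := by
    simpa [dist_eq_norm] using Metric.eventually_nhds_iff_ball.2
      ⟨min 1 (ε / (2 * L)), by positivity, fun x hx => (by simpa [dist_eq_norm] using hx :
        ‖x - y‖ < 1 ∧ ‖x - y‖ < ε / (2 * L))⟩
  have h2 : ∀ᶠ x in 𝓝 y, ‖J (x - y)‖ < η := by
    have hc : Continuous fun x => ‖J (x - y)‖ := by fun_prop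
    have := hc.tendsto y
    rw [sub_self, map_zero, norm_zero] at this
    exact this.eventually (gt_mem_nhds hη)
  filter_upwards [h1, h2] with x hx1 hx2
  rw [lt_min_iff, lt_div_iff₀ (by positivity)] at hx1
  rw [dist_eq_norm]
  have h3 : ‖x‖ ≤ ‖y‖ + 1 := by
    have := norm_sub_norm_le x y
    linarith [hx1.1]
  have := h x y h3 (by linarith) hx2.le
  linarith [hx1.2]

theorem map_Φ_zero (H : SemilinearSetting J W Φ K L) : Φ 0 = 0 := by
  simpa using H.norm_Φ 0

theorem intervalIntegrable (H : SemilinearSetting J W Φ K L) {u : ℝ → X} {t : ℝ}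
    (hu : ContinuousOn u (uIcc 0 t)) :
    IntervalIntegrable (fun τ => W (t - τ) (Φ (u τ))) volume 0 t :=
  ContinuousOn.intervalIntegrable <| H.continuous_prod.comp_continuousOn
    ((continuous_const.sub continuous_id).continuousOn.prodMk
      (H.continuous_Φ.comp_continuousOn hu))

theorem continuous_duhamelMap (H : SemilinearSetting J W Φ K L) (u₀ : X) {u : ℝ → X}
    (hu : Continuous u) : Continuous (duhamelMap W Φ u₀ u) := by
  refine (H.continuous_W u₀).add (Continuous.const_smul ?_ _)
  refine intervalIntegral.continuous_parametric_intervalIntegral_of_continuous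
    (f := fun t τ => W (t - τ) (Φ (u τ))) ?_ continuous_id
  exact H.continuous_prod.comp ((continuous_fst.sub continuous_snd).prodMk
    (H.continuous_Φ.comp (hu.comp continuous_snd)))

theorem duhamelMap_zero (H : SemilinearSetting J W Φ K L) (t : ℝ) :
    duhamelMap W Φ 0 (fun _ => 0) t = 0 := by
  simp [duhamelMap, H.map_Φ_zero]

theorem duhamelMap_sub (H : SemilinearSetting J W Φ K L) (u₀ v₀ : X) {u v : ℝ → X} {t : ℝ}
    (hu : ContinuousOn u (uIcc 0 t)) (hv : ContinuousOn v (uIcc 0 t)) :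
    duhamelMap W Φ u₀ u t - duhamelMap W Φ v₀ v t =
      W t (u₀ - v₀) + Complex.I • ∫ τ in (0 : ℝ)..t, W (t - τ) (Φ (u τ) - Φ (v τ)) := by
  have e : ∫ τ in (0 : ℝ)..t, W (t - τ) (Φ (u τ) - Φ (v τ)) =
      (∫ τ in (0 : ℝ)..t, W (t - τ) (Φ (u τ))) - ∫ τ in (0 : ℝ)..t, W (t - τ) (Φ (v τ)) := by
    rw [← intervalIntegral.integral_sub (H.intervalIntegrable hu) (H.intervalIntegrable hv)]
    simp only [map_sub]
  rw [e, duhamelMap, duhamelMap, map_sub, smul_sub]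
  abel

theorem norm_duhamelMap_sub_le (H : SemilinearSetting J W Φ K L) {u₀ v₀ : X} {u v : ℝ → X}
    {t A C l : ℝ} (hl : 0 < l) (hC : 0 ≤ C)
    (hu : ContinuousOn u (uIcc 0 t)) (hv : ContinuousOn v (uIcc 0 t))
    (h : ∀ τ ∈ uIcc 0 t, ‖Φ (u τ) - Φ (v τ)‖ ≤ A + C * Real.exp (l * |τ|)) :
    ‖duhamelMap W Φ u₀ u t - duhamelMap W Φ v₀ v t‖ ≤
      K * ‖u₀ - v₀‖ + K * (A * |t| + C / l * Real.exp (l * |t|)) := by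
  have hK : 0 ≤ K := zero_le_one.trans H.one_le
  rw [H.duhamelMap_sub u₀ v₀ hu hv]
  refine (norm_add_le _ _).trans (add_le_add (H.norm_W _ _) ?_)
  rw [norm_smul, Complex.norm_I, one_mul]
  refine (norm_integral_le_exp (A := K * A) (C := K * C) hl (by positivity) fun τ hτ => ?_).trans_eq
    (by ring)
  refine (H.norm_W _ _).trans ?_
  rw [mul_assoc, ← mul_add]
  exact mul_le_mul_of_nonneg_left (h τ hτ) hK

theorem norm_J_duhamelMap_sub_le [CompleteSpace X] [CompleteSpace Y]
    (H : SemilinearSetting J W Φ K L) {u₀ v₀ : X} {u v : ℝ → X}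
    {t C l : ℝ} (hl : 0 < l) (hC : 0 ≤ C)
    (hu : ContinuousOn u (uIcc 0 t)) (hv : ContinuousOn v (uIcc 0 t))
    (h : ∀ τ ∈ uIcc 0 t, ‖J (u τ - v τ)‖ ≤ C * Real.exp (l * |τ|)) :
    ‖J (duhamelMap W Φ u₀ u t - duhamelMap W Φ v₀ v t)‖ ≤
      ‖J (u₀ - v₀)‖ + L * C / l * Real.exp (l * |t|) := by
  have hL := H.pos
  have hi : IntervalIntegrable (fun τ => W (t - τ) (Φ (u τ) - Φ (v τ))) volume 0 t := by
    simp only [map_sub]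
    exact (H.intervalIntegrable hu).sub (H.intervalIntegrable hv)
  rw [H.duhamelMap_sub u₀ v₀ hu hv, map_add, map_smul]
  refine (norm_add_le _ _).trans (add_le_add (H.norm_JW _ _) ?_)
  rw [norm_smul, Complex.norm_I, one_mul, ← J.intervalIntegral_comp_comm hi]
  refine (norm_integral_le_exp (A := 0) (C := L * C) hl (by positivity) fun τ hτ => ?_).trans_eq
    (by ring)
  rw [zero_add, mul_assoc]
  refine (H.norm_JW _ _).trans ((H.norm_J_Φ _ _).trans ?_)
  gcongr
  exact h τ hτ

/-! ### Stability, Picard iteration and global existence for the truncated equation. -/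

theorem rate_pos (H : SemilinearSetting J W Φ K L) : 0 < 2 * K * L := by
  have := H.one_le
  have := H.pos
  positivity

/-- Weak stability. -/
theorem norm_J_sub_le [CompleteSpace X] [CompleteSpace Y] (H : SemilinearSetting J W Φ K L) {u₀ v₀ : X} {u v : ℝ → X} {t : ℝ}
    (hu : ContinuousOn u (uIcc 0 t)) (hv : ContinuousOn v (uIcc 0 t))
    (hu' : ∀ τ ∈ uIcc 0 t, u τ = duhamelMap W Φ u₀ u τ)
    (hv' : ∀ τ ∈ uIcc 0 t, v τ = duhamelMap W Φ v₀ v τ) :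
    ‖J (u t - v t)‖ ≤ 2 * ‖J (u₀ - v₀)‖ * Real.exp (2 * K * L * |t|) := by
  have hl := H.rate_pos
  refine le_exp_of_bootstrap hl.le (φ := fun τ => ‖J (u τ - v τ)‖)
    (J.continuous.comp_continuousOn (hu.sub hv)).norm (fun _ => norm_nonneg _)
    (fun S hS h τ hτ => ?_) t right_mem_uIcc
  have hsub : uIcc 0 τ ⊆ uIcc 0 t := uIcc_subset_uIcc left_mem_uIcc hτ
  rw [hu' τ hτ, hv' τ hτ]
  refine (H.norm_J_duhamelMap_sub_le hl hS (hu.mono hsub) (hv.mono hsub)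
    fun r hr => h r (hsub hr)).trans ?_
  have hSL : L * S / (2 * K * L) ≤ S / 2 := by
    have := H.one_le
    rw [div_le_div_iff₀ hl two_pos]
    nlinarith [mul_nonneg hS H.pos.le]
  gcongr

/-- Strong stability, for bounded solutions which are close in the weak norm. -/
theorem norm_sub_le (H : SemilinearSetting J W Φ K L) {u₀ v₀ : X} {u v : ℝ → X} {t ε : ℝ}
    (hε : 0 ≤ ε)
    (hu : ContinuousOn u (uIcc 0 t)) (hv : ContinuousOn v (uIcc 0 t))
    (hu' : ∀ τ ∈ uIcc 0 t, u τ = duhamelMap W Φ u₀ u τ)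
    (hv' : ∀ τ ∈ uIcc 0 t, v τ = duhamelMap W Φ v₀ v τ)
    (hΦ : ∀ τ ∈ uIcc 0 t, ‖Φ (u τ) - Φ (v τ)‖ ≤ L * ‖u τ - v τ‖ + ε) :
    ‖u t - v t‖ ≤ 2 * (K * (‖u₀ - v₀‖ + ε * |t|)) * Real.exp (2 * K * L * |t|) := by
  have hl := H.rate_pos
  have hK := H.one_le
  have hL := H.pos
  refine le_exp_of_bootstrap hl.le (φ := fun τ => ‖u τ - v τ‖)
    (hu.sub hv).norm (fun _ => norm_nonneg _) (fun S hS h τ hτ => ?_) t right_mem_uIcc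
  have hsub : uIcc 0 τ ⊆ uIcc 0 t := uIcc_subset_uIcc left_mem_uIcc hτ
  rw [hu' τ hτ, hv' τ hτ]
  refine (H.norm_duhamelMap_sub_le (A := ε) (C := L * S) hl (by positivity) (hu.mono hsub)
    (hv.mono hsub) fun r hr => ?_).trans ?_
  · refine (hΦ r (hsub hr)).trans ?_
    have := mul_le_mul_of_nonneg_left (h r (hsub hr)) hL.le
    linarith
  · have e : K * (L * S / (2 * K * L) * Real.exp (2 * K * L * |τ|)) =
        S / 2 * Real.exp (2 * K * L * |τ|) := by
      field_simp
    have hτt : |τ| ≤ |t| := by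
      rw [mem_uIcc] at hτ
      rcases hτ with h | h
      · rw [abs_of_nonneg h.1, abs_of_nonneg (h.1.trans h.2)]; exact h.2
      · rw [abs_of_nonpos h.2, abs_of_nonpos (h.1.trans h.2)]; linarith [h.1]
    rw [mul_add K (ε * |τ|), e]
    have : K * (ε * |τ|) ≤ K * (ε * |t|) := by gcongr
    linarith

/-- The growth of solutions. -/
theorem norm_le (H : SemilinearSetting J W Φ K L) {u₀ : X} {u : ℝ → X} {t : ℝ}
    (hu : ContinuousOn u (uIcc 0 t)) (hu' : ∀ τ ∈ uIcc 0 t, u τ = duhamelMap W Φ u₀ u τ) :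
    ‖u t‖ ≤ 2 * (K * ‖u₀‖) * Real.exp (2 * K * L * |t|) := by
  have h := H.norm_sub_le (v₀ := 0) (v := fun _ => 0) le_rfl hu continuousOn_const hu'
    (fun τ _ => (H.duhamelMap_zero τ).symm) (fun τ _ => by
      simpa [H.map_Φ_zero] using H.norm_Φ (u τ))
  simpa using h

/-- The Picard iterates. -/
def picard (W : ℝ → X →L[ℂ] X) (Φ : X → X) (u₀ : X) : ℕ → ℝ → X
  | 0 => fun _ => 0
  | n + 1 => duhamelMap W Φ u₀ (picard W Φ u₀ n)

theorem continuous_picard (H : SemilinearSetting J W Φ K L) (u₀ : X) (n : ℕ) :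
    Continuous (picard W Φ u₀ n) := by
  induction n with
  | zero => exact continuous_const
  | succ n ih => exact H.continuous_duhamelMap u₀ ih

/-- Induction: the linear term accounts for K‖u₀‖, and the exponential rate makes the integral
reproduce only half of the previous bound. -/
theorem norm_picard_le (H : SemilinearSetting J W Φ K L) (u₀ : X) (n : ℕ) (t : ℝ) :
    ‖picard W Φ u₀ n t‖ ≤ 2 * (K * ‖u₀‖) * Real.exp (2 * K * L * |t|) := by
  have hl := H.rate_pos
  have hK := H.one_le
  have hL := H.pos
  induction n generalizing t with
  | zero => rw [picard, norm_zero]; positivity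
  | succ n ih =>
    have h := H.norm_duhamelMap_sub_le (u₀ := u₀) (v₀ := 0) (u := picard W Φ u₀ n)
      (v := fun _ => 0) (t := t) (A := 0) (C := L * (2 * (K * ‖u₀‖))) hl (by positivity)
      (H.continuous_picard u₀ n).continuousOn continuousOn_const (fun τ _ => by
        rw [H.map_Φ_zero, sub_zero, zero_add, mul_assoc]
        exact (H.norm_Φ _).trans (mul_le_mul_of_nonneg_left (ih τ) hL.le))
    rw [H.duhamelMap_zero, sub_zero, sub_zero] at h
    have e : K * (0 * |t| + L * (2 * (K * ‖u₀‖)) / (2 * K * L) * Real.exp (2 * K * L * |t|)) =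
        K * ‖u₀‖ * Real.exp (2 * K * L * |t|) := by
      field_simp
      ring
    have h1 : 1 ≤ Real.exp (2 * K * L * |t|) := Real.one_le_exp (by positivity)
    rw [e] at h
    change ‖duhamelMap W Φ u₀ (picard W Φ u₀ n) t‖ ≤ _
    nlinarith [mul_nonneg (zero_le_one.trans hK) (norm_nonneg u₀)]

/-- In the weak norm Φ is genuinely Lipschitz, so each step contracts by L/(2KL) ≤ 1/2, starting
from the difference W t u₀. -/
theorem norm_J_picard_succ_sub_le [CompleteSpace X] [CompleteSpace Y]
    (H : SemilinearSetting J W Φ K L) (u₀ : X) (n : ℕ) (t : ℝ) :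
    ‖J (picard W Φ u₀ (n + 1) t - picard W Φ u₀ n t)‖ ≤
      ‖J u₀‖ * (1 / 2) ^ n * Real.exp (2 * K * L * |t|) := by
  have hl := H.rate_pos
  have hK := H.one_le
  have hL := H.pos
  induction n generalizing t with
  | zero =>
    have h1 : 1 ≤ Real.exp (2 * K * L * |t|) := Real.one_le_exp (by positivity)
    have e : picard W Φ u₀ (0 + 1) t - picard W Φ u₀ 0 t = W t u₀ := by
      simp [picard, duhamelMap, H.map_Φ_zero]
    rw [e, pow_zero, mul_one]
    exact (H.norm_JW _ _).trans (le_mul_of_one_le_right (norm_nonneg _) h1)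
  | succ n ih =>
    have h := H.norm_J_duhamelMap_sub_le (u₀ := u₀) (v₀ := u₀) (t := t) hl
      (C := ‖J u₀‖ * (1 / 2) ^ n) (by positivity)
      (H.continuous_picard u₀ (n + 1)).continuousOn (H.continuous_picard u₀ n).continuousOn
      fun τ _ => ih τ
    rw [sub_self, map_zero, norm_zero, zero_add] at h
    refine h.trans ?_
    gcongr
    rw [div_le_iff₀ hl, pow_succ]
    have : 0 ≤ ‖J u₀‖ * (1 / 2) ^ n * L := by positivity
    nlinarith

theorem norm_J_picard_sub_le [CompleteSpace X] [CompleteSpace Y]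
    (H : SemilinearSetting J W Φ K L) (u₀ : X) {n m : ℕ} (hnm : n ≤ m) (t : ℝ) :
    ‖J (picard W Φ u₀ m t - picard W Φ u₀ n t)‖ ≤
      2 * ‖J u₀‖ * (1 / 2) ^ n * Real.exp (2 * K * L * |t|) := by
  have key : ‖J (picard W Φ u₀ m t - picard W Φ u₀ n t)‖ ≤
      2 * ‖J u₀‖ * ((1 / 2) ^ n - (1 / 2) ^ m) * Real.exp (2 * K * L * |t|) := by
    induction m, hnm using Nat.le_induction with
    | base => simp
    | succ m _ ih =>
      rw [← sub_add_sub_cancel _ (picard W Φ u₀ m t), map_add]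
      refine (norm_add_le _ _).trans ((add_le_add (H.norm_J_picard_succ_sub_le u₀ m t)
        ih).trans_eq ?_)
      rw [pow_succ]
      ring
  refine key.trans ?_
  gcongr
  exact sub_le_self _ (by positivity)

/-- The iterates are bounded in X and uniformly Cauchy in the weak norm, so beyond some index the
almost Lipschitz estimate applies with error ε. Each later step halves the strong difference and
adds a multiple of ε. -/
theorem uniformCauchySeqOn_picard [CompleteSpace X] [CompleteSpace Y]
    (H : SemilinearSetting J W Φ K L) (u₀ : X) {T : ℝ} (hT : 0 < T) :
    UniformCauchySeqOn (picard W Φ u₀) atTop (Icc (-T) T) := by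
  have hl := H.rate_pos
  have hK := H.one_le
  have hL := H.pos
  set E := Real.exp (2 * K * L * T) with hE
  have hE1 : 1 ≤ E := Real.one_le_exp (by positivity)
  have hexp : ∀ {t : ℝ}, |t| ≤ T → Real.exp (2 * K * L * |t|) ≤ E := fun ht => by
    rw [hE]; gcongr
  set R := 2 * (K * ‖u₀‖) * E with hR
  have hbd : ∀ n t, |t| ≤ T → ‖picard W Φ u₀ n t‖ ≤ R := fun n t ht =>
    (H.norm_picard_le u₀ n t).trans (by rw [hR]; gcongr; exact hexp ht)
  have hR0 : 0 ≤ R := by positivity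
  have hw : ∀ η > 0, ∃ N, ∀ n m, N ≤ n → N ≤ m → ∀ t, |t| ≤ T →
      ‖J (picard W Φ u₀ m t - picard W Φ u₀ n t)‖ ≤ η := by
    intro η hη
    have h1 : Tendsto (fun n : ℕ => 2 * ‖J u₀‖ * (1 / 2) ^ n * E) atTop (𝓝 0) := by
      simpa using ((tendsto_pow_atTop_nhds_zero_of_lt_one (r := (1 / 2 : ℝ)) (by norm_num)
        (by norm_num)).const_mul (2 * ‖J u₀‖)).mul_const E
    obtain ⟨N, hN⟩ := eventually_atTop.1 (h1.eventually (gt_mem_nhds hη))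
    have h2 : ∀ n m, N ≤ n → n ≤ m → ∀ t, |t| ≤ T →
        ‖J (picard W Φ u₀ m t - picard W Φ u₀ n t)‖ ≤ η := by
      intro n m hn hnm t ht
      refine (H.norm_J_picard_sub_le u₀ hnm t).trans (le_trans ?_ (hN n hn).le)
      gcongr
      exact hexp ht
    refine ⟨N, fun n m hn hm t ht => ?_⟩
    rcases le_total n m with h | h
    · exact h2 n m hn h t ht
    · rw [← neg_sub, map_neg, norm_neg]
      exact h2 m n hm h t ht
  -- N depends on ε only, so j may afterwards be taken large. The term 2KTε is a fixed point:
  -- halved, it leaves KTε, and the error of the new step restores KTε.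
  have hmain : ∀ ε > 0, ∃ N, ∀ j, ∀ n m, N + j ≤ n → N + j ≤ m → ∀ t, |t| ≤ T →
      ‖picard W Φ u₀ m t - picard W Φ u₀ n t‖ ≤
        (2 * R * (1 / 2) ^ j + 2 * K * T * ε) * Real.exp (2 * K * L * |t|) := by
    intro ε hε
    obtain ⟨η, hη, hη'⟩ := H.norm_Φ_sub R ε hε
    obtain ⟨N, hN⟩ := hw η hη
    refine ⟨N, fun j => ?_⟩
    induction j with
    | zero =>
      intro n m hn hm t ht
      have h1 : 1 ≤ Real.exp (2 * K * L * |t|) := Real.one_le_exp (by positivity)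
      have h2 : 2 * R ≤ 2 * R * (1 / 2) ^ 0 + 2 * K * T * ε := by
        rw [pow_zero, mul_one]
        have : 0 ≤ 2 * K * T * ε := by positivity
        linarith
      calc _ ≤ ‖picard W Φ u₀ m t‖ + ‖picard W Φ u₀ n t‖ := _root_.norm_sub_le _ _
        _ ≤ 2 * R := by linarith [hbd n t ht, hbd m t ht]
        _ ≤ _ := h2.trans (le_mul_of_one_le_right (by linarith) h1)
    | succ j ih =>
      intro n m hn hm t ht
      obtain ⟨n, rfl⟩ : ∃ k, n = k + 1 := ⟨n - 1, by omega⟩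
      obtain ⟨m, rfl⟩ : ∃ k, m = k + 1 := ⟨m - 1, by omega⟩
      have hD : 0 ≤ 2 * R * (1 / 2) ^ j + 2 * K * T * ε := by positivity
      have h := H.norm_duhamelMap_sub_le (u₀ := u₀) (v₀ := u₀) (t := t) (A := ε)
        (C := L * (2 * R * (1 / 2) ^ j + 2 * K * T * ε)) hl (by positivity)
        (H.continuous_picard u₀ m).continuousOn (H.continuous_picard u₀ n).continuousOn
        (fun τ hτ => by
          have hτ' : |τ| ≤ T := by
            have := abs_sub_left_of_mem_uIcc hτ
            rw [sub_zero, sub_zero] at this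
            exact this.trans ht
          have h3 := hη' _ _ (hbd m τ hτ') (hbd n τ hτ') (hN n m (by omega) (by omega) τ hτ')
          have h4 := mul_le_mul_of_nonneg_left (ih n m (by omega) (by omega) τ hτ') hL.le
          linarith)
      rw [sub_self, norm_zero, mul_zero, zero_add] at h
      refine h.trans ?_
      have e : K * (ε * |t| + L * (2 * R * (1 / 2) ^ j + 2 * K * T * ε) / (2 * K * L) *
          Real.exp (2 * K * L * |t|)) = K * ε * |t| +
          (R * (1 / 2) ^ j + K * T * ε) * Real.exp (2 * K * L * |t|) := by
        field_simp
      rw [e, pow_succ]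
      have h1 : 1 ≤ Real.exp (2 * K * L * |t|) := Real.one_le_exp (by positivity)
      have h5 : K * ε * |t| ≤ K * ε * T * Real.exp (2 * K * L * |t|) :=
        (mul_le_mul_of_nonneg_left ht (by positivity)).trans
          (le_mul_of_one_le_right (by positivity) h1)
      linarith
  rw [Metric.uniformCauchySeqOn_iff]
  intro δ hδ
  -- The accumulated error 2KTε, multiplied by the largest weight E, is then δ/4.
  obtain ⟨N, hN⟩ := hmain (δ / (8 * K * T * E)) (by positivity)
  have h1 : Tendsto (fun j : ℕ => 2 * R * (1 / 2) ^ j * E) atTop (𝓝 0) := by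
    simpa using ((tendsto_pow_atTop_nhds_zero_of_lt_one (r := (1 / 2 : ℝ)) (by norm_num)
      (by norm_num)).const_mul (2 * R)).mul_const E
  obtain ⟨j, hj⟩ := (h1.eventually (gt_mem_nhds (half_pos hδ))).exists
  refine ⟨N + j, fun m hm n hn t ht => ?_⟩
  have ht' : |t| ≤ T := abs_le.2 ht
  rw [dist_eq_norm]
  refine (hN j n m hn hm t ht').trans_lt ?_
  have h2 : 2 * K * T * (δ / (8 * K * T * E)) * E = δ / 4 := by
    field_simp
    norm_num
  calc _ ≤ (2 * R * (1 / 2) ^ j + 2 * K * T * (δ / (8 * K * T * E))) * E := by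
        gcongr
        exact hexp ht'
    _ < δ := by rw [add_mul, h2]; linarith

/-- Global existence. -/
theorem exists_solution [CompleteSpace X] [CompleteSpace Y]
    (H : SemilinearSetting J W Φ K L) (u₀ : X) :
    ∃ u : ℝ → X, Continuous u ∧ ∀ t, u t = duhamelMap W Φ u₀ u t := by
  have hK := H.one_le
  have hL := H.pos
  have hpt : ∀ t, ∃ x, Tendsto (fun n => picard W Φ u₀ n t) atTop (𝓝 x) := by
    intro t
    have := (H.uniformCauchySeqOn_picard u₀ (T := |t| + 1) (by positivity)).cauchySeq
      (x := t) (abs_le.1 (by linarith))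
    exact cauchySeq_tendsto_of_complete this
  choose u hu using hpt
  have hloc : TendstoLocallyUniformly (picard W Φ u₀) u atTop := by
    rw [tendstoLocallyUniformly_iff_forall_isCompact]
    intro k hk
    obtain ⟨T, hT⟩ := hk.isBounded.subset_closedBall 0
    have h := (H.uniformCauchySeqOn_picard u₀ (T := |T| + 1)
      (by positivity)).tendstoUniformlyOn_of_tendsto fun t _ => hu t
    refine h.mono (hT.trans fun t ht => ?_)
    rw [mem_closedBall_zero_iff, Real.norm_eq_abs] at ht
    exact abs_le.1 (by linarith [le_abs_self T])
  have hc : Continuous u := hloc.continuous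
    (Eventually.of_forall fun n => H.continuous_picard u₀ n).frequently
  refine ⟨u, hc, fun t => tendsto_nhds_unique ((tendsto_add_atTop_iff_nat 1).2 (hu t)) ?_⟩
  refine Tendsto.const_add _ (Tendsto.const_smul ?_ _)
  refine intervalIntegral.tendsto_integral_filter_of_dominated_convergence
    (fun _ => K * (L * (2 * (K * ‖u₀‖) * Real.exp (2 * K * L * |t|)))) ?_ ?_
    intervalIntegrable_const ?_
  · exact Eventually.of_forall fun n =>
      (H.intervalIntegrable (H.continuous_picard u₀ n).continuousOn).def'.aestronglyMeasurable
  · refine Eventually.of_forall fun n => Eventually.of_forall fun τ hτ => ?_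
    have hτ' : |τ| ≤ |t| := by
      have := abs_sub_left_of_mem_uIcc (uIoc_subset_uIcc hτ)
      rwa [sub_zero, sub_zero] at this
    refine (H.norm_W _ _).trans ?_
    gcongr
    refine (H.norm_Φ _).trans ?_
    gcongr
    refine (H.norm_picard_le u₀ n τ).trans ?_
    gcongr
  · refine Eventually.of_forall fun τ _ => ?_
    exact ((W (t - τ)).continuous.tendsto _).comp ((H.continuous_Φ.tendsto _).comp (hu τ))

end SemilinearSetting

/-! ### Local well-posedness -/

theorem IsSolution.mono {γ p s : ℝ} {I J : Set ℝ} {u₀ : Hs s} {u : ℝ → Hs s}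
    (h : IsSolution γ p s I u₀ u) (hJ : J ⊆ I) : IsSolution γ p s J u₀ u :=
  ⟨h.continuousOn.mono hJ, fun t ht => h.memLp t (hJ ht), fun t ht => h.integrable t (hJ ht),
    fun t ht => h.duhamel t (hJ ht)⟩

/-- The truncation level `sobolevConst s 0 * B` is the L^∞ bound for functions of H^s norm at most
B, so the truncation does not affect u. Duhamel's formula in L² is then equivalent to the one in
H^s, as the inclusion is injective and commutes with the integral. W and K precede B because the
choice of B will depend on K. -/
theorem exists_semilinearSetting {γ p s : ℝ} (hγ : γ ≠ 0) (hp : 1 < p) (hs : 1 / 2 < s)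
    (hs' : s < 1) (hs0 : 0 ≤ s) :
    ∃ (W : ℝ → Hs s →L[ℂ] Hs s) (K : ℝ), ∀ B : ℝ, ∃ (Φ : Hs s → Hs s) (L : ℝ),
      SemilinearSetting (Hs.toL2L hs0) W Φ K L ∧
      ∀ (I : Set ℝ) (u₀ : Hs s) (u : ℝ → Hs s), I.OrdConnected → 0 ∈ I → ContinuousOn u I →
        (∀ t ∈ I, ‖u t‖ ≤ B) →
        (IsSolution γ p s I u₀ u ↔ ∀ t ∈ I, u t = duhamelMap W Φ u₀ u t) := by
  have := Hs.completeSpace hs0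
  obtain ⟨W, K, hK, hW, hWn, hWc⟩ := exists_propagator_Hs hγ hs0 hs'.le
  refine ⟨W, K, fun B => ?_⟩
  obtain ⟨Φ, L, hL, h1, h2, h3, h4⟩ := exists_truncated_powerNL hp hs hs' (sobolevConst s 0 * B)
  have H : SemilinearSetting (Hs.toL2L hs0) W Φ K L :=
    { one_le := hK
      pos := hL
      injective := Hs.toL2_injective
      norm_W := hWn
      norm_JW := fun t x => by
        rw [Hs.toL2L_apply, Hs.toL2L_apply, hW, LinearIsometryEquiv.norm_map]
      continuous_W := hWc
      norm_Φ := h1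
      norm_J_Φ := h2
      norm_Φ_sub := h3 }
  refine ⟨Φ, L, H, fun I u₀ u hI h0 hu hB => ?_⟩
  have hM : ∀ t ∈ I, MemLp (powerFun p (u t).toL2) 2 volume ∧
      powerNL p (u t).toL2 = (Φ (u t)).toL2 := fun t ht => h4 _ (by
    filter_upwards [Hs.ae_norm_le hs 0 (u t)] with x hx
    rw [abs_zero, zero_mul, zero_add] at hx
    exact hx.trans (mul_le_mul_of_nonneg_left (hB t ht) (Real.sqrt_nonneg _)))
  have hcont : ∀ t ∈ I, ContinuousOn u (uIcc 0 t) := fun t ht => hu.mono (hI.uIcc_subset h0 ht)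
  have hint : ∀ t ∈ I, EqOn (fun τ => Hs.toL2L hs0 (W (t - τ) (Φ (u τ))))
      (fun τ => deltaPropagator γ (t - τ) (powerNL p (u τ).toL2)) (uIcc 0 t) := fun t ht τ hτ => by
    simp only [Hs.toL2L_apply]
    rw [hW, (hM τ (hI.uIcc_subset h0 ht hτ)).2]
  have hD : ∀ t ∈ I, (duhamelMap W Φ u₀ u t).toL2 = deltaPropagator γ t u₀.toL2 +
      Complex.I • ∫ τ in (0 : ℝ)..t, deltaPropagator γ (t - τ) (powerNL p (u τ).toL2) := by
    intro t ht
    rw [← intervalIntegral.integral_congr (hint t ht),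
      (Hs.toL2L hs0).intervalIntegral_comp_comm (H.intervalIntegrable (hcont t ht)), duhamelMap,
      map_add, map_smul, hW, Hs.toL2L_apply]
  constructor
  · intro h t ht
    exact Hs.toL2_injective ((h.duhamel t ht).trans (hD t ht).symm)
  · intro h
    refine ⟨hu, fun t ht => (hM t ht).1, fun t ht => ?_, fun t ht => ?_⟩
    · refine ContinuousOn.intervalIntegrable (ContinuousOn.congr (f := fun τ =>
        Hs.toL2L hs0 (W (t - τ) (Φ (u τ)))) ?_ fun τ hτ => (hint t ht hτ).symm)
      exact (Hs.toL2L hs0).continuous.comp_continuousOn (H.continuous_prod.comp_continuousOn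
        ((continuous_const.sub continuous_id).continuousOn.prodMk
          (H.continuous_Φ.comp_continuousOn (hcont t ht))))
    · rw [← hD t ht, ← h t ht]

theorem local_existence {γ p s : ℝ} (hγ : γ ≠ 0) (hp : 1 < p) (hs : 1 / 2 < s) (hs' : s < 1)
    {R : ℝ} (hR : 0 < R) : ∃ T : ℝ, 0 < T ∧ ∀ u₀ : Hs s, ‖u₀‖ ≤ R →
      ∃ u : ℝ → Hs s, IsSolution γ p s (Icc (-T) T) u₀ u := by
  have hs0 : 0 ≤ s := by linarith
  have := Hs.completeSpace hs0
  obtain ⟨W, K, hWK⟩ := exists_semilinearSetting hγ hp hs hs' hs0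
  obtain ⟨Φ, L, H, hsol⟩ := hWK (2 * (K * R) * 2)
  have hl := H.rate_pos
  have hK := H.one_le
  -- Up to this time the growth factor e^{2KL|t|} is at most 2, so the solution stays below the
  -- truncation bound 2KR · 2.
  have hT : 0 < Real.log 2 / (2 * K * L) := div_pos (Real.log_pos one_lt_two) hl
  refine ⟨_, hT, fun u₀ hu₀ => ?_⟩
  obtain ⟨u, hu, hu'⟩ := H.exists_solution u₀
  refine ⟨u, (hsol _ u₀ u ordConnected_Icc ⟨by linarith, hT.le⟩ hu.continuousOn
    fun t ht => ?_).2 fun t _ => hu' t⟩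
  have ht' : 2 * K * L * |t| ≤ Real.log 2 := by
    have := abs_le.2 ht
    rwa [le_div_iff₀ hl, mul_comm] at this
  refine (H.norm_le hu.continuousOn fun τ _ => hu' τ).trans ?_
  gcongr
  exact (Real.exp_le_exp.2 ht').trans_eq (Real.exp_log two_pos)

/-- Between 0 and t both solutions are bounded in H^s, so they solve a common truncated equation,
and L² stability with equal data makes them equal. -/
theorem solution_unique {γ p s : ℝ} (hγ : γ ≠ 0) (hp : 1 < p) (hs : 1 / 2 < s) (hs' : s < 1)
    {I : Set ℝ} (hI : I.OrdConnected) (h0 : (0 : ℝ) ∈ I) {u₀ : Hs s} {u v : ℝ → Hs s}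
    (hu : IsSolution γ p s I u₀ u) (hv : IsSolution γ p s I u₀ v) : EqOn u v I := by
  have hs0 : 0 ≤ s := by linarith
  have := Hs.completeSpace hs0
  intro t ht
  have hsub := hI.uIcc_subset h0 ht
  replace hu := hu.mono hsub
  replace hv := hv.mono hsub
  obtain ⟨B₁, hB₁⟩ := isCompact_uIcc.exists_bound_of_continuousOn hu.continuousOn
  obtain ⟨B₂, hB₂⟩ := isCompact_uIcc.exists_bound_of_continuousOn hv.continuousOn
  obtain ⟨W, K, hWK⟩ := exists_semilinearSetting hγ hp hs hs' hs0
  obtain ⟨Φ, L, H, hsol⟩ := hWK (max B₁ B₂)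
  have h1 := (hsol _ u₀ u ordConnected_uIcc left_mem_uIcc hu.continuousOn
    fun τ hτ => (hB₁ τ hτ).trans (le_max_left _ _)).1 hu
  have h2 := (hsol _ u₀ v ordConnected_uIcc left_mem_uIcc hv.continuousOn
    fun τ hτ => (hB₂ τ hτ).trans (le_max_right _ _)).1 hv
  have h3 := H.norm_J_sub_le hu.continuousOn hv.continuousOn h1 h2
  rw [sub_self, map_zero, norm_zero, mul_zero, zero_mul, norm_le_zero_iff, map_sub, sub_eq_zero]
    at h3
  exact H.injective h3

/-- Truncate for norms up to B + ε, where B bounds u. The truncated solution with datum v₀ is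
global. By stability it stays within ε of u, hence below the truncation, so it solves the original
equation on the same interval. -/
theorem continuous_dependence {γ p s : ℝ} (hγ : γ ≠ 0) (hp : 1 < p) (hs : 1 / 2 < s) (hs' : s < 1)
    {a b : ℝ} (ha : a ≤ 0) (hb : 0 ≤ b) {u₀ : Hs s} {u : ℝ → Hs s}
    (hu : IsSolution γ p s (Icc a b) u₀ u) {ε : ℝ} (hε : 0 < ε) :
    ∃ δ : ℝ, 0 < δ ∧ ∀ v₀ : Hs s, ‖v₀ - u₀‖ < δ → ∃ v : ℝ → Hs s,
      IsSolution γ p s (Icc a b) v₀ v ∧ ∀ t ∈ Icc a b, ‖v t - u t‖ ≤ ε := by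
  have hs0 : 0 ≤ s := by linarith
  have := Hs.completeSpace hs0
  have h0 : (0 : ℝ) ∈ Icc a b := ⟨ha, hb⟩
  obtain ⟨B, hB⟩ := isCompact_Icc.exists_bound_of_continuousOn hu.continuousOn
  obtain ⟨W, K, hWK⟩ := exists_semilinearSetting hγ hp hs hs' hs0
  obtain ⟨Φ, L, H, hsol⟩ := hWK (B + ε)
  have hl := H.rate_pos
  have hK := H.one_le
  have hu' := (hsol _ u₀ u ordConnected_Icc h0 hu.continuousOn
    fun t ht => (hB t ht).trans (by linarith)).1 hu
  set T := b - a
  have hT : 0 ≤ T := by simp only [T]; linarith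
  have htT : ∀ {t}, t ∈ Icc a b → |t| ≤ T := fun ht =>
    abs_le.2 ⟨by simp only [T]; linarith [ht.1], by simp only [T]; linarith [ht.2]⟩
  set E := Real.exp (2 * K * L * T)
  have hE : 0 < E := Real.exp_pos _
  have hexp : ∀ {t}, t ∈ Icc a b → Real.exp (2 * K * L * |t|) ≤ E := fun ht =>
    Real.exp_le_exp.2 (mul_le_mul_of_nonneg_left (htT ht) hl.le)
  have hsub : ∀ {t}, t ∈ Icc a b → uIcc 0 t ⊆ Icc a b := fun ht =>
    ordConnected_Icc.uIcc_subset h0 ht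
  obtain ⟨η, hη, hΦ⟩ := H.norm_Φ_sub (2 * (K * (‖u₀‖ + 1)) * E) (ε / (4 * K * E * (T + 1)))
    (by positivity)
  -- The 1 keeps ‖v₀‖ ≤ ‖u₀‖ + 1 and thus both solutions in a fixed ball. The bound η/(2E) keeps
  -- them η-close in L². The bound ε/(4KE) on the data and the error ε/(4KE(T+1)) each contribute
  -- ε/2.
  refine ⟨min 1 (min (ε / (4 * K * E)) (η / (2 * E))), by positivity, fun v₀ hv₀ => ?_⟩
  rw [lt_min_iff, lt_min_iff] at hv₀
  obtain ⟨hδ1, hδ2, hδ3⟩ := hv₀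
  obtain ⟨v, hv, hv'⟩ := H.exists_solution v₀
  have hv₀ : ‖v₀‖ ≤ ‖u₀‖ + 1 := by
    have := norm_sub_norm_le v₀ u₀
    linarith
  have hun : ∀ t ∈ Icc a b, ‖u t‖ ≤ 2 * (K * (‖u₀‖ + 1)) * E := fun t ht =>
    (H.norm_le (hu.continuousOn.mono (hsub ht)) fun τ hτ => hu' τ (hsub ht hτ)).trans (by
      gcongr
      · linarith
      · exact hexp ht)
  have hvn : ∀ t ∈ Icc a b, ‖v t‖ ≤ 2 * (K * (‖u₀‖ + 1)) * E := fun t ht =>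
    (H.norm_le hv.continuousOn fun τ _ => hv' τ).trans (by
      gcongr
      exact hexp ht)
  have hweak : ∀ t ∈ Icc a b, ‖Hs.toL2L hs0 (v t - u t)‖ ≤ η := by
    intro t ht
    refine (H.norm_J_sub_le hv.continuousOn (hu.continuousOn.mono (hsub ht)) (fun τ _ => hv' τ)
      fun τ hτ => hu' τ (hsub ht hτ)).trans ?_
    have h1 : ‖Hs.toL2L hs0 (v₀ - u₀)‖ ≤ η / (2 * E) := (Hs.norm_toL2_le hs0 _).trans hδ3.le
    calc _ ≤ 2 * (η / (2 * E)) * E := by gcongr; exact hexp ht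
      _ = η := by field_simp
  have hstrong : ∀ t ∈ Icc a b, ‖v t - u t‖ ≤ ε := by
    intro t ht
    refine (H.norm_sub_le (ε := ε / (4 * K * E * (T + 1))) (by positivity) hv.continuousOn
      (hu.continuousOn.mono (hsub ht)) (fun τ _ => hv' τ)
      (fun τ hτ => hu' τ (hsub ht hτ)) fun τ hτ => hΦ _ _ (hvn τ (hsub ht hτ))
        (hun τ (hsub ht hτ)) (hweak τ (hsub ht hτ))).trans ?_
    have htT' : |t| ≤ T + 1 := (htT ht).trans (by linarith)
    calc _ ≤ 2 * (K * (ε / (4 * K * E) + ε / (4 * K * E * (T + 1)) * (T + 1))) * E := by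
          gcongr
          exact hexp ht
      _ = ε := by field_simp; norm_num
  refine ⟨v, (hsol _ v₀ v ordConnected_Icc h0 hv.continuousOn fun t ht => ?_).2
    fun t _ => hv' t, hstrong⟩
  calc ‖v t‖ = ‖u t + (v t - u t)‖ := by rw [add_sub_cancel]
    _ ≤ _ := (norm_add_le _ _).trans (add_le_add (hB t ht) (hstrong t ht))

end

/-- Local well-posedness in `H^s(ℝ)`, `1/2 < s < 1`, of the nonlinear Schrödinger equation with a
delta potential: the propagator
`e^{i t Δ_γ}` exists; solutions exist on a time interval whose length depends only
on the size of the initial datum; they are unique in `C(I; H^s)` on every interval `I ∋ 0`; and they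
depend continuously on the initial datum on every compact interval of existence. -/
theorem mainTheorem6 (γ p s : ℝ) (hγ : γ ≠ 0) (hp : 1 < p) (hs : 1 / 2 < s) (hs' : s < 1) :
    IsDeltaPropagator γ (deltaPropagator γ) ∧
    (∀ R : ℝ, 0 < R → ∃ T : ℝ, 0 < T ∧ ∀ u₀ : Hs s, ‖u₀‖ ≤ R →
      ∃ u : ℝ → Hs s, IsSolution γ p s (Icc (-T) T) u₀ u) ∧
    (∀ (I : Set ℝ), I.OrdConnected → (0 : ℝ) ∈ I → ∀ (u₀ : Hs s) (u v : ℝ → Hs s),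
      IsSolution γ p s I u₀ u → IsSolution γ p s I u₀ v → EqOn u v I) ∧
    (∀ (a b : ℝ), a ≤ 0 → 0 ≤ b → ∀ (u₀ : Hs s) (u : ℝ → Hs s),
      IsSolution γ p s (Icc a b) u₀ u → ∀ ε : ℝ, 0 < ε → ∃ δ : ℝ, 0 < δ ∧
        ∀ v₀ : Hs s, ‖v₀ - u₀‖ < δ → ∃ v : ℝ → Hs s,
          IsSolution γ p s (Icc a b) v₀ v ∧ ∀ t ∈ Icc a b, ‖v t - u t‖ ≤ ε) := by
  refine ⟨isDeltaPropagator_deltaPropagator hγ, fun R hR => local_existence hγ hp hs hs' hR,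
    fun I hI h0 u₀ u v hu hv => solution_unique hγ hp hs hs' hI h0 hu hv,
    fun a b ha hb u₀ u hu ε hε => continuous_dependence hγ hp hs hs' ha hb hu hε⟩
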